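/- Let $N\ge 2$, $n=N-1$, $\chi=\kappa^2=2N/(N-1)$, $\kappa>0$. View $SU(N)$ as $SU(N)\times SU(N)/\mathrm{diag}$ via $(\psi,\varphi)\mapsto\psi\varphi^{-1}$, with metric $g(Y,Z)=-\tfrac12\mathrm{tr}(e(Y)e(Z))$, where $e(Y)=\tfrac12\gamma^{-1}Y$ for $Y\in T_\gamma SU(N)$; let $\nabla$ be its Levi-Civita derivative and let $\mathrm{ad}(Y)Z$ be defined by $e(\mathrm{ad}(Y)Z)=[e(Y),e(Z)]$. Vectors in $\mathbb C^{n}$ are rows, $a\cdot b=\sum a_jb_j$, $a\otimes b=a^{T}b$, $v\lrcorner S=vS$, $a\cdot^\dagger b=\tfrac12(a\cdot b+\bar b\cdot\bar a)$, $a\wedge^\dagger b=a\otimes b-\bar b\otimes\bar a$, $a\odot^\dagger b=a\otimes b+\bar b\otimes\bar a$. **Hierarchy.** On differential polynomials in $v,\bar v$ put $\mathcal I=\mathrm i$, $$\mathcal H=D_x-2\mathrm i D_x^{-1}(\bar v\cdot^\dagger\mathrm i\;)v+v\lrcorner D_x^{-1}(\bar v\wedge^\dagger\;),\qquad \mathcal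 R=\mathrm i\big(D_x+2D_x^{-1}(\bar v\cdot^\dagger\;)v+v\lrcorner D_x^{-1}(\bar v\odot^\dagger\;)\big).$$ Then $\mathcal H,\mathcal I$ are a compatible pair of Hamiltonian operators (on covectors on which they act locally). The vector fields $\mathrm i h^{(k)}=\mathcal R^k(\mathrm i v)$, $k\ge0$ (with $D_x^{-1}$ normalized to have no constant term), are differential polynomials, and there are real differential polynomials $H^{(k)}$ with $\delta H^{(k)}/\delta\bar v=-h^{(k)}$. For every $k\ge 0$ the flow $v_t=\mathrm i(h^{(k+2)}-\chi h^{(k)})$ is bi-Hamiltonian: its right hand side is $-\mathcal I\big(\delta(H^{(k+2)}-\chi H^{(k)})/\delta\bar v\big)$ and is a value of $\mathcal H$ at $\delta(H^{(k+1)}-\chi H^{(k-1)})/\delta\bar v$, where $H^{(-1)}=0$ (the constants in $D_x^{-1}$ being free in this last $\mathcal H$). **Curves.** Let $\gamma(t,x)$ be a smooth flow of non-stretching curves ($g(\gamma_x,\gamma_x)=1$) in $SU(N)$, on a product of two open intervals, with an $SU(N)$-parallel frame: a smooth lift $(\psi,\varphi)$, $\gamma=\psi\varphi^{-1}$, such that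 the half difference $e$ and the half sum $\omega$ of $\psi^{-1}d\psi$ and $\varphi^{-1}d\varphi$ satisfy $$e_x=\kappa\tfrac{\mathrm i}{N}\,\mathrm{diag}(1-N,1,\dots,1),\qquad \omega_x=\begin{pmatrix}0&v\\-v^\dagger&0\end{pmatrix}.$$ The principal normal $\nabla_x\gamma_x$ then has the frame matrix $\kappa\mathrm i\begin{pmatrix}0&v\\ v^\dagger&0\end{pmatrix}$. Write $e_t=\kappa\begin{pmatrix}-\mathrm i h&h_\perp\\-h_\perp^\dagger&\mathbf h\end{pmatrix}$. For $k\ge0$ the $+(k+1)$ flow is given by $h_\perp=h^{(k)}$, $h=-2D_x^{-1}(\bar v\cdot^\dagger\mathrm ih_\perp)$, $\mathbf h=-\mathrm iD_x^{-1}(\bar v\odot^\dagger\mathrm ih_\perp)$, evaluated at $v$ and with no constants of integration; the $0$ flow by $e_t=e_x$; the $-1$ flow by $\mathcal R(\mathrm i h_\perp)=0$, with antiderivatives in $\mathcal R$ those that give $h,\mathbf h$ by the same formulas. Then: 1. $\gamma$ is a $0$ flow iff $\gamma_t=\gamma_x$ (convective map); then $v_t=v_x$ in a suitable parallel frame. 2.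 For each $k\ge 0$ there is a noncommutative polynomial $f_k$ such that $\gamma$ is a $+(k+1)$ flow iff $\gamma_t=f_k(\gamma_x,\nabla_x\gamma_x,\nabla_x^2\gamma_x,\dots)$ (evaluated through $e$). It has order $k+1$: up to terms in $\nabla_x^j\gamma_x$, $j\le k$, it is $(-1)^m\chi^{-1/2}\mathrm{ad}(\gamma_x)\nabla_x^{2m+1}\gamma_x$ for $k=2m$ and $(-1)^m\nabla_x^{2m+2}\gamma_x$ for $k=2m+1$. In a suitable parallel frame, in which $\gamma$ is again a $+(k+1)$ flow, $v_t=\mathrm i(h^{(k+2)}-\chi h^{(k)})$. 3. $\gamma$ is a $+1$ flow iff it is a chiral Schrödinger map, $\gamma_t=\chi^{-1/2}\mathrm{ad}(\gamma_x)\nabla_x\gamma_x$; then in a suitable parallel frame $v$ satisfies the vector NLS equation $\mathrm iv_t=v_{xx}+2|v|^2v+\chi v$. 4. $\gamma$ is a $+2$ flow iff it is a chiral mKdV map, $\gamma_t=\nabla_x^2\gamma_x-\tfrac32\chi^{-1}\mathrm{ad}(\nabla_x\gamma_x)^2\gamma_x$; then in a suitable parallel frame $v$ satisfies the complex vector mKdV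 equation $v_t=v_{xxx}+3|v|^2v_x+3(v_x\cdot\bar v)v+\chi v_x$. 5. $\gamma$ is a $-1$ flow iff it is a chiral wave map, $\nabla_t\gamma_x=0$; then in a suitable parallel frame $\omega_t=0$ and $v_t=-\chi\mathrm ih_\perp$. If, in such a frame, $|\gamma_t|_g=2/\chi$ and $\mathbf h=\alpha\mathrm i\,\bar h_\perp\otimes h_\perp+\beta\mathrm i\mathbf 1$ with smooth real functions $\alpha,\beta$, and if at each point $v,h_\perp$ are linearly independent or $\alpha(h+\beta)=-1$, then $\alpha=-(h+\beta)^{-1}$ everywhere, $\beta=-2\sigma/(N\chi)$ with a constant sign $\sigma=\pm1$, and $v$ satisfies the complex vector hyperbolic equation $$\sigma v_{tx}=(1+r)v-(1-r)|v_t|^{-2}(v\cdot\bar v_t)v_t,\qquad r^2=1-|v_t|^2,$$ with a smooth real function $r$ (at points with $v_t=0$ one has $r=1$ and the last term is absent). -/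

import Mathlib

open scoped Matrix ContDiff

noncomputable section

namespace SUCurveFlow

/-! ### Hermitian products of row vectors, and the matrices of the parallel frame -/

section Products

variable {A : Type*} [CommRing A] [Algebra ℂ A] {n : ℕ}

/-- `a · b = ∑ aⱼ bⱼ` (no conjugation). -/
def dot (a b : Fin n → A) : A := ∑ j, a j * b j

/-- `(a ⊗ b)ᵢⱼ = aᵢ bⱼ`. -/
def outer (a b : Fin n → A) : Matrix (Fin n) (Fin n) A := Matrix.of fun i j => a i * b j

/-- `a ·† b = ½ a·b + ½ b̄·ā`, where `c` is the conjugation of `A`. -/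
def hdot (c : A → A) (a b : Fin n → A) : A :=
  (1 / 2 : ℂ) • dot a b + (1 / 2 : ℂ) • dot (c ∘ b) (c ∘ a)

/-- `a ∧† b = a ⊗ b - b̄ ⊗ ā`. -/
def hwedge (c : A → A) (a b : Fin n → A) : Matrix (Fin n) (Fin n) A :=
  outer a b - outer (c ∘ b) (c ∘ a)

/-- `a ⊙† b = a ⊗ b + b̄ ⊗ ā`. -/
def hsym (c : A → A) (a b : Fin n → A) : Matrix (Fin n) (Fin n) A :=
  outer a b + outer (c ∘ b) (c ∘ a)

/-- Value `i (u_x + 2 s v + v ⌟ S)` of the recursion operator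
`R = i (D_x + 2 D_x⁻¹(v̄ ·† ) v + v ⌟ D_x⁻¹(v̄ ⊙† ))` at `u`, where `ux` is the `x`-derivative
of `u` and `s`, `S` are the antiderivatives of `v̄ ·† u` and `v̄ ⊙† u` that are used. -/
def recValue (v ux : Fin n → A) (s : A) (S : Matrix (Fin n) (Fin n) A) : Fin n → A :=
  Complex.I • (ux + (2 : ℂ) • (s • v) + v ᵥ* S)

end Products

/-! ### Differential polynomials in `v`, `v̄` and their `x`-derivatives -/

/-- `inl (j, k)` is the jet coordinate `∂ₓᵏ vⱼ`, `inr (j, k)` is its conjugate. -/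
abbrev JetVar (n : ℕ) : Type := (Fin n × ℕ) ⊕ (Fin n × ℕ)

/-- Differential polynomials: polynomial functions on the `x`-jet space of `v`. -/
abbrev DiffPoly (n : ℕ) : Type := MvPolynomial (JetVar n) ℂ

variable {n : ℕ}

/-- The total derivative `D_x`. -/
def totalD (n : ℕ) : Derivation ℂ (DiffPoly n) (DiffPoly n) :=
  MvPolynomial.mkDerivation ℂ (Sum.elim
    (fun a => MvPolynomial.X (Sum.inl (a.1, a.2 + 1)))
    (fun a => MvPolynomial.X (Sum.inr (a.1, a.2 + 1))))

/-- Complex conjugation of differential polynomials. -/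
def jconj (n : ℕ) : DiffPoly n →+* DiffPoly n :=
  MvPolynomial.eval₂Hom (MvPolynomial.C.comp (starRingEnd ℂ))
    (fun a => MvPolynomial.X a.swap)

/-- The coordinate vector `v`. -/
def jv (n : ℕ) : Fin n → DiffPoly n := fun j => MvPolynomial.X (Sum.inl (j, 0))

/-- The coordinate vector `v̄`. -/
def jvbar (n : ℕ) : Fin n → DiffPoly n := fun j => MvPolynomial.X (Sum.inr (j, 0))

/-- The derivation of differential polynomials given by the evolutionary vector field with
characteristic `X`, that is by `v_t = X`, `v̄_t = X̄`. -/
def evol (X : Fin n → DiffPoly n) : Derivation ℂ (DiffPoly n) (DiffPoly n) :=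
  MvPolynomial.mkDerivation ℂ (Sum.elim
    (fun a => (totalD n)^[a.2] (X a.1))
    (fun a => (totalD n)^[a.2] (jconj n (X a.1))))

/-- The variational derivative `δF/δv̄`. -/
def varDeriv (F : DiffPoly n) : Fin n → DiffPoly n := fun j =>
  ∑ᶠ k : ℕ, (-1 : DiffPoly n) ^ k *
    (totalD n)^[k] (MvPolynomial.pderiv (Sum.inr (j, k)) F)

/-- Density of the real pairing `∫ (ξ·X̄ + ξ̄·X) dx` of a covector field with a vector field;
for `ξ = δF/δv̄` with `F` real it gives the derivative of `∫ F dx` along `X`. -/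
def pairing (ξ X : Fin n → DiffPoly n) : DiffPoly n :=
  dot ξ (jconj n ∘ X) + dot (jconj n ∘ ξ) X

/-- `F` is a total `x`-derivative, so that `∫ F dx` is zero as a formal functional. -/
def IsExact (F : DiffPoly n) : Prop := ∃ G, totalD n G = F

/-- Density of `⟨L_X ξ, Y⟩ = X⟨ξ, Y⟩ - ⟨ξ, [X, Y]⟩`, where `L_X ξ` is the Lie derivative of the
covector field `ξ` along the evolutionary vector field `X`. -/
def liePairing (X ξ Y : Fin n → DiffPoly n) : DiffPoly n :=
  pairing (fun j => evol X (ξ j)) Y + pairing ξ (fun j => evol Y (X j))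

/-- A possibly nonlocal operator from covector fields to vector fields, given by its graph:
`P ξ X` says that `X` is a value of the operator at `ξ`. -/
abbrev Operator (n : ℕ) : Type := (Fin n → DiffPoly n) → (Fin n → DiffPoly n) → Prop

/-- Hamiltonian (cosymplectic) operators in Dorfman's sense: the graph is isotropic (the operator
is skew-adjoint) and the trilinear form `∑ ⟨L_{X₁} ξ₂, X₃⟩` (cyclic sum) vanishes on it (the
Schouten bracket of the operator with itself vanishes, so that the Poisson bracket satisfies the
Jacobi identity). -/
def IsHamiltonianOp (P : Operator n) : Prop :=
  (∀ ξ X η Y, P ξ X → P η Y → IsExact (pairing ξ Y + pairing η X)) ∧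
  (∀ ξ₁ X₁ ξ₂ X₂ ξ₃ X₃, P ξ₁ X₁ → P ξ₂ X₂ → P ξ₃ X₃ →
    IsExact (liePairing X₁ ξ₂ X₃ + liePairing X₂ ξ₃ X₁ + liePairing X₃ ξ₁ X₂))

/-- The graph of `a P + b Q`. -/
def pencil (a b : ℝ) (P Q : Operator n) : Operator n := fun ξ X =>
  ∃ Y Z, P ξ Y ∧ Q ξ Z ∧ X = (a : ℂ) • Y + (b : ℂ) • Z

/-- `P`, `Q` are compatible Hamiltonian operators. -/
def IsHamiltonianPair (P Q : Operator n) : Prop :=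
  IsHamiltonianOp P ∧ IsHamiltonianOp Q ∧ ∀ a b : ℝ, IsHamiltonianOp (pencil a b P Q)

/-- The operator `H = D_x - 2i D_x⁻¹(v̄ ·† i ) v + v ⌟ D_x⁻¹(v̄ ∧† )`. Here `D_x⁻¹` stands for
any antiderivative among the differential polynomials with the same reality property as the
integrand. In particular `H` acts on `δF/δv̄` for every real `U(n)`-invariant `F`. -/
def opH (n : ℕ) : Operator n := fun ξ X =>
  ∃ (s : DiffPoly n) (S : Matrix (Fin n) (Fin n) (DiffPoly n)),
    jconj n s = s ∧ (S.map (jconj n))ᵀ = -S ∧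
    totalD n s = hdot (jconj n) (jvbar n) (Complex.I • ξ) ∧
    S.map (totalD n) = hwedge (jconj n) (jvbar n) ξ ∧
    X = (fun j => totalD n (ξ j)) - (2 * Complex.I : ℂ) • (s • jv n) + jv n ᵥ* S

/-- The operator `I = i`. -/
def opI (n : ℕ) : Operator n := fun ξ X => X = Complex.I • ξ

/-- The hierarchy of Hamiltonian vector fields `i h⁽ᵏ⁾ = Rᵏ (i v)`, together with the
antiderivatives `s⁽ᵏ⁾ = D_x⁻¹(v̄ ·† i h⁽ᵏ⁾)` and `S⁽ᵏ⁾ = D_x⁻¹(v̄ ⊙† i h⁽ᵏ⁾)` that occur in `R`.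
These are differential polynomials without constant term, which determines them. -/
structure Hierarchy (n : ℕ) where
  h : ℕ → Fin n → DiffPoly n
  s : ℕ → DiffPoly n
  S : ℕ → Matrix (Fin n) (Fin n) (DiffPoly n)
  h_zero : h 0 = jv n
  s_real : ∀ k, jconj n (s k) = s k
  S_herm : ∀ k, ((S k).map (jconj n))ᵀ = S k
  s_deriv : ∀ k, totalD n (s k) = hdot (jconj n) (jvbar n) (Complex.I • h k)
  S_deriv : ∀ k, (S k).map (totalD n) = hsym (jconj n) (jvbar n) (Complex.I • h k)
  s_const : ∀ k, MvPolynomial.constantCoeff (s k) = 0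
  S_const : ∀ k i j, MvPolynomial.constantCoeff (S k i j) = 0
  h_succ : ∀ k, Complex.I • h (k + 1) =
    recValue (jv n) (fun j => totalD n (Complex.I • h k j)) (s k) (S k)

/-! ### Constants -/

/-- `χ = κ² = 2N/(N-1)` for `N = n + 1`. -/
def chi (n : ℕ) : ℝ := 2 * (n + 1) / n

/-- `κ`, the factor that gives `e_x` unit norm. -/
def kappa (n : ℕ) : ℝ := √(chi n)

/-- The right hand side `i (h⁽ᵏ⁺²⁾ - χ h⁽ᵏ⁾)` of the `+(k+1)` flow on `v`. -/
def Hierarchy.flow (𝓗 : Hierarchy n) (k : ℕ) : Fin n → DiffPoly n :=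
  Complex.I • (𝓗.h (k + 2) - (chi n : ℂ) • 𝓗.h k)

/-! ### Geometry of `SU(N)`, `N = n + 1`, along a map `γ(t, x)` -/

/-- `N × N` complex matrices in block form. -/
abbrev Mat (n : ℕ) : Type := Matrix (Unit ⊕ Fin n) (Unit ⊕ Fin n) ℂ

/-- `∂f/∂x` for a function of `(t, x)`. -/
def dx (f : ℝ × ℝ → ℂ) : ℝ × ℝ → ℂ := fun p => deriv (fun y => f (p.1, y)) p.2

/-- `∂f/∂t` for a function of `(t, x)`. -/
def dt (f : ℝ × ℝ → ℂ) : ℝ × ℝ → ℂ := fun p => deriv (fun y => f (y, p.2)) p.1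

/-- Entrywise `∂/∂x`. -/
def mdx (F : ℝ × ℝ → Mat n) : ℝ × ℝ → Mat n := fun p =>
  Matrix.of fun i j => dx (fun q => F q i j) p

/-- Entrywise `∂/∂t`. -/
def mdt (F : ℝ × ℝ → Mat n) : ℝ × ℝ → Mat n := fun p =>
  Matrix.of fun i j => dt (fun q => F q i j) p

/-- Entrywise smoothness on an open set. -/
def SmoothMat (F : ℝ × ℝ → Mat n) (U : Set (ℝ × ℝ)) : Prop :=
  ∀ i j, ContDiffOn ℝ ∞ (fun q => F q i j) U

/-- The left-invariant coframe on `SU(N) ≃ SU(N) × SU(N) / diag`, applied to a vector `Y` at `g`: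
the antisymmetric part `½ g⁻¹ Y` of the Maurer-Cartan form `(g⁻¹ Y, 0)` of `SU(N) × SU(N)`
along the section `g ↦ (g, 1)`. -/
def coframe (g Y : Mat n) : Mat n := (1 / 2 : ℂ) • (gᴴ * Y)

/-- The Riemannian metric `g(Y, Z) = -½ tr(e(Y) e(Z))`. -/
def metric (g Y Z : Mat n) : ℝ := -(1 / 2) * ((coframe g Y * coframe g Z).trace).re

/-- `ad(Y) Z` on the tangent space at `g`: `e(ad(Y) Z) = [e(Y), e(Z)]`. -/
def adT (g Y Z : Mat n) : Mat n := (2 : ℂ) • (g * ⁅coframe g Y, coframe g Z⁆)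

/-- The Levi-Civita covariant derivative `∇_x` of a vector field `Y` along `γ`, for the
bi-invariant metric: `γ⁻¹ ∇_x Y = ∂_x (γ⁻¹ Y) + ½ [γ⁻¹ γ_x, γ⁻¹ Y]`. -/
def covX (γ Y : ℝ × ℝ → Mat n) : ℝ × ℝ → Mat n := fun p =>
  γ p * (mdx (fun q => (γ q)ᴴ * Y q) p +
    (1 / 2 : ℂ) • ⁅(γ p)ᴴ * mdx γ p, (γ p)ᴴ * Y p⁆)

/-- The Levi-Civita covariant derivative `∇_t`. -/
def covT (γ Y : ℝ × ℝ → Mat n) : ℝ × ℝ → Mat n := fun p =>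
  γ p * (mdt (fun q => (γ q)ᴴ * Y q) p +
    (1 / 2 : ℂ) • ⁅(γ p)ᴴ * mdt γ p, (γ p)ᴴ * Y p⁆)

/-- A smooth flow `γ(t, x)` of non-stretching curves in `SU(N)`. -/
structure IsNonStretchingFlow (γ : ℝ × ℝ → Mat n) (U : Set (ℝ × ℝ)) : Prop where
  smooth : SmoothMat γ U
  mem : ∀ p ∈ U, γ p ∈ Matrix.specialUnitaryGroup (Unit ⊕ Fin n) ℂ
  unit : ∀ p ∈ U, metric (γ p) (mdx γ p) (mdx γ p) = 1

/-! ### Parallel frames -/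

/-- `e_x = κ (i/N) diag(1 - N, 1, …, 1)`. -/
def unitFrame (n : ℕ) : Mat n :=
  ((kappa n : ℂ) * Complex.I / (n + 1)) • Matrix.fromBlocks (Matrix.of fun _ _ => -(n : ℂ)) 0 0 1

/-- The skew-Hermitian matrix with rows `(0, v)` and `(-v†, 0)`. -/
def connMatrix (v : Fin n → ℂ) : Mat n :=
  Matrix.fromBlocks 0 (Matrix.replicateRow Unit v) (-(Matrix.replicateRow Unit v)ᴴ) 0

/-- The matrix `κ (-i h, h⊥; -h⊥†, 𝐡)`, with `h = (1 - 1/N) h∥` and `𝐡 = 𝐡⊥ + (i/N) h∥ 1`. -/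
def flowMatrix (hperp : Fin n → ℂ) (h : ℂ) (hmat : Matrix (Fin n) (Fin n) ℂ) : Mat n :=
  (kappa n : ℂ) • Matrix.fromBlocks (Matrix.of fun _ _ => -(Complex.I * h))
    (Matrix.replicateRow Unit hperp) (-(Matrix.replicateRow Unit hperp)ᴴ) hmat

/-- `e_x`, half the difference of the pullbacks of the Maurer-Cartan forms. -/
def frameX (ψ φ : ℝ × ℝ → Mat n) (p : ℝ × ℝ) : Mat n :=
  (1 / 2 : ℂ) • ((ψ p)ᴴ * mdx ψ p - (φ p)ᴴ * mdx φ p)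

/-- `e_t`. -/
def frameT (ψ φ : ℝ × ℝ → Mat n) (p : ℝ × ℝ) : Mat n :=
  (1 / 2 : ℂ) • ((ψ p)ᴴ * mdt ψ p - (φ p)ᴴ * mdt φ p)

/-- `ω_x`, half the sum of the pullbacks of the Maurer-Cartan forms. -/
def conX (ψ φ : ℝ × ℝ → Mat n) (p : ℝ × ℝ) : Mat n :=
  (1 / 2 : ℂ) • ((ψ p)ᴴ * mdx ψ p + (φ p)ᴴ * mdx φ p)

/-- `ω_t`. -/
def conT (ψ φ : ℝ × ℝ → Mat n) (p : ℝ × ℝ) : Mat n :=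
  (1 / 2 : ℂ) • ((ψ p)ᴴ * mdt ψ p + (φ p)ᴴ * mdt φ p)

/-- `(ψ, φ)` is a smooth lift of `γ` to `SU(N) × SU(N)`, the bundle being `(ψ, φ) ↦ ψ φ⁻¹`, for
which `e_x` is the constant unit vector `unitFrame` and `ω_x` is orthogonal to the isotropy
algebra `u(N-1)` of that vector: an `SU(N)`-parallel frame with connection components `v`. -/
structure IsParallelFrame (γ ψ φ : ℝ × ℝ → Mat n) (v : ℝ × ℝ → Fin n → ℂ)
    (U : Set (ℝ × ℝ)) : Prop where
  smooth_left : SmoothMat ψ U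
  smooth_right : SmoothMat φ U
  mem_left : ∀ p ∈ U, ψ p ∈ Matrix.specialUnitaryGroup (Unit ⊕ Fin n) ℂ
  mem_right : ∀ p ∈ U, φ p ∈ Matrix.specialUnitaryGroup (Unit ⊕ Fin n) ℂ
  lift : ∀ p ∈ U, γ p = ψ p * (φ p)ᴴ
  frame : ∀ p ∈ U, frameX ψ φ p = unitFrame n
  conn : ∀ p ∈ U, conX ψ φ p = connMatrix (v p)

/-- Substitution of a vector function `v(t, x)` and its `x`-derivatives into differential
polynomials, at the point `p`. -/
def evalJet (v : ℝ × ℝ → Fin n → ℂ) (p : ℝ × ℝ) : DiffPoly n →ₐ[ℂ] ℂ :=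
  MvPolynomial.aeval (Sum.elim
    (fun a => dx^[a.2] (fun q => v q a.1) p)
    (fun a => star (dx^[a.2] (fun q => v q a.1) p)))

/-- Componentwise `∂v/∂x`. -/
def vdx (v : ℝ × ℝ → Fin n → ℂ) : ℝ × ℝ → Fin n → ℂ := fun p j => dx (fun q => v q j) p

/-- Componentwise `∂v/∂t`. -/
def vdt (v : ℝ × ℝ → Fin n → ℂ) : ℝ × ℝ → Fin n → ℂ := fun p j => dt (fun q => v q j) p

/-! ### The flows -/

/-- The `0` flow: `h⊥ = 0`, `𝐡⊥ = 0`, `h∥ = 1`. -/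
def IsZeroFlow (ψ φ : ℝ × ℝ → Mat n) (U : Set (ℝ × ℝ)) : Prop :=
  ∀ p ∈ U, frameT ψ φ p = flowMatrix 0 (1 - 1 / (n + 1)) ((Complex.I / (n + 1)) • 1)

/-- The `+(k+1)` flow: `h⊥ = h⁽ᵏ⁾`, and `h = -2 D_x⁻¹(v̄ ·† i h⊥)`, `𝐡 = -i D_x⁻¹(v̄ ⊙† i h⊥)`. -/
def IsFlow (𝓗 : Hierarchy n) (k : ℕ) (ψ φ : ℝ × ℝ → Mat n) (v : ℝ × ℝ → Fin n → ℂ)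
    (U : Set (ℝ × ℝ)) : Prop :=
  ∀ p ∈ U, frameT ψ φ p = flowMatrix (fun j => evalJet v p (𝓗.h k j))
    (-2 * evalJet v p (𝓗.s k)) (-(Complex.I • (𝓗.S k).map (evalJet v p)))

/-- The `-1` flow: `R (i h⊥) = 0`, where the antiderivatives in `R` are those that give
`h = -2 D_x⁻¹(v̄ ·† i h⊥)` and `𝐡 = -i D_x⁻¹(v̄ ⊙† i h⊥)`. -/
def IsMinusOneFlow (ψ φ : ℝ × ℝ → Mat n) (v : ℝ × ℝ → Fin n → ℂ) (U : Set (ℝ × ℝ)) : Prop :=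
  ∃ (hperp : ℝ × ℝ → Fin n → ℂ) (s : ℝ × ℝ → ℂ) (S : ℝ × ℝ → Matrix (Fin n) (Fin n) ℂ),
    (∀ j, ContDiffOn ℝ ∞ (fun q => hperp q j) U) ∧ ContDiffOn ℝ ∞ s U ∧
    (∀ i j, ContDiffOn ℝ ∞ (fun q => S q i j) U) ∧
    ∀ p ∈ U,
      frameT ψ φ p = flowMatrix (hperp p) (-2 * s p) (-(Complex.I • S p)) ∧
      dx s p = hdot star (star (v p)) (Complex.I • hperp p) ∧
      (∀ i j, dx (fun q => S q i j) p = hsym star (star (v p)) (Complex.I • hperp p) i j) ∧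
      recValue (v p) (Complex.I • vdx hperp p) (s p) (S p) = 0

/-- The chiral Schrödinger map equation `γ_t = χ^{-1/2} ad(γ_x) ∇_x γ_x`. -/
def IsSchrodingerMap (γ : ℝ × ℝ → Mat n) (U : Set (ℝ × ℝ)) : Prop :=
  ∀ p ∈ U, mdt γ p = ((kappa n)⁻¹ : ℂ) • adT (γ p) (mdx γ p) (covX γ (mdx γ) p)

/-- The chiral mKdV map equation `γ_t = ∇_x² γ_x - (3/2) χ⁻¹ ad(∇_x γ_x)² γ_x`. -/
def IsMKdVMap (γ : ℝ × ℝ → Mat n) (U : Set (ℝ × ℝ)) : Prop :=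
  ∀ p ∈ U, mdt γ p = covX γ (covX γ (mdx γ)) p - (3 / 2 * (chi n : ℂ)⁻¹) •
    adT (γ p) (covX γ (mdx γ) p) (adT (γ p) (covX γ (mdx γ) p) (mdx γ p))

/-- The chiral wave map equation `∇_t γ_x = 0`. -/
def IsWaveMap (γ : ℝ × ℝ → Mat n) (U : Set (ℝ × ℝ)) : Prop :=
  ∀ p ∈ U, covT γ (mdx γ) p = 0

/-- The geometric map equation `γ_t = f(γ_x, ∇_x γ_x, ∇_x² γ_x, …)` given by a noncommutative
polynomial `f`, tangent vectors being identified with matrices by the left-invariant coframe. -/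
def IsGeometricMap (f : FreeAlgebra ℂ ℕ) (γ : ℝ × ℝ → Mat n) (U : Set (ℝ × ℝ)) : Prop :=
  ∀ p ∈ U, coframe (γ p) (mdt γ p) =
    FreeAlgebra.lift ℂ (fun j : ℕ => coframe (γ p) ((covX γ)^[j] (mdx γ) p)) f

/-- `f - g` involves only the variables `0, …, m - 1`. -/
def SameLeading (m : ℕ) (f g : FreeAlgebra ℂ ℕ) : Prop :=
  f - g ∈ Algebra.adjoin ℂ (FreeAlgebra.ι ℂ '' {j : ℕ | j < m})

end SUCurveFlow

end

noncomputable section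

namespace SUCurveFlow

set_option linter.unusedSectionVars false
set_option linter.unusedSimpArgs false
set_option linter.unnecessarySimpa false

/-! ### The formal spectral projector of the Lax operator -/

section ProjectorHierarchy

open PowerSeries Finset

variable {R : Type*} [Ring R] [Algebra ℂ R]

/-! The whole hierarchy is contained in one formal series. Let p be the projector onto the first
coordinate, W the matrix with rows (0, v) and (-v†, 0), and D = D_x + [W, ·]. There is an idempotent
Π = p + Π₁λ⁻¹ + Π₂λ⁻² + … with DΠ = -iλ[p, Π]; in other words, Π commutes with the Lax operator D_x
+ W + iλp of the vector NLS equation. The off-diagonal part of Πₖ₊₁ is obtained by differentiating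
Πₖ, and the block-diagonal part is forced algebraically by Π² = Π (`projSeq`, `projSeq_idem`,
`projSeq_deriv`). Nothing is ever integrated, so all entries are differential polynomials. The
blocks of iΠₖ₊₁ are h⁽ᵏ⁾, s⁽ᵏ⁾, S⁽ᵏ⁾, and DΠₖ₊₁ = -i[p, Πₖ₊₂] read block by block is the recursion
operator together with its antiderivatives (`jet_recursion`).

Hamiltonian structure. The curvature tr(Π[∂Π, δΠ]) of the projector, for the Euler derivative ∂ in
λ⁻¹ and a variation δ, yields a trace identity (`projSeq_trace_identity`); it makes a multiple of
s⁽ᵏ⁺¹⁾ a Hamiltonian density for h⁽ᵏ⁾. The graph of aH + bI consists of the off-diagonal data of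
matrices M for which (aD + ib[p, ·])M is off-diagonal. This operator is a derivation and skew for
the trace form modulo total derivatives, which gives both skewness and the Jacobi identity, for all
a, b at once (`isHamiltonianOp_of_graph`).

Geometry. In a parallel frame e_x = -iκ(p - 1/N), and ∇_x acts on frame matrices as D. So the Dʲp
represent ∇_xʲγ_x, and Πₖ₊₁, being a noncommutative polynomial in p, Dp, D²p, …, is a geometric
expression in γ with a computable leading term (`projSeq_leading`, `exists_geometric`). The flow
equation e_t = κiΠₖ₊₁ is therefore independent of the frame.

Evolution of v. The torsion equation determines the off-diagonal part of ω_t; the curvature equation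
shows that the remaining block-diagonal part is independent of x, so that a gauge transformation
g(t) removes it (`exists_gauge`, `exists_adapted_frame`). The off-diagonal part of the curvature
equation is then the equation for v. For the -1 flow the torsion equation says that ω_t is block
diagonal, which is ∇_tγ_x = 0; inserting the ansatz for 𝐡 into the flow equations reduces them to
algebra in h, α, β and |h⊥|² (`IsWaveFrame.alpha_mul`, `reduction_algebra`, `hyperbolic_rhs`). -/

lemma brk_add (a b c : R) : ⁅a, b + c⁆ = ⁅a, b⁆ + ⁅a, c⁆ := by
  simp only [Ring.lie_def, mul_add, add_mul]; abel

lemma brk_smul (z : ℂ) (a b : R) : ⁅a, z • b⁆ = z • ⁅a, b⁆ := by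
  simp only [Ring.lie_def, mul_smul_comm, smul_mul_assoc, smul_sub]

/-- The coefficients of the idempotent formal series `Π = p + ∑ Πₖ λ⁻ᵏ` that satisfies
`D Πₖ = -i [p, Πₖ₊₁]`, for a derivation `D` and an idempotent `p`. -/
def projSeq (p : R) (D : R →ₗ[ℂ] R) : ℕ → R
  | 0 => p
  | k + 1 => Complex.I • ⁅p, D (projSeq p D k)⁆ +
      (1 - 2 * p) * ∑ i : Fin k, projSeq p D (i + 1) * projSeq p D (k - i)
  decreasing_by all_goals omega

variable {p : R} {D : R →ₗ[ℂ] R}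

lemma projSeq_zero : projSeq p D 0 = p := by rw [projSeq]

lemma projSeq_succ (k : ℕ) : projSeq p D (k + 1) = Complex.I • ⁅p, D (projSeq p D k)⁆ +
    (1 - 2 * p) * ∑ i ∈ range k, projSeq p D (i + 1) * projSeq p D (k - i) := by
  rw [projSeq, Fin.sum_univ_eq_sum_range (fun i => projSeq p D (i + 1) * projSeq p D (k - i))]

lemma sum_antidiagonal_split (a : ℕ → R) (k : ℕ) :
    ∑ ij ∈ antidiagonal (k + 1), a ij.1 * a ij.2 =
      a 0 * a (k + 1) + a (k + 1) * a 0 + ∑ i ∈ range k, a (i + 1) * a (k - i) := by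
  rw [Nat.sum_antidiagonal_eq_sum_range_succ (fun i j => a i * a j), sum_range_succ,
    sum_range_succ']
  simp only [Nat.sub_zero, Nat.sub_self, Nat.add_sub_add_right]
  abel

/-- If a series is idempotent up to order `k`, then the quadratic error in order `k + 1` commutes
with the leading coefficient. -/
lemma commute_error (a : ℕ → R) (k : ℕ)
    (h : ∀ j ≤ k, ∑ ij ∈ antidiagonal j, a ij.1 * a ij.2 = a j) :
    a 0 * ∑ i ∈ range k, a (i + 1) * a (k - i) = (∑ i ∈ range k, a (i + 1) * a (k - i)) * a 0 := by
  -- Truncate at order k: the series f commutes with f² - f, whose lowest possibly nonzero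
  -- coefficient is the one of order k + 1. Comparing coefficients of order k + 1 in f(f² - f) = (f²
  -- - f)f gives the claim.
  set b : ℕ → R := fun j => if j ≤ k then a j else 0 with hb
  set f : R⟦X⟧ := PowerSeries.mk b with hf
  have hlow : ∀ j ≤ k, coeff j (f * f - f) = 0 := by
    intro j hj
    rw [map_sub, coeff_mul, hf, coeff_mk, sub_eq_zero, hb]
    simp only [hj, if_true]
    rw [← h j hj]
    refine sum_congr rfl fun ij hij => ?_
    have := mem_antidiagonal.1 hij
    simp only [coeff_mk]
    rw [if_pos (by omega), if_pos (by omega)]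
  have htop : coeff (k + 1) (f * f - f) = ∑ i ∈ range k, a (i + 1) * a (k - i) := by
    rw [map_sub, coeff_mul, hf]
    simp only [coeff_mk]
    rw [sum_antidiagonal_split b]
    have : b (k + 1) = 0 := by simp [hb]
    rw [this]
    simp only [mul_zero, zero_mul, add_zero, zero_add, sub_zero]
    refine sum_congr rfl fun i hi => ?_
    have := mem_range.1 hi
    rw [hb]
    simp only
    rw [if_pos (by omega), if_pos (by omega)]
  have h1 : coeff (k + 1) (f * (f * f - f)) = a 0 * ∑ i ∈ range k, a (i + 1) * a (k - i) := by
    rw [coeff_mul, sum_eq_single (0, k + 1)]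
    · rw [htop, hf, coeff_mk, hb]; simp
    · rintro ⟨i, j⟩ hij hne
      have := mem_antidiagonal.1 hij
      simp only at this ⊢
      rw [hlow j (by
        rcases Nat.eq_zero_or_pos i with rfl | hi
        · exact absurd (by ext <;> simp; simpa using this) hne
        · omega), mul_zero]
    · intro h; simp at h
  have h2 : coeff (k + 1) ((f * f - f) * f) = (∑ i ∈ range k, a (i + 1) * a (k - i)) * a 0 := by
    rw [coeff_mul, sum_eq_single (k + 1, 0)]
    · rw [htop, hf, coeff_mk, hb]; simp
    · rintro ⟨i, j⟩ hij hne
      have := mem_antidiagonal.1 hij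
      simp only at this ⊢
      rw [hlow i (by
        rcases Nat.eq_zero_or_pos j with rfl | hi
        · exact absurd (by ext <;> simp; simpa using this) hne
        · omega), zero_mul]
    · intro h; simp at h
  rw [← h1, ← h2, mul_sub, sub_mul, mul_assoc]

/-- The equation pb + bp = b expresses that b is off-diagonal for the Peirce decomposition of p. On
such elements ad p is an involution, which is the next lemma. -/
lemma lie_isOffDiag (hp : p * p = p) (a : R) : p * ⁅p, a⁆ + ⁅p, a⁆ * p = ⁅p, a⁆ := by
  rw [Ring.lie_def, mul_sub, sub_mul, ← mul_assoc, hp, mul_assoc a, hp, mul_assoc]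
  abel

lemma lie_lie_of_offDiag (hp : p * p = p) {a : R} (ha : p * a + a * p = a) : ⁅p, ⁅p, a⁆⁆ = a := by
  have h0 : p * a * p = 0 := by
    have := congrArg (p * ·) ha
    simp only [mul_add, ← mul_assoc, hp] at this
    simpa using this
  simp only [Ring.lie_def, mul_sub, sub_mul, ← mul_assoc, hp, h0]
  rw [mul_assoc a, hp]
  simpa using ha

lemma lie_lie_lie (hp : p * p = p) (a : R) : ⁅p, ⁅p, ⁅p, a⁆⁆⁆ = ⁅p, a⁆ :=
  lie_lie_of_offDiag hp (lie_isOffDiag hp a)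

/-- In order k + 1 the condition reads pX + Xp + C = X with C the sum of the products of lower
terms. It puts no constraint on the off-diagonal part of X, and since C commutes with p by
`commute_error`, the diagonal part (1 - 2p)C solves it. -/
theorem projSeq_idem (hp : p * p = p) (k : ℕ) :
    ∑ ij ∈ antidiagonal k, projSeq p D ij.1 * projSeq p D ij.2 = projSeq p D k := by
  induction k using Nat.strong_induction_on with
  | _ k ih =>
    rcases k with _ | k
    · simp [projSeq_zero, hp]
    · have hc := commute_error (projSeq p D) k fun j hj => ih j (by omega)
      rw [sum_antidiagonal_split (projSeq p D), projSeq_succ, projSeq_zero] at *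
      set C := ∑ i ∈ range k, projSeq p D (i + 1) * projSeq p D (k - i)
      set O : R := Complex.I • ⁅p, D (projSeq p D k)⁆ with hO
      have h1 : p * O + O * p = O := by
        rw [hO, mul_smul_comm, smul_mul_assoc, ← smul_add, lie_isOffDiag hp]
      have h2 : p * ((1 - 2 * p) * C) = -(p * C) := by
        rw [← mul_assoc, mul_sub, mul_one, two_mul, mul_add, hp]
        rw [show p - (p + p) = -p by abel, neg_mul]
      have h3 : (1 - 2 * p) * C * p = -(p * C) := by
        rw [mul_assoc, ← hc, ← mul_assoc, sub_mul, one_mul, mul_assoc, hp, two_mul]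
        rw [show p - (p + p) = -p by abel, neg_mul]
      calc p * (O + (1 - 2 * p) * C) + (O + (1 - 2 * p) * C) * p + C
          = (p * O + O * p) + (p * ((1 - 2 * p) * C) + (1 - 2 * p) * C * p + C) := by
            rw [mul_add, add_mul]; abel
        _ = O + (1 - 2 * p) * C := by
            rw [h1, h2, h3, sub_mul, one_mul, mul_assoc, two_mul]; abel

lemma projSeq_isOffDiag_lie (hp : p * p = p) (k : ℕ) :
    ⁅p, projSeq p D (k + 1)⁆ = Complex.I • ⁅p, ⁅p, D (projSeq p D k)⁆⁆ := by
  have hc := commute_error (projSeq p D) k fun j _ => projSeq_idem hp j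
  rw [projSeq_succ, projSeq_zero] at *
  set C := ∑ i ∈ range k, projSeq p D (i + 1) * projSeq p D (k - i)
  have : ⁅p, (1 - 2 * p) * C⁆ = 0 := by
    rw [Ring.lie_def, sub_eq_zero, mul_assoc, ← hc]
    simp only [mul_sub, sub_mul, one_mul, two_mul, mul_add, add_mul, ← mul_assoc, hp]
  rw [brk_add, this, add_zero, brk_smul]

/-- The recursion relation `D Πₖ = -i [p, Πₖ₊₁]`. -/
theorem projSeq_deriv (hp : p * p = p) (hD : ∀ a b, D (a * b) = D a * b + a * D b) (k : ℕ) :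
    D (projSeq p D k) = -(Complex.I • ⁅p, projSeq p D (k + 1)⁆) := by
  induction k using Nat.strong_induction_on with
  | _ k ih =>
    -- T is the defect of the recursion relation. Both D and ad p are derivations and the series is
    -- idempotent, so T obeys the Leibniz rule against it.
    set T : ℕ → R := fun j => D (projSeq p D j) + Complex.I • ⁅p, projSeq p D (j + 1)⁆ with hT
    have hT0 : ∀ j < k, T j = 0 := fun j hj => by rw [hT]; simp only; rw [ih j hj]; abel
    have hDk : D (projSeq p D k) = ∑ ij ∈ antidiagonal k,
        (D (projSeq p D ij.1) * projSeq p D ij.2 + projSeq p D ij.1 * D (projSeq p D ij.2)) := by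
      conv_lhs => rw [← projSeq_idem hp k, map_sum]
      exact sum_congr rfl fun _ _ => hD _ _
    have hl : ⁅p, projSeq p D (k + 1)⁆ = ∑ ij ∈ antidiagonal k,
        (⁅p, projSeq p D (ij.1 + 1)⁆ * projSeq p D ij.2 +
          projSeq p D ij.1 * ⁅p, projSeq p D (ij.2 + 1)⁆) := by
      have h1 : ⁅p, projSeq p D (k + 1)⁆ = ∑ ij ∈ antidiagonal (k + 1),
          (⁅p, projSeq p D ij.1⁆ * projSeq p D ij.2 +
            projSeq p D ij.1 * ⁅p, projSeq p D ij.2⁆) := by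
        conv_lhs => rw [← projSeq_idem hp (k + 1)]
        rw [Ring.lie_def, mul_sum, sum_mul, ← sum_sub_distrib]
        refine sum_congr rfl fun _ _ => ?_
        simp only [Ring.lie_def]; noncomm_ring
      rw [h1, sum_add_distrib, sum_add_distrib]
      congr 1
      · rw [Nat.antidiagonal_succ, sum_cons, sum_map]
        simp [projSeq_zero, Ring.lie_def]
      · rw [Nat.antidiagonal_succ', sum_cons, sum_map]
        simp [projSeq_zero, Ring.lie_def]
    have hTk : T k = ∑ ij ∈ antidiagonal k,
        (T ij.1 * projSeq p D ij.2 + projSeq p D ij.1 * T ij.2) := by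
      rw [hT]; simp only
      rw [hDk, hl, smul_sum, ← sum_add_distrib]
      refine sum_congr rfl fun _ _ => ?_
      simp only [add_mul, mul_add, smul_add, smul_mul_assoc, mul_smul_comm]
      abel
    -- Lower defects vanish, so the Leibniz rule leaves only the two terms with p: the defect is
    -- off-diagonal. By construction of Πₖ₊₁ its off-diagonal part is zero.
    have hoff : p * T k + T k * p = T k := by
      conv_rhs => rw [hTk]
      rw [sum_add_distrib, sum_eq_single (k, 0), sum_eq_single (0, k)]
      · simp only [projSeq_zero]; abel
      · rintro ⟨i, j⟩ hij hne
        have := mem_antidiagonal.1 hij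
        simp only at this ⊢
        rw [hT0 j (by
          rcases Nat.eq_zero_or_pos i with rfl | hi
          · exact absurd (by ext <;> simp; simpa using this) hne
          · omega), mul_zero]
      · intro h; simp at h
      · rintro ⟨i, j⟩ hij hne
        have := mem_antidiagonal.1 hij
        simp only at this ⊢
        rw [hT0 i (by
          rcases Nat.eq_zero_or_pos j with rfl | hi
          · exact absurd (by ext <;> simp; simpa using this) hne
          · omega), zero_mul]
      · intro h; simp at h
    have hz : T k = 0 := by
      rw [← lie_lie_of_offDiag hp hoff, hT]
      simp only
      rw [projSeq_isOffDiag_lie hp, brk_add, brk_add, brk_smul, brk_smul, brk_smul, brk_smul,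
        lie_lie_lie hp, smul_smul, Complex.I_mul_I, neg_one_smul, add_neg_cancel]
    rw [hT] at hz
    exact eq_neg_of_add_eq_zero_left hz

/-- i times a commutator of self-adjoint elements is self-adjoint. Reversing the summation shows the
same of the quadratic sum, and this survives the factor 1 - 2p because the sum commutes with p. -/
lemma projSeq_star [StarRing R] [StarModule ℂ R] (hp : p * p = p) (hs : star p = p)
    (hDs : ∀ a, D (star a) = star (D a)) (k : ℕ) : star (projSeq p D k) = projSeq p D k := by
  induction k using Nat.strong_induction_on with
  | _ k ih =>
    rcases k with _ | k
    · rw [projSeq_zero, hs]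
    · have hc := commute_error (projSeq p D) k fun j _ => projSeq_idem hp j
      rw [projSeq_zero] at hc
      rw [projSeq_succ, star_add, star_smul, star_mul, star_sum]
      have h1 : ∑ i ∈ range k, star (projSeq p D (i + 1) * projSeq p D (k - i)) =
          ∑ i ∈ range k, projSeq p D (i + 1) * projSeq p D (k - i) := by
        rw [← sum_range_reflect]
        refine sum_congr rfl fun i hi => ?_
        have := mem_range.1 hi
        rw [star_mul, ih _ (by omega), ih _ (by omega)]
        congr 2 <;> omega
      rw [h1]
      set C := ∑ i ∈ range k, projSeq p D (i + 1) * projSeq p D (k - i)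
      congr 1
      · rw [Ring.lie_def, star_sub, star_mul, star_mul, hs, ← hDs, ih k (by omega)]
        simp only [Complex.star_def, Complex.conj_I, neg_smul, ← smul_neg]
        congr 1; abel
      · rw [star_sub, star_mul, hs, star_one, mul_sub, sub_mul, mul_one, one_mul]
        congr 1
        rw [show star (2 : R) = 2 by simp, mul_two, two_mul, mul_add, add_mul, hc]

end ProjectorHierarchy

/-! ### The trace identity behind the Hamiltonians -/

section TraceIdentity

open PowerSeries Finset

/-- The coefficientwise extension of an additive map to power series. -/
def seriesMap {R S : Type*} [Ring R] [Ring S] (φ : R →+ S) : R⟦X⟧ →+ S⟦X⟧ where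
  toFun f := PowerSeries.mk fun k => φ (coeff k f)
  map_zero' := by ext; simp
  map_add' f g := by ext; simp

@[simp] lemma coeff_seriesMap {R S : Type*} [Ring R] [Ring S] (φ : R →+ S) (f : R⟦X⟧) (k : ℕ) :
    coeff k (seriesMap φ f) = φ (coeff k f) := by simp [seriesMap]

lemma seriesMap_mul {R : Type*} [Ring R] {φ : R →+ R}
    (h : ∀ a b, φ (a * b) = φ a * b + a * φ b) (f g : R⟦X⟧) :
    seriesMap φ (f * g) = seriesMap φ f * g + f * seriesMap φ g := by
  ext k
  simp only [coeff_seriesMap, coeff_mul, map_add, map_sum, h, sum_add_distrib]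

lemma seriesMap_trace {R A : Type*} [Ring R] [Ring A] {τ : R →+ A}
    (h : ∀ a b, τ (a * b) = τ (b * a)) (f g : R⟦X⟧) :
    seriesMap τ (f * g) = seriesMap τ (g * f) := by
  ext k
  simp only [coeff_seriesMap, coeff_mul, map_sum]
  rw [← Finset.Nat.sum_antidiagonal_swap]
  exact sum_congr rfl fun _ _ => h _ _

/-- The derivation `X d/dX` of power series. -/
def eulerSeries (R : Type*) [Ring R] : R⟦X⟧ →+ R⟦X⟧ where
  toFun f := PowerSeries.mk fun k => k • coeff k f
  map_zero' := by ext; simp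
  map_add' f g := by ext; simp

@[simp] lemma coeff_eulerSeries {R : Type*} [Ring R] (f : R⟦X⟧) (k : ℕ) :
    coeff k (eulerSeries R f) = k • coeff k f := by simp [eulerSeries]

lemma eulerSeries_mul {R : Type*} [Ring R] (f g : R⟦X⟧) :
    eulerSeries R (f * g) = eulerSeries R f * g + f * eulerSeries R g := by
  ext k
  simp only [coeff_eulerSeries, coeff_mul, map_add, smul_sum, ← sum_add_distrib]
  refine sum_congr rfl fun ij hij => ?_
  rw [← mem_antidiagonal.1 hij, add_smul, smul_mul_assoc, mul_smul_comm]

section Idempotent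

variable {S T : Type*} [Ring S] [AddCommGroup T] {t : S →+ T} {P : S}

/-- By invariance of the trace form the left side is -t([P, [P, a]] b) = -t(a [P, [P, b]]), and ad P
is an involution on the off-diagonal b. -/
lemma trace_idem_lie (ht : ∀ a b, t (a * b) = t (b * a)) (hP : P * P = P) (a : S) {b : S}
    (hb : P * b + b * P = b) : t (P * ⁅⁅a, P⁆, b⁆) = -t (a * b) := by
  have h0 : P * b * P = 0 := by
    have := congrArg (P * ·) hb
    simp only [mul_add, ← mul_assoc, hP] at this
    simpa using this
  have e : P * ⁅⁅a, P⁆, b⁆ = P * (a * P * b) - P * (a * b) - (P * b * a) * P + P * b * P * a := by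
    simp only [Ring.lie_def, mul_sub, sub_mul, ← mul_assoc, hP]
    abel
  have h1 : t (P * (a * P * b)) = 0 := by
    rw [ht, mul_assoc, mul_assoc, ← mul_assoc P, h0, mul_zero, map_zero]
  have h2 : t (P * (a * b)) = t (a * (b * P)) := by rw [ht, mul_assoc]
  have h3 : t (P * b * a * P) = t (a * (P * b)) := by
    rw [ht, ← mul_assoc, ← mul_assoc, hP, ht]
  rw [e, h0, zero_mul, add_zero, map_sub, map_sub, h1, h2, h3]
  conv_rhs => rw [← hb]
  rw [mul_add, map_add]
  abel

/-- Here a and b play the role of two variations of the idempotent P, and t(P[a, b]) is the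
curvature of the projector. The left side is its derivative along a direction in which P moves by
[j, P], while a and b move by [j, ·] corrected by the variations of j itself. -/
lemma trace_curvature (ht : ∀ a b, t (a * b) = t (b * a)) (hP : P * P = P) (j v : S) {a b : S}
    (ha : P * a + a * P = a) (hb : P * b + b * P = b) :
    t (⁅j, P⁆ * ⁅a, b⁆ + P * (⁅⁅j, a⁆ - ⁅j, P⁆, b⁆ + ⁅a, ⁅j, b⁆ - ⁅v, P⁆⁆)) =
      t (j * b) - t (v * a) := by
  have e : ⁅j, P⁆ * ⁅a, b⁆ + P * (⁅⁅j, a⁆ - ⁅j, P⁆, b⁆ + ⁅a, ⁅j, b⁆ - ⁅v, P⁆⁆) =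
      (j * (P * ⁅a, b⁆) - (P * ⁅a, b⁆) * j) - P * ⁅⁅j, P⁆, b⁆ + P * ⁅⁅v, P⁆, a⁆ := by
    simp only [Ring.lie_def]
    noncomm_ring
  rw [e, map_add, map_sub, map_sub, ht j, sub_self, trace_idem_lie ht hP j hb,
    trace_idem_lie ht hP v ha]
  abel

end Idempotent

variable {R A : Type*} [Ring R] [Algebra ℂ R] [Ring A] {p : R} {D : R →ₗ[ℂ] R}

/-- The trace identity: up to total derivatives, the variation of the trace of `-i p Πₖ₊₁` is `k`
times the trace of `w Πₖ`. -/
theorem projSeq_trace_identity (hp : p * p = p) (hD : ∀ a b, D (a * b) = D a * b + a * D b)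
    {τ : R →+ A} (hτ : ∀ a b, τ (a * b) = τ (b * a)) {d : A →+ A} (hd : ∀ a, d (τ a) = τ (D a))
    {δ : R →ₗ[ℂ] R} (hδ : ∀ a b, δ (a * b) = δ a * b + a * δ b) (hδp : δ p = 0) {w : R}
    (hw : ∀ a, δ (D a) = D (δ a) + ⁅w, a⁆) (k : ℕ) :
    ∃ G, d G = τ ((-Complex.I • p) * δ (projSeq p D (k + 1))) - k • τ (w * projSeq p D k) := by
  -- With X = λ⁻¹ and j = -ip the recursion becomes X·DP = [j, P]. The next three equations are this
  -- one, its image under the Euler derivation X d/dX, and its variation under δ, where w enters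
  -- through the commutator of δ with D.
  set P : R⟦X⟧ := PowerSeries.mk (projSeq p D) with hPdef
  set j : R⟦X⟧ := C (-Complex.I • p) with hj
  have hP : P * P = P := by
    ext k; rw [coeff_mul, hPdef]; simp only [coeff_mk]; exact projSeq_idem hp k
  have hPd : ∀ k, D (projSeq p D k) = ⁅-Complex.I • p, projSeq p D (k + 1)⁆ := fun k => by
    rw [projSeq_deriv hp hD]
    simp only [Ring.lie_def, smul_mul_assoc, mul_smul_comm, neg_smul, neg_mul, mul_neg, smul_sub]
    abel
  have hj0 : ⁅-Complex.I • p, p⁆ = 0 := by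
    simp only [Ring.lie_def, smul_mul_assoc, mul_smul_comm, sub_self]
  have hjc : ∀ (f : R⟦X⟧) (k : ℕ), coeff k ⁅j, f⁆ = ⁅-Complex.I • p, coeff k f⁆ := fun f k => by
    rw [hj, Ring.lie_def, Ring.lie_def, map_sub, coeff_C_mul, coeff_mul_C]
  set D' : R⟦X⟧ →+ R⟦X⟧ := seriesMap D.toAddMonoidHom with hD'
  set δ' : R⟦X⟧ →+ R⟦X⟧ := seriesMap δ.toAddMonoidHom with hδ'
  have hD'm : ∀ f g, D' (f * g) = D' f * g + f * D' g := seriesMap_mul hD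
  have hδ'm : ∀ f g, δ' (f * g) = δ' f * g + f * δ' g := seriesMap_mul hδ
  have e1 : X * D' P = ⁅j, P⁆ := by
    ext k
    rw [hjc, hPdef, coeff_mk]
    rcases k with _ | k
    · rw [coeff_zero_X_mul, projSeq_zero, hj0]
    · rw [coeff_succ_X_mul, hD', coeff_seriesMap, coeff_mk]; exact hPd k
  have e2 : X * D' (eulerSeries R P) = ⁅j, eulerSeries R P⁆ - ⁅j, P⁆ := by
    ext k
    rw [map_sub, hjc, hjc, hPdef, coeff_eulerSeries, coeff_mk]
    rcases k with _ | k
    · rw [coeff_zero_X_mul, projSeq_zero, hj0, zero_smul]; simp [Ring.lie_def]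
    · rw [coeff_succ_X_mul, hD', coeff_seriesMap, coeff_eulerSeries, coeff_mk, map_nsmul]
      change k • D (projSeq p D k) = _
      rw [hPd k, succ_nsmul]
      generalize -Complex.I • p = c
      simp only [Ring.lie_def, mul_add, add_mul, mul_smul_comm, smul_mul_assoc, smul_sub]
      abel
  have e3 : X * D' (δ' P) = ⁅j, δ' P⁆ - ⁅X * C w, P⁆ := by
    have hXw : ⁅X * C w, P⁆ = X * (C w * P - P * C w) := by
      rw [Ring.lie_def, mul_assoc, ← mul_assoc P, ← X_mul, mul_assoc X, ← mul_sub]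
    ext k
    rw [hXw, map_sub, hjc, hδ', coeff_seriesMap, hPdef]
    rcases k with _ | k
    · rw [coeff_zero_X_mul, coeff_zero_X_mul, coeff_mk, projSeq_zero]
      change 0 = ⁅-Complex.I • p, δ p⁆ - 0
      rw [hδp]; simp [Ring.lie_def]
    · rw [coeff_succ_X_mul, coeff_succ_X_mul, hD', coeff_seriesMap, coeff_seriesMap, coeff_mk,
        map_sub, coeff_C_mul, coeff_mul_C, coeff_mk, coeff_mk]
      change D (δ (projSeq p D k)) = ⁅-Complex.I • p, δ (projSeq p D (k + 1))⁆ - _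
      have := hw (projSeq p D k)
      rw [hPd k, Ring.lie_def, map_sub, hδ, hδ, map_smul, hδp] at this
      rw [Ring.lie_def]
      simp only [smul_zero, zero_mul, zero_add, mul_zero, add_zero] at this
      rw [this, Ring.lie_def, add_sub_cancel_right]
  have ha : P * eulerSeries R P + eulerSeries R P * P = eulerSeries R P := by
    conv_rhs => rw [← hP, eulerSeries_mul]
    abel
  have hb : P * δ' P + δ' P * P = δ' P := by
    conv_rhs => rw [← hP, hδ'm]
    abel
  have key := trace_curvature (t := seriesMap τ) (seriesMap_trace hτ) hP j (X * C w) ha hb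
  rw [← e3, ← e2, ← e1] at key
  have e4 : X * D' P * ⁅eulerSeries R P, δ' P⁆ + P * (⁅X * D' (eulerSeries R P), δ' P⁆ +
      ⁅eulerSeries R P, X * D' (δ' P)⁆) = X * D' (P * ⁅eulerSeries R P, δ' P⁆) := by
    simp only [Ring.lie_def, hD'm, map_sub]
    have hx : ∀ f g : R⟦X⟧, f * (X * g) = X * (f * g) := fun f g => by
      rw [← mul_assoc, ← X_mul, mul_assoc]
    simp only [mul_add, mul_sub, mul_assoc, hx]
    abel
  rw [e4] at key
  -- The curvature identity is compared in order k + 1; the factor X in front of the derivative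
  -- makes the antiderivative the coefficient of order k, and the Euler derivation produces the
  -- factor k.
  refine ⟨coeff k (seriesMap τ (P * ⁅eulerSeries R P, δ' P⁆)), ?_⟩
  have key' := congrArg (coeff (k + 1)) key
  rw [coeff_seriesMap, coeff_succ_X_mul, map_sub, coeff_seriesMap, coeff_seriesMap, coeff_seriesMap,
    mul_assoc, coeff_succ_X_mul, hj, coeff_C_mul, coeff_C_mul, coeff_eulerSeries, hδ', coeff_seriesMap,
    hPdef, coeff_mk, coeff_mk, mul_smul_comm, map_nsmul] at key'
  rw [coeff_seriesMap, hd]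
  exact key'

end TraceIdentity

/-! ### Leading terms as noncommutative polynomials in the derivatives of p -/

section LeadingTerms

open Finset

variable {R : Type*} [Ring R] [Algebra ℂ R]

/-- The subalgebra generated by the first `m` terms of a sequence. -/
def genBy (Y : ℕ → R) (m : ℕ) : Subalgebra ℂ R := Algebra.adjoin ℂ (Y '' {j | j < m})

lemma genBy_mono (Y : ℕ → R) {m m' : ℕ} (h : m ≤ m') : genBy Y m ≤ genBy Y m' :=
  Algebra.adjoin_mono (Set.image_mono fun _ hj => lt_of_lt_of_le hj h)

lemma mem_genBy (Y : ℕ → R) {j m : ℕ} (h : j < m) : Y j ∈ genBy Y m :=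
  Algebra.subset_adjoin ⟨j, h, rfl⟩

lemma genBy_lie (Y : ℕ → R) {m : ℕ} {a b : R} (ha : a ∈ genBy Y m) (hb : b ∈ genBy Y m) :
    ⁅a, b⁆ ∈ genBy Y m := by
  rw [Ring.lie_def]; exact sub_mem (mul_mem ha hb) (mul_mem hb ha)

variable {p : R} {D : R →ₗ[ℂ] R}

lemma derivation_one (hD : ∀ a b, D (a * b) = D a * b + a * D b) : D 1 = 0 := by
  have := hD 1 1
  simpa using this

lemma derivation_lie (hD : ∀ a b, D (a * b) = D a * b + a * D b) (a b : R) :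
    D ⁅a, b⁆ = ⁅D a, b⁆ + ⁅a, D b⁆ := by
  simp only [Ring.lie_def, map_sub, hD]; abel

lemma genBy_deriv (hD : ∀ a b, D (a * b) = D a * b + a * D b) {Y : ℕ → R}
    (hY : ∀ j, D (Y j) = Y (j + 1)) {m : ℕ} {a : R} (ha : a ∈ genBy Y m) :
    D a ∈ genBy Y (m + 1) := by
  induction ha using Algebra.adjoin_induction with
  | mem x hx =>
    obtain ⟨j, hj, rfl⟩ := hx
    rw [hY]; exact mem_genBy Y (Nat.succ_lt_succ hj)
  | algebraMap r =>
    rw [Algebra.algebraMap_eq_smul_one, map_smul, derivation_one hD, smul_zero]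
    exact zero_mem _
  | add x y _ _ hx hy => rw [map_add]; exact add_mem hx hy
  | mul x y hx' hy' hx hy =>
    rw [hD]
    exact add_mem (mul_mem hx (genBy_mono Y (Nat.le_succ m) hy'))
      (mul_mem (genBy_mono Y (Nat.le_succ m) hx') hy)

section

variable (hp : p * p = p) (hD : ∀ a b, D (a * b) = D a * b + a * D b)
include hp hD

/-- Differentiating p² = p repeatedly: all products in which both factors are differentiated have
lower order. Hence the derivatives of p are off-diagonal up to lower order. -/
lemma genBy_diag (j : ℕ) :
    p * D^[j + 1] p + D^[j + 1] p * p - D^[j + 1] p ∈ genBy (fun j => D^[j] p) (j + 1) := by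
  have hY : ∀ j, D (D^[j] p) = D^[j + 1] p := fun j => (Function.iterate_succ_apply' _ _ _).symm
  induction j with
  | zero =>
    have : p * D p + D p * p - D p = 0 := by
      conv_lhs => rw [← hp]
      rw [hD]
      simp only [hp]
      have h2 := congrArg D hp
      rw [hD] at h2
      rw [h2, add_comm, h2, sub_self]
    simp only [zero_add, Function.iterate_one, this]
    exact zero_mem _
  | succ j ih =>
    have h := genBy_deriv hD hY ih
    rw [map_sub, map_add, hD, hD, hY] at h
    have h1 : D p ∈ genBy (fun j => D^[j] p) (j + 1 + 1) :=
      mem_genBy (fun j => D^[j] p) (j := 1) (by omega)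
    have h2 : D^[j + 1] p ∈ genBy (fun j => D^[j] p) (j + 1 + 1) :=
      mem_genBy (fun j => D^[j] p) (by omega)
    have h3 := sub_mem h (add_mem (mul_mem h1 h2) (mul_mem h2 h1))
    convert h3 using 1
    abel

lemma genBy_offDiag (j : ℕ) :
    D^[j + 1] p - ⁅p, ⁅p, D^[j + 1] p⁆⁆ ∈ genBy (fun j => D^[j] p) (j + 1) := by
  have h := genBy_diag hp hD j
  set q := D^[j + 1] p
  have hpm : p ∈ genBy (fun j => D^[j] p) (j + 1) := mem_genBy (fun j => D^[j] p) (j := 0) (by omega)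
  have h2 := mul_mem hpm h
  have h3 := sub_mem (add_mem h2 h2) h
  convert h3 using 1
  simp only [Ring.lie_def, mul_sub, sub_mul, mul_add, ← mul_assoc, hp]
  rw [mul_assoc q, hp]
  abel

/-- Modulo lower order Πₖ₊₁ is i[p, DΠₖ]. Two such steps take Dʲp to i²[p, [p, Dʲ⁺²p]], and this is
-Dʲ⁺²p modulo lower order by `genBy_offDiag`; so the leading terms alternate between two shapes. The
third conjunct bounds the order of all terms so far and feeds the induction. -/
lemma projSeq_leading (m : ℕ) :
    (projSeq p D (2 * m) - ((-1 : ℂ) ^ m) • D^[2 * m] p ∈ genBy (fun j => D^[j] p) (2 * m)) ∧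
    (projSeq p D (2 * m + 1) - (Complex.I * (-1) ^ m) • ⁅p, D^[2 * m + 1] p⁆ ∈
      genBy (fun j => D^[j] p) (2 * m + 1)) ∧
    ∀ k ≤ 2 * m + 1, projSeq p D k ∈ genBy (fun j => D^[j] p) (k + 1) := by
  set Y : ℕ → R := fun j => D^[j] p with hYdef
  have hY : ∀ j, D (Y j) = Y (j + 1) := fun j => (Function.iterate_succ_apply' _ _ _).symm
  have hpm : ∀ k, p ∈ genBy Y (k + 1) := fun k => mem_genBy Y (j := 0) (by omega)
  -- The quadratic sum in Πₖ₊₁ involves only Π₁, …, Πₖ, which contain no derivative of p of order k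
  -- + 1.
  have step : ∀ k, (∀ j ≤ k, projSeq p D j ∈ genBy Y (j + 1)) →
      projSeq p D (k + 1) - Complex.I • ⁅p, D (projSeq p D k)⁆ ∈ genBy Y (k + 1) := by
    intro k hk
    rw [projSeq_succ, add_sub_cancel_left]
    refine mul_mem (sub_mem (one_mem _) ?_) (sum_mem fun i hi => ?_)
    · rw [two_mul]; exact add_mem (hpm k) (hpm k)
    · have := mem_range.1 hi
      exact mul_mem (genBy_mono Y (by omega) (hk (i + 1) (by omega)))
        (genBy_mono Y (by omega) (hk (k - i) (by omega)))
  have odd : ∀ m, projSeq p D (2 * m) - ((-1 : ℂ) ^ m) • Y (2 * m) ∈ genBy Y (2 * m) →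
      (∀ k ≤ 2 * m, projSeq p D k ∈ genBy Y (k + 1)) →
      projSeq p D (2 * m + 1) - (Complex.I * (-1) ^ m) • ⁅p, Y (2 * m + 1)⁆ ∈
        genBy Y (2 * m + 1) := by
    intro m h1 h2
    have h3 := genBy_deriv hD hY h1
    rw [map_sub, map_smul, hY] at h3
    have h4 := add_mem (step _ h2) (Subalgebra.smul_mem _ (genBy_lie Y (hpm _) h3) Complex.I)
    convert h4 using 1
    simp only [Ring.lie_def, mul_sub, sub_mul, smul_sub, mul_smul_comm, smul_mul_assoc, smul_smul]
    abel
  have full : ∀ k x, x ∈ genBy Y (k + 1) → projSeq p D k - x ∈ genBy Y k →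
      projSeq p D k ∈ genBy Y (k + 1) := fun k x hx h => by
    have := add_mem (genBy_mono Y (Nat.le_succ k) h) hx
    rwa [sub_add_cancel] at this
  have full_odd : ∀ m, projSeq p D (2 * m + 1) - (Complex.I * (-1) ^ m) • ⁅p, Y (2 * m + 1)⁆ ∈
      genBy Y (2 * m + 1) → (∀ k ≤ 2 * m, projSeq p D k ∈ genBy Y (k + 1)) →
      ∀ k ≤ 2 * m + 1, projSeq p D k ∈ genBy Y (k + 1) := by
    intro m h1 h2 k hk
    rcases Nat.lt_or_ge (2 * m) k with h | h
    · obtain rfl : k = 2 * m + 1 := by omega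
      exact full _ _ (Subalgebra.smul_mem _ (genBy_lie Y (hpm _) (mem_genBy Y (by omega))) _) h1
    · exact h2 k h
  induction m with
  | zero =>
    have h0 : projSeq p D (2 * 0) - ((-1 : ℂ) ^ 0) • Y (2 * 0) ∈ genBy Y (2 * 0) := by
      rw [mul_zero, projSeq_zero, pow_zero, one_smul, hYdef]
      simp
    have h1 : ∀ k ≤ 2 * 0, projSeq p D k ∈ genBy Y (k + 1) := by
      intro k hk
      obtain rfl : k = 0 := by omega
      rw [projSeq_zero]; exact hpm 0
    exact ⟨h0, odd 0 h0 h1, full_odd 0 (odd 0 h0 h1) h1⟩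
  | succ m ih =>
    obtain ⟨-, ih2, ih3⟩ := ih
    have h0 : projSeq p D (2 * (m + 1)) - ((-1 : ℂ) ^ (m + 1)) • Y (2 * (m + 1)) ∈
        genBy Y (2 * (m + 1)) := by
      have h3 := genBy_deriv hD hY ih2
      rw [map_sub, map_smul, derivation_lie hD, hY] at h3
      have h4 : ⁅D p, Y (2 * m + 1)⁆ ∈ genBy Y (2 * m + 1 + 1) :=
        genBy_lie Y (mem_genBy Y (j := 1) (by omega)) (mem_genBy Y (by omega))
      have h5 := add_mem h3 (Subalgebra.smul_mem _ h4 (Complex.I * (-1) ^ m))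
      have h6 := Subalgebra.smul_mem _ (genBy_lie Y (hpm (2 * m + 1)) h5) Complex.I
      have h7 := Subalgebra.smul_mem _ (genBy_offDiag hp hD (2 * m + 1)) ((-1 : ℂ) ^ m)
      have h8 := add_mem (add_mem (step _ ih3) h6) h7
      change projSeq p D (2 * m + 1 + 1) - ((-1 : ℂ) ^ (m + 1)) • Y (2 * m + 1 + 1) ∈
        genBy Y (2 * m + 1 + 1)
      convert h8 using 1
      have hI : Complex.I * (Complex.I * (-1) ^ m) = -(-1) ^ m := by
        rw [← mul_assoc, Complex.I_mul_I, neg_one_mul]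
      simp only [Ring.lie_def, mul_sub, sub_mul, smul_sub, mul_smul_comm, smul_mul_assoc,
        smul_smul, hI, pow_succ, mul_neg, mul_one, neg_smul, mul_add, add_mul, smul_add, hYdef]
      abel
    have h1 : ∀ k ≤ 2 * (m + 1), projSeq p D k ∈ genBy Y (k + 1) := by
      intro k hk
      rcases Nat.lt_or_ge (2 * m + 1) k with h | h
      · obtain rfl : k = 2 * (m + 1) := by omega
        exact full _ _ (Subalgebra.smul_mem _ (mem_genBy Y (by omega)) _) h0
      · exact ih3 k h
    exact ⟨h0, odd _ h0 h1, full_odd _ (odd _ h0 h1) h1⟩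

end

end LeadingTerms

/-! ### Block matrices and the recursion operator -/

section BlockMatrices

variable {A : Type*} [CommRing A] [StarRing A] [Algebra ℂ A] [StarModule ℂ A] {n : ℕ}

/-- The off-diagonal skew-Hermitian matrix with rows `(0, v)` and `(-v†, 0)`. -/
def offMat (v : Fin n → A) : Matrix (Unit ⊕ Fin n) (Unit ⊕ Fin n) A :=
  Matrix.fromBlocks 0 (Matrix.replicateRow Unit v) (-(Matrix.replicateRow Unit v)ᴴ) 0

/-- The matrix `(2 i s, b; -b†, -i S)`. -/
def blockMat (b : Fin n → A) (s : A) (S : Matrix (Fin n) (Fin n) A) :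
    Matrix (Unit ⊕ Fin n) (Unit ⊕ Fin n) A :=
  Matrix.fromBlocks (Matrix.of fun _ _ => (2 * Complex.I) • s) (Matrix.replicateRow Unit b)
    (-(Matrix.replicateRow Unit b)ᴴ) (-(Complex.I • S))

/-- The projector onto the first coordinate. -/
def projMat (A : Type*) [CommRing A] (n : ℕ) : Matrix (Unit ⊕ Fin n) (Unit ⊕ Fin n) A :=
  Matrix.fromBlocks 1 0 0 0

lemma projMat_mul_self : projMat A n * projMat A n = projMat A n := by
  simp [projMat, Matrix.fromBlocks_multiply]

lemma projMat_conjTranspose : (projMat A n)ᴴ = projMat A n := by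
  simp [projMat, Matrix.fromBlocks_conjTranspose]

lemma offMat_conjTranspose (v : Fin n → A) : (offMat v)ᴴ = -offMat v := by
  simp [offMat, Matrix.fromBlocks_conjTranspose, Matrix.fromBlocks_neg]

lemma algebraMap_I_mul_I : algebraMap ℂ A Complex.I * algebraMap ℂ A Complex.I = -1 := by
  rw [← map_mul, Complex.I_mul_I, map_neg, map_one]

lemma star_algebraMap_I : star (algebraMap ℂ A Complex.I) = -algebraMap ℂ A Complex.I := by
  rw [← algebraMap_star_comm, Complex.star_def, Complex.conj_I, map_neg]

/-- The covariant derivative of `(2 i s, b; -b†, -i S)` in terms of the recursion operator. -/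
lemma blockMat_add_lie (v b b' : Fin n → A) (s s' : A) (S S' : Matrix (Fin n) (Fin n) A)
    (hs : star s = s) (hS : Sᴴ = S) :
    blockMat b' s' S' + ⁅offMat v, blockMat b s S⁆ =
      blockMat (-recValue v (Complex.I • b') s S)
        (s' - hdot star (star v) (Complex.I • b))
        (S' - hsym star (star v) (Complex.I • b)) := by
  have hI := algebraMap_I_mul_I (A := A)
  have hI' := star_algebraMap_I (A := A)
  have h2 : algebraMap ℂ A (2⁻¹) * 2 = 1 := by
    rw [← map_ofNat (algebraMap ℂ A) 2, ← map_mul]; norm_num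
  have hS' : ∀ i j, star (S i j) = S j i := fun i j => by
    conv_rhs => rw [← hS]
    rfl
  have hst : ∀ x : A, star (Complex.I • x) = -(Complex.I • star x) := fun x => by
    rw [star_smul, Complex.star_def, Complex.conj_I, neg_smul]
  ext (i | i) (j | j)
  · simp only [offMat, blockMat, Ring.lie_def, Matrix.add_apply, Matrix.sub_apply,
      Matrix.mul_apply, Fintype.sum_sum_type, Matrix.fromBlocks_apply₁₁, Matrix.fromBlocks_apply₁₂,
      Matrix.fromBlocks_apply₂₁, Matrix.of_apply, Matrix.zero_apply, zero_mul, mul_zero,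
      Matrix.replicateRow_apply, Matrix.neg_apply, Matrix.conjTranspose_apply, hdot, dot,
      Pi.smul_apply, Pi.star_apply, Function.comp_apply, Finset.sum_const_zero, zero_add,
      mul_neg, Finset.sum_neg_distrib, one_div, hst, star_star, mul_smul_comm, smul_mul_assoc,
      neg_mul, ← Finset.smul_sum]
    have e1 : ∑ x, star (v x) * b x = ∑ x, b x * star (v x) :=
      Finset.sum_congr rfl fun _ _ => mul_comm _ _
    have e2 : ∑ x, star (b x) * v x = ∑ x, v x * star (b x) :=
      Finset.sum_congr rfl fun _ _ => mul_comm _ _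
    rw [e1, e2]
    simp only [Algebra.smul_def, map_mul, map_ofNat]
    linear_combination (∑ x, b x * star (v x) - ∑ x, v x * star (b x)) * hI *
      (algebraMap ℂ A 2⁻¹ * 2) + (∑ x, v x * star (b x) - ∑ x, b x * star (v x)) * h2
  · simp only [offMat, blockMat, recValue, Ring.lie_def, Matrix.add_apply, Matrix.sub_apply,
      Matrix.mul_apply, Fintype.sum_sum_type, Matrix.fromBlocks_apply₁₁, Matrix.fromBlocks_apply₁₂,
      Matrix.fromBlocks_apply₂₂, Matrix.of_apply, Matrix.zero_apply, zero_mul, mul_zero,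
      Matrix.replicateRow_apply, Matrix.neg_apply, Matrix.smul_apply, Pi.add_apply, Pi.neg_apply,
      Pi.smul_apply, Finset.sum_const_zero, zero_add, Finset.univ_unique, Finset.sum_singleton,
      mul_neg, Finset.sum_neg_distrib, Matrix.vecMul, dotProduct, mul_smul_comm, smul_mul_assoc,
      neg_mul, ← Finset.smul_sum, smul_eq_mul]
    simp only [Algebra.smul_def, map_mul, map_ofNat]
    linear_combination b' j * hI
  · simp only [offMat, blockMat, recValue, Ring.lie_def, Matrix.add_apply, Matrix.sub_apply,
      Matrix.mul_apply, Fintype.sum_sum_type, Matrix.fromBlocks_apply₁₁, Matrix.fromBlocks_apply₂₁,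
      Matrix.fromBlocks_apply₂₂, Matrix.of_apply, Matrix.zero_apply, zero_mul, mul_zero,
      Matrix.replicateRow_apply, Matrix.neg_apply, Matrix.smul_apply, Pi.add_apply, Pi.neg_apply,
      Pi.smul_apply, Finset.sum_const_zero, zero_add, Finset.univ_unique, Finset.sum_singleton,
      mul_neg, neg_mul, Matrix.vecMul, Matrix.conjTranspose_apply, dotProduct, add_zero, star_neg,
      mul_smul_comm, smul_mul_assoc, ← Finset.smul_sum, star_add, hst, star_sum, star_mul', hs, hS',
      star_smul, star_ofNat, smul_eq_mul, neg_neg, smul_neg, Finset.sum_neg_distrib, neg_zero]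
    have e1 : ∑ x, S i x * star (v x) = ∑ x, star (v x) * S i x :=
      Finset.sum_congr rfl fun _ _ => mul_comm _ _
    rw [e1]
    simp only [Algebra.smul_def, map_mul, map_ofNat]
    linear_combination -star (b' i) * hI
  · simp only [offMat, blockMat, Ring.lie_def, Matrix.add_apply, Matrix.sub_apply,
      Matrix.mul_apply, Fintype.sum_sum_type, Matrix.fromBlocks_apply₂₂, Matrix.fromBlocks_apply₁₂,
      Matrix.fromBlocks_apply₂₁, Matrix.of_apply, Matrix.zero_apply, zero_mul, mul_zero,
      Matrix.replicateRow_apply, Matrix.neg_apply, Matrix.conjTranspose_apply, hsym, outer,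
      Pi.smul_apply, Pi.star_apply, Function.comp_apply, Finset.sum_const_zero, add_zero,
      Finset.univ_unique, Finset.sum_singleton, Matrix.smul_apply,
      mul_neg, neg_mul, hst, star_star, mul_smul_comm, smul_mul_assoc, smul_zero, neg_zero]
    simp only [Algebra.smul_def, map_mul, map_ofNat]
    linear_combination (star (b i) * v j - star (v i) * b j) * hI

lemma blockMat_inj {b b' : Fin n → A} {s s' : A} {S S' : Matrix (Fin n) (Fin n) A}
    (h : blockMat b s S = blockMat b' s' S') : b = b' ∧ s = s' ∧ S = S' := by
  rw [blockMat, blockMat, Matrix.fromBlocks_inj] at h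
  obtain ⟨h1, h2, -, h4⟩ := h
  refine ⟨?_, ?_, ?_⟩
  · ext j; exact congrFun (congrFun h2 ()) j
  · have := congrFun (congrFun h1 ()) ()
    simp only [Matrix.of_apply] at this
    have h3 := congrArg ((2 * Complex.I)⁻¹ • ·) this
    simpa [smul_smul] using h3
  · have h3 := congrArg (Complex.I • ·) h4
    simpa [smul_smul] using h3

lemma offMat_eq_blockMat (b : Fin n → A) : offMat b = blockMat b 0 0 := by
  ext (i | i) (j | j) <;> simp [offMat, blockMat]

end BlockMatrices

/-! ### Derivations of matrix algebras -/

section MatrixDerivations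

variable {A : Type*} [CommRing A] [Algebra ℂ A] {m : Type*} [Fintype m]

/-- The entrywise extension of a derivation to matrices. -/
def matDeriv (m : Type*) (d : Derivation ℂ A A) : Matrix m m A →ₗ[ℂ] Matrix m m A :=
  (d : A →ₗ[ℂ] A).mapMatrix

lemma matDeriv_apply (d : Derivation ℂ A A) (M : Matrix m m A) (i j : m) :
    matDeriv m d M i j = d (M i j) := rfl

lemma matDeriv_mul (d : Derivation ℂ A A) (M N : Matrix m m A) :
    matDeriv m d (M * N) = matDeriv m d M * N + M * matDeriv m d N := by
  ext i j
  simp only [matDeriv_apply, Matrix.mul_apply, Matrix.add_apply, map_sum, Derivation.leibniz,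
    smul_eq_mul, ← Finset.sum_add_distrib]
  exact Finset.sum_congr rfl fun _ _ => by ring

lemma matDeriv_lie (d : Derivation ℂ A A) (M N : Matrix m m A) :
    matDeriv m d ⁅M, N⁆ = ⁅matDeriv m d M, N⁆ + ⁅M, matDeriv m d N⁆ := by
  simp only [Ring.lie_def, map_sub, matDeriv_mul]; abel

lemma matDeriv_trace (d : Derivation ℂ A A) (M : Matrix m m A) :
    (matDeriv m d M).trace = d M.trace := by
  simp [Matrix.trace, matDeriv_apply]

end MatrixDerivations

/-! ### Conjugation, total derivative and evolutionary fields -/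

section DiffPolyBasics

variable {n : ℕ}

lemma jconj_jconj (f : DiffPoly n) : jconj n (jconj n f) = f := by
  induction f using MvPolynomial.induction_on with
  | C a => simp [jconj]
  | add p q hp hq => rw [map_add, map_add, hp, hq]
  | mul_X p i hp => rw [map_mul, map_mul, hp]; simp [jconj]

/-- With conjugation as the star, conjugate transposes of matrices of differential polynomials make
sense, and the block computations apply both to jets and to their values. -/
instance : StarRing (DiffPoly n) where
  star := jconj n
  star_involutive := jconj_jconj
  star_mul a b := by rw [map_mul, mul_comm]
  star_add a b := map_add _ a b

lemma star_eq_jconj (f : DiffPoly n) : star f = jconj n f := rfl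

lemma coe_jconj : ⇑(jconj n) = (star : DiffPoly n → DiffPoly n) := rfl

@[simp] lemma star_C (a : ℂ) : star (MvPolynomial.C a : DiffPoly n) = MvPolynomial.C (star a) := by
  simp [star_eq_jconj, jconj]

@[simp] lemma star_X (a : JetVar n) :
    star (MvPolynomial.X a : DiffPoly n) = MvPolynomial.X a.swap := by
  simp [star_eq_jconj, jconj]

instance : StarModule ℂ (DiffPoly n) where
  star_smul z f := by rw [MvPolynomial.smul_eq_C_mul, star_mul', star_C, MvPolynomial.smul_eq_C_mul]

lemma jvbar_eq : jvbar n = star (jv n) := by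
  ext1 j; simp [jvbar, jv]

lemma totalD_X_inl (a : Fin n × ℕ) :
    totalD n (MvPolynomial.X (Sum.inl a)) = MvPolynomial.X (Sum.inl (a.1, a.2 + 1)) := by
  simp [totalD, MvPolynomial.mkDerivation_X]

lemma totalD_X_inr (a : Fin n × ℕ) :
    totalD n (MvPolynomial.X (Sum.inr a)) = MvPolynomial.X (Sum.inr (a.1, a.2 + 1)) := by
  simp [totalD, MvPolynomial.mkDerivation_X]

lemma totalD_star (f : DiffPoly n) : totalD n (star f) = star (totalD n f) := by
  induction f using MvPolynomial.induction_on with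
  | C a => rw [star_C, MvPolynomial.derivation_C, MvPolynomial.derivation_C, star_zero]
  | add p q hp hq => rw [star_add, map_add, hp, hq, map_add, star_add]
  | mul_X p i hp =>
    rw [star_mul', Derivation.leibniz, Derivation.leibniz, hp, star_add, smul_eq_mul, smul_eq_mul,
      smul_eq_mul, smul_eq_mul, star_mul', star_mul']
    congr 2
    rcases i with a | a <;> simp [totalD_X_inl, totalD_X_inr]

lemma iterate_totalD_star (k : ℕ) (f : DiffPoly n) :
    (totalD n)^[k] (star f) = star ((totalD n)^[k] f) := by
  induction k with
  | zero => rfl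
  | succ k ih => rw [Function.iterate_succ_apply', ih, totalD_star, Function.iterate_succ_apply']

lemma evol_X_inl (X : Fin n → DiffPoly n) (a : Fin n × ℕ) :
    evol X (MvPolynomial.X (Sum.inl a)) = (totalD n)^[a.2] (X a.1) := by
  simp [evol, MvPolynomial.mkDerivation_X]

lemma evol_X_inr (X : Fin n → DiffPoly n) (a : Fin n × ℕ) :
    evol X (MvPolynomial.X (Sum.inr a)) = (totalD n)^[a.2] (star (X a.1)) := by
  simp [evol, MvPolynomial.mkDerivation_X, star_eq_jconj]

lemma evol_star (X : Fin n → DiffPoly n) (f : DiffPoly n) : evol X (star f) = star (evol X f) := by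
  induction f using MvPolynomial.induction_on with
  | C a => rw [star_C, MvPolynomial.derivation_C, MvPolynomial.derivation_C, star_zero]
  | add p q hp hq => rw [star_add, map_add, hp, hq, map_add, star_add]
  | mul_X p i hp =>
    rw [star_mul', Derivation.leibniz, Derivation.leibniz, hp, star_add, smul_eq_mul, smul_eq_mul,
      smul_eq_mul, smul_eq_mul, star_mul', star_mul']
    congr 2
    rcases i with a | a <;> simp [evol_X_inl, evol_X_inr, iterate_totalD_star]

/-- The commutator is a derivation, so it suffices that it vanishes on the jet coordinates. -/
lemma evol_totalD (X : Fin n → DiffPoly n) (f : DiffPoly n) :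
    evol X (totalD n f) = totalD n (evol X f) := by
  have : ⁅evol X, totalD n⁆ = 0 := by
    refine MvPolynomial.derivation_ext fun i => ?_
    rw [Derivation.commutator_apply]
    rcases i with a | a
    · rw [totalD_X_inl, evol_X_inl, evol_X_inl, Function.iterate_succ_apply']; simp
    · rw [totalD_X_inr, evol_X_inr, evol_X_inr, Function.iterate_succ_apply']; simp
  have h := DFunLike.congr_fun this f
  rw [Derivation.commutator_apply] at h
  exact sub_eq_zero.1 h

lemma constantCoeff_totalD (f : DiffPoly n) : MvPolynomial.constantCoeff (totalD n f) = 0 := by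
  induction f using MvPolynomial.induction_on with
  | C a => rw [MvPolynomial.derivation_C, map_zero]
  | add p q hp hq => rw [map_add, map_add, hp, hq, add_zero]
  | mul_X p i hp =>
    rw [Derivation.leibniz, smul_eq_mul, smul_eq_mul, map_add, map_mul, map_mul, hp]
    rcases i with a | a <;> simp [totalD_X_inl, totalD_X_inr]

end DiffPolyBasics

/-! ### Construction of the hierarchy from the projector series -/

section HierarchyConstruction

variable {n : ℕ}

lemma lie_projMat_apply {A : Type*} [CommRing A] (M : Matrix (Unit ⊕ Fin n) (Unit ⊕ Fin n) A) :
    (∀ i j, ⁅projMat A n, M⁆ (Sum.inl i) (Sum.inl j) = 0) ∧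
    (∀ i j, ⁅projMat A n, M⁆ (Sum.inl i) (Sum.inr j) = M (Sum.inl i) (Sum.inr j)) ∧
    (∀ i j, ⁅projMat A n, M⁆ (Sum.inr i) (Sum.inl j) = -M (Sum.inr i) (Sum.inl j)) ∧
    (∀ i j, ⁅projMat A n, M⁆ (Sum.inr i) (Sum.inr j) = 0) := by
  refine ⟨?_, ?_, ?_, ?_⟩ <;> intro i j <;>
    simp [projMat, Ring.lie_def, Matrix.mul_apply, Fintype.sum_sum_type]

/-- `N × N` matrices of differential polynomials in block form. -/
abbrev JetMat (n : ℕ) : Type := Matrix (Unit ⊕ Fin n) (Unit ⊕ Fin n) (DiffPoly n)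

/-- The covariant derivative `D_x + [W, ·]`, where `W` has rows `(0, v)` and `(-v†, 0)`. -/
def jetCov (n : ℕ) : JetMat n →ₗ[ℂ] JetMat n :=
  matDeriv _ (totalD n) + (LinearMap.mulLeft ℂ (offMat (jv n)) - LinearMap.mulRight ℂ (offMat (jv n)))

lemma jetCov_apply (M : JetMat n) :
    jetCov n M = matDeriv _ (totalD n) M + ⁅offMat (jv n), M⁆ := rfl

lemma jetCov_mul (M N : JetMat n) : jetCov n (M * N) = jetCov n M * N + M * jetCov n N := by
  simp only [jetCov_apply, matDeriv_mul, Ring.lie_def]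
  noncomm_ring

lemma matDeriv_conjTranspose {d : Derivation ℂ (DiffPoly n) (DiffPoly n)}
    (hd : ∀ f, d (star f) = star (d f)) (M : JetMat n) :
    matDeriv _ d Mᴴ = (matDeriv _ d M)ᴴ := by
  ext i j; simp [matDeriv_apply, hd]

lemma matDeriv_offMat {d : Derivation ℂ (DiffPoly n) (DiffPoly n)}
    (hd : ∀ f, d (star f) = star (d f)) (v : Fin n → DiffPoly n) :
    matDeriv _ d (offMat v) = offMat fun j => d (v j) := by
  ext (i | i) (j | j) <;> simp [matDeriv_apply, offMat, hd]

lemma matDeriv_blockMat {d : Derivation ℂ (DiffPoly n) (DiffPoly n)}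
    (hd : ∀ f, d (star f) = star (d f)) (b : Fin n → DiffPoly n) (s : DiffPoly n)
    (S : Matrix (Fin n) (Fin n) (DiffPoly n)) :
    matDeriv _ d (blockMat b s S) = blockMat (fun j => d (b j)) (d s) (S.map d) := by
  ext (i | i) (j | j) <;> simp [matDeriv_apply, blockMat, hd]

lemma jetCov_conjTranspose (M : JetMat n) : jetCov n (star M) = star (jetCov n M) := by
  have h : ⁅offMat (jv n), M⁆ᴴ = ⁅offMat (jv n), Mᴴ⁆ := by
    rw [Ring.lie_def, Ring.lie_def, Matrix.conjTranspose_sub, Matrix.conjTranspose_mul,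
      Matrix.conjTranspose_mul, offMat_conjTranspose, mul_neg, neg_mul, neg_sub_neg]
  rw [Matrix.star_eq_conjTranspose, Matrix.star_eq_conjTranspose, jetCov_apply, jetCov_apply,
    Matrix.conjTranspose_add, h, matDeriv_conjTranspose totalD_star]

/-- Only W depends on v, and its variation is `offMat X`. This is the commutation hypothesis of the
trace identity, with w = `offMat X`. -/
lemma matDeriv_evol_jetCov (X : Fin n → DiffPoly n) (M : JetMat n) :
    matDeriv _ (evol X) (jetCov n M) = jetCov n (matDeriv _ (evol X) M) + ⁅offMat X, M⁆ := by
  have h1 : matDeriv _ (evol X) (matDeriv _ (totalD n) M) =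
      matDeriv _ (totalD n) (matDeriv _ (evol X) M) := by
    ext i j; simp [matDeriv_apply, evol_totalD]
  have h2 : matDeriv _ (evol X) (offMat (jv n)) = offMat X := by
    rw [matDeriv_offMat (evol_star X)]
    congr 1; ext1 j
    rw [jv, evol_X_inl]; rfl
  rw [jetCov_apply, jetCov_apply, map_add, h1, matDeriv_lie, h2]
  abel

/-- The coefficients `Πₖ` of the projector hierarchy over the differential polynomials. -/
def jetProj (n : ℕ) : ℕ → JetMat n := projSeq (projMat (DiffPoly n) n) (jetCov n)

lemma jetProj_conjTranspose (k : ℕ) : (jetProj n k)ᴴ = jetProj n k :=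
  projSeq_star projMat_mul_self projMat_conjTranspose jetCov_conjTranspose k

lemma jetProj_star (k : ℕ) (i j : Unit ⊕ Fin n) : star (jetProj n k j i) = jetProj n k i j := by
  conv_rhs => rw [← jetProj_conjTranspose]
  rfl

lemma jetCov_jetProj (k : ℕ) : jetCov n (jetProj n k) =
    -(Complex.I • ⁅projMat (DiffPoly n) n, jetProj n (k + 1)⁆) :=
  projSeq_deriv projMat_mul_self jetCov_mul k

/-- At the zero jet W vanishes, and total derivatives have no constant term, so every value of D has
none. The quadratic terms follow by induction. This normalizes the antiderivatives s⁽ᵏ⁾ and S⁽ᵏ⁾. -/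
lemma jetProj_const (k : ℕ) :
    MvPolynomial.constantCoeff.mapMatrix (jetProj n (k + 1)) = 0 := by
  have hsmul : ∀ (z : ℂ) (M : JetMat n), MvPolynomial.constantCoeff.mapMatrix (z • M) =
      z • MvPolynomial.constantCoeff.mapMatrix M := fun z M => by
    ext i j; simp
  have hW : MvPolynomial.constantCoeff.mapMatrix (offMat (jv n)) = 0 := by
    ext (i | i) (j | j) <;> simp [offMat, jv]
  have hcov : ∀ M : JetMat n, MvPolynomial.constantCoeff.mapMatrix (jetCov n M) = 0 := fun M => by
    have : MvPolynomial.constantCoeff.mapMatrix (matDeriv _ (totalD n) M) = 0 := by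
      ext i j; simp [matDeriv_apply, constantCoeff_totalD]
    rw [jetCov_apply, map_add, this, Ring.lie_def, map_sub, map_mul, map_mul, hW]
    simp
  induction k using Nat.strong_induction_on with
  | _ k ih =>
    rw [jetProj, projSeq_succ, map_add, hsmul, map_mul, map_sum, Ring.lie_def, map_sub, map_mul,
      map_mul, hcov, Finset.sum_eq_zero fun i hi => ?_]
    · simp
    · rw [map_mul]
      have := ih i (Finset.mem_range.1 hi)
      rw [jetProj] at this
      rw [this, zero_mul]

/-- The differential polynomials `h⁽ᵏ⁾`. -/
def jetH (n k : ℕ) (j : Fin n) : DiffPoly n := Complex.I • jetProj n (k + 1) (Sum.inl ()) (Sum.inr j)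

/-- The differential polynomials `s⁽ᵏ⁾`. -/
def jetS (n k : ℕ) : DiffPoly n := (1 / 2 : ℂ) • jetProj n (k + 1) (Sum.inl ()) (Sum.inl ())

/-- The differential polynomials `S⁽ᵏ⁾`. -/
def jetT (n k : ℕ) : Matrix (Fin n) (Fin n) (DiffPoly n) :=
  Matrix.of fun i j => -jetProj n (k + 1) (Sum.inr i) (Sum.inr j)

lemma blockMat_jet (k : ℕ) :
    blockMat (jetH n k) (jetS n k) (jetT n k) = Complex.I • jetProj n (k + 1) := by
  ext1 (i | i) (j | j)
  · simp only [blockMat, jetS, Matrix.fromBlocks_apply₁₁, Matrix.of_apply, Matrix.smul_apply,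
      smul_smul]
    congr 1; ring
  · simp [blockMat, jetH]
  · simp [blockMat, jetH, jetProj_star]
  · simp [blockMat, jetT]

lemma star_jetS (k : ℕ) : star (jetS n k) = jetS n k := by
  rw [jetS, star_smul, jetProj_star]; simp

lemma conjTranspose_jetT (k : ℕ) : (jetT n k)ᴴ = jetT n k := by
  ext1 i j; simp [jetT, jetProj_star]

/-- This is D(iΠₖ₊₁) = [p, Πₖ₊₂] in blocks. The right side has no diagonal blocks, so the diagonal
says that s⁽ᵏ⁾ and S⁽ᵏ⁾ are the required antiderivatives; the off-diagonal block is the recursion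
for h⁽ᵏ⁺¹⁾. -/
lemma jet_recursion (k : ℕ) :
    blockMat (-recValue (jv n) (Complex.I • fun j => totalD n (jetH n k j)) (jetS n k) (jetT n k))
        (totalD n (jetS n k) - hdot star (star (jv n)) (Complex.I • jetH n k))
        ((jetT n k).map (totalD n) - hsym star (star (jv n)) (Complex.I • jetH n k)) =
      ⁅projMat (DiffPoly n) n, jetProj n (k + 2)⁆ := by
  rw [← blockMat_add_lie _ _ _ _ _ _ _ (star_jetS k) (conjTranspose_jetT k),
    ← matDeriv_blockMat totalD_star, ← jetCov_apply, blockMat_jet, map_smul, jetCov_jetProj,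
    smul_neg, smul_smul, Complex.I_mul_I, neg_one_smul, neg_neg]

/-- The hierarchy of Hamiltonian vector fields. -/
def jetHierarchy (n : ℕ) : Hierarchy n where
  h := jetH n
  s := jetS n
  S := jetT n
  h_zero := by
    ext1 j
    have hD : jetCov n (projMat (DiffPoly n) n) = ⁅offMat (jv n), projMat (DiffPoly n) n⁆ := by
      rw [jetCov_apply]
      have : matDeriv _ (totalD n) (projMat (DiffPoly n) n) = 0 := by
        ext1 (i | i) (j | j) <;> simp [matDeriv_apply, projMat]
      rw [this, zero_add]
    rw [jetH, jetProj, projSeq_succ, projSeq_zero, hD, Finset.range_zero, Finset.sum_empty,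
      mul_zero, add_zero, Matrix.smul_apply, (lie_projMat_apply _).2.1, smul_smul, Complex.I_mul_I]
    simp [Ring.lie_def, offMat, projMat, Matrix.mul_apply, Fintype.sum_sum_type]
  s_real := star_jetS
  S_herm k := conjTranspose_jetT k
  s_deriv k := by
    have h := congrFun (congrFun (jet_recursion (n := n) k) (Sum.inl ())) (Sum.inl ())
    rw [(lie_projMat_apply _).1, coe_jconj, jvbar_eq] at *
    simp only [blockMat, Matrix.fromBlocks_apply₁₁, Matrix.of_apply] at h
    have h2 := congrArg ((2 * Complex.I)⁻¹ • ·) h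
    simp only [smul_smul, smul_zero] at h2
    rw [inv_mul_cancel₀ (by simp), one_smul] at h2
    exact sub_eq_zero.1 h2
  S_deriv k := by
    rw [coe_jconj, jvbar_eq]
    ext1 i j
    have h := congrFun (congrFun (jet_recursion (n := n) k) (Sum.inr i)) (Sum.inr j)
    rw [(lie_projMat_apply _).2.2.2] at h
    simp only [blockMat, Matrix.fromBlocks_apply₂₂, Matrix.neg_apply, Matrix.smul_apply] at h
    have h2 := congrArg (Complex.I • ·) h
    simp only [smul_neg, smul_smul, smul_zero, Complex.I_mul_I, neg_one_smul, neg_neg] at h2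
    exact sub_eq_zero.1 h2
  s_const k := by
    have h := congrFun (congrFun (jetProj_const (n := n) k) (Sum.inl ())) (Sum.inl ())
    simp only [RingHom.mapMatrix_apply, Matrix.map_apply, Matrix.zero_apply] at h
    simp [jetS, h]
  S_const k i j := by
    have h := congrFun (congrFun (jetProj_const (n := n) k) (Sum.inr i)) (Sum.inr j)
    simp only [RingHom.mapMatrix_apply, Matrix.map_apply, Matrix.zero_apply] at h
    simp [jetT, h]
  h_succ k := by
    ext1 j
    have h := congrFun (congrFun (jet_recursion (n := n) k) (Sum.inl ())) (Sum.inr j)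
    rw [(lie_projMat_apply _).2.1] at h
    simp only [blockMat, Matrix.fromBlocks_apply₁₂, Matrix.replicateRow_apply, Pi.neg_apply] at h
    rw [Pi.smul_apply, jetH, ← h, smul_smul, Complex.I_mul_I, neg_one_smul, neg_neg]
    congr 2
    ext1 j
    simp

end HierarchyConstruction

/-! ### Formal calculus of variations -/

section VariationalCalculus

variable {n : ℕ}

lemma IsExact.add {F G : DiffPoly n} (hF : IsExact F) (hG : IsExact G) : IsExact (F + G) := by
  obtain ⟨a, rfl⟩ := hF
  obtain ⟨b, rfl⟩ := hG
  exact ⟨a + b, map_add _ _ _⟩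

lemma IsExact.smul {F : DiffPoly n} (z : ℂ) (hF : IsExact F) : IsExact (z • F) := by
  obtain ⟨a, rfl⟩ := hF
  exact ⟨z • a, Derivation.map_smul _ _ _⟩

lemma IsExact.neg {F : DiffPoly n} (hF : IsExact F) : IsExact (-F) := by
  obtain ⟨a, rfl⟩ := hF
  exact ⟨-a, map_neg _ _⟩

lemma IsExact.sub {F G : DiffPoly n} (hF : IsExact F) (hG : IsExact G) : IsExact (F - G) := by
  rw [sub_eq_add_neg]; exact hF.add hG.neg

lemma isExact_zero : IsExact (0 : DiffPoly n) := ⟨0, map_zero _⟩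

lemma isExact_sum {ι : Type*} {s : Finset ι} {F : ι → DiffPoly n} (h : ∀ i ∈ s, IsExact (F i)) :
    IsExact (∑ i ∈ s, F i) :=
  Finset.sum_induction _ _ (fun _ _ => IsExact.add) isExact_zero h

lemma isExact_integrate_by_parts (k : ℕ) (a b : DiffPoly n) :
    IsExact ((totalD n)^[k] a * b - a * ((-1) ^ k * (totalD n)^[k] b)) := by
  induction k generalizing b with
  | zero => simpa using isExact_zero
  | succ k ih =>
    have h := ih (totalD n b)
    have h2 : IsExact (totalD n ((totalD n)^[k] a * b)) := ⟨_, rfl⟩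
    have h3 := h2.sub h
    convert h3 using 1
    rw [Derivation.leibniz, smul_eq_mul, smul_eq_mul, Function.iterate_succ_apply',
      Function.iterate_succ_apply, pow_succ]
    ring

lemma pderiv_star (a : JetVar n) (f : DiffPoly n) :
    MvPolynomial.pderiv a (star f) = star (MvPolynomial.pderiv a.swap f) := by
  induction f using MvPolynomial.induction_on with
  | C z => simp
  | add p q hp hq => rw [star_add, map_add, hp, hq, map_add, star_add]
  | mul_X p i hp =>
    rw [star_mul', Derivation.leibniz, Derivation.leibniz, hp, star_add, smul_eq_mul, smul_eq_mul,
      smul_eq_mul, smul_eq_mul, star_mul', star_mul', star_X, MvPolynomial.pderiv_X,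
      MvPolynomial.pderiv_X]
    congr 2
    by_cases h : a = i.swap
    · subst h; simp
    · have h2 : a.swap ≠ i := fun h3 => h (by rw [← h3, Sum.swap_swap])
      rw [Pi.single_eq_of_ne (Ne.symm h), Pi.single_eq_of_ne (Ne.symm h2), star_zero]

lemma pderiv_comm (a b : JetVar n) (f : DiffPoly n) :
    MvPolynomial.pderiv a (MvPolynomial.pderiv b f) =
      MvPolynomial.pderiv b (MvPolynomial.pderiv a f) := by
  have : ⁅(MvPolynomial.pderiv a : Derivation ℂ (DiffPoly n) (DiffPoly n)),
      (MvPolynomial.pderiv b : Derivation ℂ (DiffPoly n) (DiffPoly n))⁆ = 0 := by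
    refine MvPolynomial.derivation_ext fun i => ?_
    classical
    rw [Derivation.commutator_apply, MvPolynomial.pderiv_X, MvPolynomial.pderiv_X,
      Pi.single_apply, Pi.single_apply]
    split_ifs <;> simp
  have h := DFunLike.congr_fun this f
  rw [Derivation.commutator_apply] at h
  exact sub_eq_zero.1 h

/-- The commutator of ∂/∂a and D_x is a derivation, hence determined by its values on generators.
For a = v̄⁽ᵏ⁺¹⁾ it is ∂/∂v̄⁽ᵏ⁾, for a = v̄ it is zero. -/
lemma pderiv_totalD (a : JetVar n) (f : DiffPoly n) (g : Derivation ℂ (DiffPoly n) (DiffPoly n))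
    (hg : ∀ i, MvPolynomial.pderiv a (totalD n (MvPolynomial.X i)) = g (MvPolynomial.X i)) :
    MvPolynomial.pderiv a (totalD n f) = totalD n (MvPolynomial.pderiv a f) + g f := by
  have : ⁅(MvPolynomial.pderiv a : Derivation ℂ (DiffPoly n) (DiffPoly n)), totalD n⁆ = g := by
    refine MvPolynomial.derivation_ext fun i => ?_
    rw [Derivation.commutator_apply, hg]
    classical
    rw [MvPolynomial.pderiv_X, sub_eq_self]
    rcases eq_or_ne i a with rfl | h
    · simp
    · simp [Pi.single_eq_of_ne h]
  rw [← this, Derivation.commutator_apply]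
  abel

lemma pderiv_totalD_succ (j : Fin n) (k : ℕ) (f : DiffPoly n) :
    MvPolynomial.pderiv (Sum.inr (j, k + 1)) (totalD n f) =
      totalD n (MvPolynomial.pderiv (Sum.inr (j, k + 1)) f) +
        MvPolynomial.pderiv (Sum.inr (j, k)) f := by
  refine pderiv_totalD _ _ _ fun i => ?_
  classical
  rcases i with ⟨a, b⟩ | ⟨a, b⟩
  · simp [totalD_X_inl, MvPolynomial.pderiv_X, Pi.single_apply]
  · simp [totalD_X_inr, MvPolynomial.pderiv_X, Pi.single_apply]

lemma pderiv_totalD_zero (j : Fin n) (f : DiffPoly n) :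
    MvPolynomial.pderiv (Sum.inr (j, 0)) (totalD n f) =
      totalD n (MvPolynomial.pderiv (Sum.inr (j, 0)) f) := by
  have := pderiv_totalD (Sum.inr (j, 0)) f 0 fun i => ?_
  · simpa using this
  classical
  rcases i with ⟨a, b⟩ | ⟨a, b⟩
  · simp [totalD_X_inl, MvPolynomial.pderiv_X, Pi.single_apply]
  · simp [totalD_X_inr, MvPolynomial.pderiv_X, Pi.single_apply]

/-- The jet variables of order less than `K`. -/
def jetBox (n K : ℕ) : Finset (JetVar n) :=
  (Finset.univ ×ˢ Finset.range K).disjSum (Finset.univ ×ˢ Finset.range K)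

lemma exists_vars_subset_jetBox (f : DiffPoly n) : ∃ K, f.vars ⊆ jetBox n K := by
  refine ⟨f.vars.sup (Sum.elim Prod.snd Prod.snd) + 1, fun a ha => ?_⟩
  have h := Finset.le_sup (f := Sum.elim Prod.snd Prod.snd) ha
  rcases a with ⟨a, b⟩ | ⟨a, b⟩
  · simp only [Sum.elim_inl] at h
    simp only [jetBox, Finset.inl_mem_disjSum, Finset.mem_product, Finset.mem_univ, true_and,
      Finset.mem_range]
    omega
  · simp only [Sum.elim_inr] at h
    simp only [jetBox, Finset.inr_mem_disjSum, Finset.mem_product, Finset.mem_univ, true_and,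
      Finset.mem_range]
    omega

lemma exists_order (f : DiffPoly n) :
    ∃ K, ∀ j, ∀ k ≥ K, MvPolynomial.pderiv (Sum.inr (j, k)) f = 0 := by
  obtain ⟨K, hK⟩ := exists_vars_subset_jetBox f
  refine ⟨K, fun j k hk => MvPolynomial.pderiv_eq_zero_of_notMem_vars fun h => ?_⟩
  have := hK h
  simp only [jetBox, Finset.inr_mem_disjSum, Finset.mem_product, Finset.mem_univ, true_and,
      Finset.mem_range] at this
  omega

lemma derivation_sum_apply {ι : Type*} (s : Finset ι)
    (d : ι → Derivation ℂ (DiffPoly n) (DiffPoly n)) (f : DiffPoly n) :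
    (∑ i ∈ s, d i) f = ∑ i ∈ s, d i f := by
  classical
  induction s using Finset.induction_on with
  | empty => simp
  | insert i s hi ih => rw [Finset.sum_insert hi, Finset.sum_insert hi, Derivation.add_apply, ih]

lemma derivation_eq_sum (d : Derivation ℂ (DiffPoly n) (DiffPoly n)) {f : DiffPoly n}
    {s : Finset (JetVar n)} (hs : f.vars ⊆ s) :
    d f = ∑ a ∈ s, d (MvPolynomial.X a) * MvPolynomial.pderiv a f := by
  classical
  have key : d f = (∑ a ∈ s, d (MvPolynomial.X a) • MvPolynomial.pderiv a :
      Derivation ℂ (DiffPoly n) (DiffPoly n)) f := by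
    refine MvPolynomial.derivation_eqOn_supported (s := (s : Set (JetVar n))) (fun i hi => ?_)
      (MvPolynomial.mem_supported.2 (by exact_mod_cast hs))
    rw [Function.comp_apply, Function.comp_apply, derivation_sum_apply, Finset.sum_eq_single i]
    · simp
    · intro b _ hb
      simp only [Derivation.smul_apply, MvPolynomial.pderiv_X, Pi.single_apply, smul_eq_mul,
        mul_ite, mul_one, mul_zero, ite_eq_right_iff]
      intro h; exact absurd h.symm hb
    · intro h; exact absurd hi h
  rw [key, derivation_sum_apply]
  rfl

lemma varDeriv_eq_sum {f : DiffPoly n} {j : Fin n} {K : ℕ}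
    (hK : ∀ k ≥ K, MvPolynomial.pderiv (Sum.inr (j, k)) f = 0) :
    varDeriv f j = ∑ k ∈ Finset.range K,
      (-1) ^ k * (totalD n)^[k] (MvPolynomial.pderiv (Sum.inr (j, k)) f) := by
  rw [varDeriv]
  refine finsum_eq_sum_of_support_subset _ fun k hk => ?_
  by_contra h
  simp only [Finset.coe_range, Set.mem_Iio, not_lt] at h
  apply hk
  simp only
  rw [hK k h, iterate_map_zero, mul_zero]

lemma varDeriv_sub (f g : DiffPoly n) : varDeriv (f - g) = varDeriv f - varDeriv g := by
  obtain ⟨K, hK⟩ := exists_order f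
  obtain ⟨L, hL⟩ := exists_order g
  ext1 j
  have h1 : ∀ k ≥ max K L, MvPolynomial.pderiv (Sum.inr (j, k)) f = 0 := fun k hk =>
    hK j k ((le_max_left _ _).trans hk)
  have h2 : ∀ k ≥ max K L, MvPolynomial.pderiv (Sum.inr (j, k)) g = 0 := fun k hk =>
    hL j k ((le_max_right _ _).trans hk)
  rw [Pi.sub_apply, varDeriv_eq_sum h1, varDeriv_eq_sum h2,
    varDeriv_eq_sum (K := max K L) fun k hk => by rw [map_sub, h1 k hk, h2 k hk, sub_zero],
    ← Finset.sum_sub_distrib]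
  exact Finset.sum_congr rfl fun k _ => by rw [map_sub, iterate_map_sub, mul_sub]

lemma varDeriv_smul (z : ℂ) (f : DiffPoly n) : varDeriv (z • f) = z • varDeriv f := by
  obtain ⟨K, hK⟩ := exists_order f
  ext1 j
  rw [Pi.smul_apply, varDeriv_eq_sum (hK j),
    varDeriv_eq_sum (K := K) fun k hk => by rw [Derivation.map_smul, hK j k hk, smul_zero],
    Finset.smul_sum]
  refine Finset.sum_congr rfl fun k _ => ?_
  have : ∀ (k : ℕ) (g : DiffPoly n), (totalD n)^[k] (z • g) = z • (totalD n)^[k] g := by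
    intro k
    induction k with
    | zero => intro g; rfl
    | succ k ih => intro g; rw [Function.iterate_succ_apply, Derivation.map_smul, ih,
        Function.iterate_succ_apply]
  rw [Derivation.map_smul, this, mul_smul_comm]

/-- The sum telescopes. With p k = ∂g/∂v̄⁽ᵏ⁾ and q k = ∂(D_x g)/∂v̄⁽ᵏ⁾ it is a partial sum of δ(D_x
g)/δv̄, and the single surviving term vanishes once K exceeds the order of g. -/
lemma alternating_iterate_sum {A : Type*} [Ring A] (d : A →+ A) (p q : ℕ → A)
    (h0 : q 0 = d (p 0)) (h : ∀ k, q (k + 1) = d (p (k + 1)) + p k) (K : ℕ) :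
    ∑ k ∈ Finset.range (K + 1), (-1) ^ k * d^[k] (q k) = (-1) ^ K * d^[K + 1] (p K) := by
  induction K with
  | zero => simp [h0]
  | succ K ih =>
    rw [Finset.sum_range_succ, ih, h, iterate_map_add, ← Function.iterate_succ_apply d (K + 1),
      pow_succ]
    noncomm_ring

/-- The variational derivative of a total derivative vanishes. -/
lemma varDeriv_totalD (g : DiffPoly n) : varDeriv (totalD n g) = 0 := by
  obtain ⟨K, hK⟩ := exists_order g
  ext1 j
  have hlt : ∀ k ≥ K + 1, MvPolynomial.pderiv (Sum.inr (j, k)) (totalD n g) = 0 := fun k hk => by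
    obtain ⟨k, rfl⟩ : ∃ m, k = m + 1 := ⟨k - 1, by omega⟩
    rw [pderiv_totalD_succ, hK j _ (by omega), hK j _ (by omega), map_zero, add_zero]
  have h := alternating_iterate_sum (totalD n : DiffPoly n →ₗ[ℂ] DiffPoly n).toAddMonoidHom
    (fun k => MvPolynomial.pderiv (Sum.inr (j, k)) g)
    (fun k => MvPolynomial.pderiv (Sum.inr (j, k)) (totalD n g))
    (pderiv_totalD_zero j g) (fun k => pderiv_totalD_succ j k g) K
  rw [hK j K le_rfl, iterate_map_zero, mul_zero] at h
  rw [varDeriv_eq_sum hlt]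
  exact h

lemma pderiv_iterate_totalD_eq_zero (j : Fin n) {f : DiffPoly n} {r : ℕ}
    (h : ∀ k ≥ r, MvPolynomial.pderiv (Sum.inr (j, k)) f = 0) (i : ℕ) :
    ∀ k ≥ r + i, MvPolynomial.pderiv (Sum.inr (j, k)) ((totalD n)^[i] f) = 0 := by
  induction i with
  | zero => simpa using h
  | succ i ih =>
    intro k hk
    obtain ⟨k, rfl⟩ : ∃ m, k = m + 1 := ⟨k - 1, by omega⟩
    rw [Function.iterate_succ_apply', pderiv_totalD_succ, ih _ (by omega), ih _ (by omega),
      map_zero, add_zero]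

lemma pderiv_iterate_totalD_top (j : Fin n) {f : DiffPoly n} {r : ℕ}
    (h : ∀ k > r, MvPolynomial.pderiv (Sum.inr (j, k)) f = 0) (i : ℕ) :
    MvPolynomial.pderiv (Sum.inr (j, r + i)) ((totalD n)^[i] f) =
      MvPolynomial.pderiv (Sum.inr (j, r)) f := by
  induction i with
  | zero => rfl
  | succ i ih =>
    rw [Function.iterate_succ_apply', ← add_assoc, pderiv_totalD_succ, ih,
      pderiv_iterate_totalD_eq_zero (r := r + 1) j h i _ (by omega), map_zero, zero_add]

/-- The fundamental lemma of the calculus of variations. -/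
lemma eq_zero_of_forall_isExact_mul (j : Fin n) {B : DiffPoly n}
    (h : ∀ Y, IsExact (B * Y)) : B = 0 := by
  obtain ⟨r, hr⟩ := exists_order B
  set x : DiffPoly n := MvPolynomial.X (Sum.inr (j, r + 1)) with hx
  -- The test function is the square of a jet variable x of order r + 1, above the order of B. Then
  -- δ(Bx²)/δv̄ = 0 has the top term ±D_xʳ⁺¹(2Bx).
  obtain ⟨G, hG⟩ := h (x * x)
  have h0 := congrFun (varDeriv_totalD G) j
  classical
  have hpx : ∀ k, k ≠ r + 1 → MvPolynomial.pderiv (Sum.inr (j, k)) x = 0 := fun k hk => by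
    rw [hx, MvPolynomial.pderiv_X, Pi.single_apply, if_neg]
    intro h; exact hk (by simpa using h.symm)
  have hpx1 : MvPolynomial.pderiv (Sum.inr (j, r + 1)) x = 1 := by
    rw [hx, MvPolynomial.pderiv_X_self]
  have hord : ∀ k, MvPolynomial.pderiv (Sum.inr (j, k)) (B * (x * x)) =
      x * x * MvPolynomial.pderiv (Sum.inr (j, k)) B +
        2 * B * x * MvPolynomial.pderiv (Sum.inr (j, k)) x := fun k => by
    rw [Derivation.leibniz, Derivation.leibniz]
    simp only [smul_eq_mul]; ring
  rw [hG, varDeriv_eq_sum (K := r + 2) fun k hk => by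
      rw [hord, hr j k (by omega), hpx k (by omega)]; ring,
    Finset.sum_range_succ, hord, hr j _ (Nat.le_succ r), hpx1, mul_zero, zero_add, mul_one] at h0
  -- Differentiating by the variable of order 2r + 2 isolates ±2B: the other terms carry fewer than
  -- r + 1 total derivatives and do not reach this order.
  have h1 := congrArg (MvPolynomial.pderiv (Sum.inr (j, r + 1 + (r + 1)))) h0
  have hconst : ∀ (m k : ℕ) (f : DiffPoly n), MvPolynomial.pderiv (Sum.inr (j, m)) ((-1) ^ k * f) =
      (-1) ^ k * MvPolynomial.pderiv (Sum.inr (j, m)) f := fun m k f => by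
    rcases neg_one_pow_eq_or (DiffPoly n) k with h | h <;> simp [h]
  have htwo : ∀ (m : ℕ) (f : DiffPoly n), MvPolynomial.pderiv (Sum.inr (j, m)) (2 * f) =
      2 * MvPolynomial.pderiv (Sum.inr (j, m)) f := fun m f => by
    rw [two_mul, map_add, two_mul]
  have htop : ∀ k > r + 1, MvPolynomial.pderiv (Sum.inr (j, k)) (2 * B * x) = 0 := fun k hk => by
    rw [mul_assoc, htwo, Derivation.leibniz, hr j k (by omega), hpx k (by omega)]
    simp
  have hlow : ∀ k < r + 1, MvPolynomial.pderiv (Sum.inr (j, r + 1 + (r + 1)))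
      ((totalD n)^[k] (MvPolynomial.pderiv (Sum.inr (j, k)) (B * (x * x)))) = 0 := fun k hk => by
    refine pderiv_iterate_totalD_eq_zero (r := r + 2) j (fun l hl => ?_) k _ (by omega)
    have hBl : MvPolynomial.pderiv (Sum.inr (j, l))
        (MvPolynomial.pderiv (Sum.inr (j, k)) B) = 0 := by
      rw [pderiv_comm, hr j l (by omega), map_zero]
    rw [hord, hpx k (by omega), mul_zero, add_zero, Derivation.leibniz, Derivation.leibniz, hBl,
      hpx l (by omega)]
    simp
  have h2 : MvPolynomial.pderiv (Sum.inr (j, r + 1)) (2 * B * x) = 2 * B := by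
    rw [mul_assoc, htwo, Derivation.leibniz, hpx1, hr j _ (Nat.le_succ r)]
    simp
  rw [map_add, map_sum, Finset.sum_eq_zero fun k hk => by
      rw [hconst, hlow k (Finset.mem_range.1 hk), mul_zero], zero_add, hconst,
    pderiv_iterate_totalD_top j htop, h2, Pi.zero_apply, map_zero] at h1
  have h3 : (2 : DiffPoly n) * B = 0 := by
    rcases neg_one_pow_eq_or (DiffPoly n) (r + 1) with h | h <;> simpa [h] using h1
  rcases mul_eq_zero.1 h3 with h4 | h4
  · exact absurd h4 two_ne_zero
  · exact h4

/-- The first variation formula for real densities. -/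
lemma isExact_evol_sub_pairing {F : DiffPoly n} (hF : star F = F) (Y : Fin n → DiffPoly n) :
    IsExact (evol Y F - pairing (varDeriv F) Y) := by
  obtain ⟨K, hK⟩ := exists_vars_subset_jetBox F
  have hK' : ∀ j, ∀ k ≥ K, MvPolynomial.pderiv (Sum.inr (j, k)) F = 0 := fun j k hk =>
    MvPolynomial.pderiv_eq_zero_of_notMem_vars fun h => by
      have := hK h
      simp only [jetBox, Finset.inr_mem_disjSum, Finset.mem_product, Finset.mem_univ, true_and,
        Finset.mem_range] at this
      omega
  -- Since F is real, its derivatives by v are conjugate to those by v̄, so `varDeriv`, which only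
  -- uses the latter, determines the first variation.
  have hbar : ∀ a : Fin n × ℕ, MvPolynomial.pderiv (Sum.inl a) F =
      star (MvPolynomial.pderiv (Sum.inr a) F) := fun a => by
    conv_lhs => rw [← hF]
    rw [pderiv_star]; rfl
  have e1 : evol Y F = ∑ j, ∑ k ∈ Finset.range K,
      ((totalD n)^[k] (Y j) * star (MvPolynomial.pderiv (Sum.inr (j, k)) F) +
        (totalD n)^[k] (star (Y j)) * MvPolynomial.pderiv (Sum.inr (j, k)) F) := by
    rw [derivation_eq_sum _ hK, jetBox, Finset.sum_disjSum, Finset.sum_product, Finset.sum_product,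
      ← Finset.sum_add_distrib]
    refine Finset.sum_congr rfl fun j _ => ?_
    rw [← Finset.sum_add_distrib]
    refine Finset.sum_congr rfl fun k _ => ?_
    rw [evol_X_inl, evol_X_inr, hbar]
  have e2 : pairing (varDeriv F) Y = ∑ j, ∑ k ∈ Finset.range K,
      (Y j * ((-1) ^ k * (totalD n)^[k] (star (MvPolynomial.pderiv (Sum.inr (j, k)) F))) +
        star (Y j) * ((-1) ^ k * (totalD n)^[k] (MvPolynomial.pderiv (Sum.inr (j, k)) F))) := by
    rw [pairing, dot, dot, ← Finset.sum_add_distrib]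
    refine Finset.sum_congr rfl fun j _ => ?_
    rw [Function.comp_apply, Function.comp_apply, varDeriv_eq_sum (hK' j), ← star_eq_jconj,
      ← star_eq_jconj, star_sum, Finset.sum_mul, Finset.sum_mul, ← Finset.sum_add_distrib]
    refine Finset.sum_congr rfl fun k _ => ?_
    rw [iterate_totalD_star, star_mul', star_pow, star_neg, star_one]
    ring
  rw [e1, e2, ← Finset.sum_sub_distrib]
  refine isExact_sum fun j _ => ?_
  rw [← Finset.sum_sub_distrib]
  refine isExact_sum fun k _ => ?_
  have h1 := isExact_integrate_by_parts k (Y j) (star (MvPolynomial.pderiv (Sum.inr (j, k)) F))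
  have h2 := isExact_integrate_by_parts k (star (Y j)) (MvPolynomial.pderiv (Sum.inr (j, k)) F)
  convert h1.add h2 using 1
  ring

/-- A covector field whose pairing with every vector field is exact vanishes. -/
lemma eq_zero_of_forall_isExact_pairing {ξ : Fin n → DiffPoly n}
    (h : ∀ X, IsExact (pairing ξ X)) : ξ = 0 := by
  ext1 j
  refine eq_zero_of_forall_isExact_mul j fun Y => ?_
  -- The pairing is only real-linear in the vector field; testing with a field and with i times it
  -- separates ξ from its conjugate.
  have h1 := h (Pi.single j (star Y))
  have h2 := h (Complex.I • Pi.single j (star Y))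
  have e1 : pairing ξ (Pi.single j (star Y)) = ξ j * Y + star (ξ j) * star Y := by
    rw [pairing, dot, dot, Finset.sum_eq_single j, Finset.sum_eq_single j]
    · simp [← star_eq_jconj]
    all_goals simp +contextual [Pi.single_apply]
  have e2 : pairing ξ (Complex.I • Pi.single j (star Y)) =
      -(Complex.I • (ξ j * Y)) + Complex.I • (star (ξ j) * star Y) := by
    rw [pairing, dot, dot, Finset.sum_eq_single j, Finset.sum_eq_single j]
    · simp [← star_eq_jconj]
    all_goals simp +contextual [Pi.single_apply]
  rw [e1] at h1
  rw [e2] at h2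
  have h3 := (h1.add (h2.smul Complex.I)).smul (1 / 2)
  convert h3 using 1
  rw [smul_add Complex.I, smul_neg, smul_smul, smul_smul, Complex.I_mul_I]
  module

end VariationalCalculus

/-! ### Hamiltonian densities and the Hamiltonian pair -/

section HamiltonianStructure

lemma brk_mul {R : Type*} [Ring R] (a b c : R) : ⁅a, b * c⁆ = ⁅a, b⁆ * c + b * ⁅a, c⁆ := by
  simp only [Ring.lie_def]; noncomm_ring

variable {n : ℕ}

/-- The off-diagonal blocks of `M` are those of the skew-Hermitian matrix with first row `ξ`. -/
def HasOff (M : JetMat n) (ξ : Fin n → DiffPoly n) : Prop :=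
  (∀ i j, M (Sum.inl i) (Sum.inr j) = ξ j) ∧ ∀ i j, M (Sum.inr j) (Sum.inl i) = -star (ξ j)

lemma hasOff_blockMat (ξ : Fin n → DiffPoly n) (s : DiffPoly n)
    (S : Matrix (Fin n) (Fin n) (DiffPoly n)) : HasOff (blockMat ξ s S) ξ :=
  ⟨fun _ _ => rfl, fun _ _ => rfl⟩

/-- The pairing of covectors with vector fields is the trace form, whatever the diagonal blocks of M
are. Thus the nonlocal parts of covectors never enter pairings. -/
lemma trace_mul_offMat {M : JetMat n} {ξ : Fin n → DiffPoly n} (h : HasOff M ξ)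
    (X : Fin n → DiffPoly n) : (M * offMat X).trace = -pairing ξ X := by
  simp only [Matrix.trace, Matrix.diag_apply, Matrix.mul_apply, Fintype.sum_sum_type, offMat,
    Matrix.fromBlocks_apply₁₁, Matrix.fromBlocks_apply₁₂, Matrix.fromBlocks_apply₂₁,
    Matrix.fromBlocks_apply₂₂, h.1, h.2, Matrix.zero_apply, mul_zero, Finset.sum_const_zero,
    zero_add, add_zero, Finset.univ_unique, Finset.sum_singleton, Matrix.replicateRow_apply,
    Matrix.neg_apply, Matrix.conjTranspose_apply, mul_neg, neg_mul, Finset.sum_neg_distrib,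
    pairing, dot, Function.comp_apply, ← star_eq_jconj, neg_add]

lemma trace_lie (A B : JetMat n) : ⁅A, B⁆.trace = 0 := by
  rw [Ring.lie_def, Matrix.trace_sub, Matrix.trace_mul_comm, sub_self]

lemma trace_mul_lie (A B C : JetMat n) : (A * ⁅B, C⁆).trace = (B * ⁅C, A⁆).trace := by
  simp only [Ring.lie_def, mul_sub, Matrix.trace_sub, ← mul_assoc]
  rw [Matrix.trace_mul_comm (A * B), ← mul_assoc, Matrix.trace_mul_comm (A * C), ← mul_assoc,
    Matrix.trace_mul_comm (C * A), ← mul_assoc]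

/-- The Hamiltonians of the hierarchy. -/
def jetHam (n k : ℕ) : DiffPoly n := (2 / (k + 1) : ℂ) • jetS n (k + 1)

lemma star_jetHam (k : ℕ) : star (jetHam n k) = jetHam n k := by
  rw [jetHam, star_smul, star_jetS]
  congr 1
  simp

/-- The trace identity in order k + 1 with w = `offMat X`. The factor 2/(k + 1) in `jetHam` cancels
the factor k + 1 of the identity and the 1/2 in `jetS`. -/
lemma isExact_evol_jetHam (k : ℕ) (X : Fin n → DiffPoly n) :
    IsExact (evol X (jetHam n k) + pairing (jetH n k) X) := by
  have hp0 : matDeriv _ (evol X) (projMat (DiffPoly n) n) = 0 := by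
    ext1 (i | i) (j | j) <;> simp [matDeriv_apply, projMat]
  obtain ⟨G, hG⟩ := projSeq_trace_identity (p := projMat (DiffPoly n) n) (D := jetCov n)
    projMat_mul_self jetCov_mul (τ := Matrix.traceAddMonoidHom (Unit ⊕ Fin n) (DiffPoly n))
    (fun a b => Matrix.trace_mul_comm a b)
    (d := (totalD n : DiffPoly n →ₗ[ℂ] DiffPoly n).toAddMonoidHom)
    (fun a => by
      change totalD n a.trace = (jetCov n a).trace
      rw [jetCov_apply, Matrix.trace_add, trace_lie, add_zero, matDeriv_trace])
    (matDeriv_mul (evol X)) hp0 (w := offMat X) (matDeriv_evol_jetCov X) (k + 1)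
  change totalD n G = Matrix.trace _ - (k + 1) • Matrix.trace _ at hG
  have h1 : (offMat X * jetProj n (k + 1)).trace = Complex.I • pairing (jetH n k) X := by
    have : jetProj n (k + 1) = -(Complex.I • blockMat (jetH n k) (jetS n k) (jetT n k)) := by
      rw [blockMat_jet, smul_smul, Complex.I_mul_I, neg_one_smul, neg_neg]
    rw [Matrix.trace_mul_comm, this, neg_mul, smul_mul_assoc, Matrix.trace_neg, Matrix.trace_smul,
      trace_mul_offMat (hasOff_blockMat _ _ _), smul_neg, neg_neg]
  have h2 : ((-Complex.I • projMat (DiffPoly n) n) *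
      matDeriv _ (evol X) (jetProj n (k + 1 + 1))).trace =
      -(Complex.I * (k + 1)) • evol X (jetHam n k) := by
    rw [smul_mul_assoc, Matrix.trace_smul]
    have : (projMat (DiffPoly n) n * matDeriv _ (evol X) (jetProj n (k + 1 + 1))).trace =
        evol X (jetProj n (k + 1 + 1) (Sum.inl ()) (Sum.inl ())) := by
      simp [Matrix.trace, Matrix.mul_apply, Fintype.sum_sum_type, projMat, matDeriv_apply]
    have hk : (k + 1 : ℂ) ≠ 0 := by exact_mod_cast k.succ_ne_zero
    rw [this, jetHam, jetS, Derivation.map_smul, Derivation.map_smul, smul_smul, smul_smul]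
    congr 1
    field_simp
  rw [← jetProj, h1, h2] at hG
  have hk : (k + 1 : ℂ) ≠ 0 := by exact_mod_cast k.succ_ne_zero
  have h3 := (IsExact.smul (-(Complex.I * (k + 1)))⁻¹ ⟨G, hG⟩)
  convert h3 using 1
  rw [smul_sub, smul_smul, inv_mul_cancel₀ (by simp [hk]), one_smul, sub_eq_add_neg]
  congr 1
  rw [← Nat.cast_smul_eq_nsmul ℂ, smul_smul, smul_smul, ← neg_smul]
  have : -((-(Complex.I * (k + 1)))⁻¹ * (((k + 1 : ℕ) : ℂ) * Complex.I)) = 1 := by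
    push_cast
    field_simp
  rw [mul_assoc, this, one_smul]

/-- Two expressions for the first variation of the Hamiltonian agree modulo total derivatives, and
the pairing is nondegenerate. -/
lemma varDeriv_jetHam (k : ℕ) : varDeriv (jetHam n k) = -jetH n k := by
  rw [← sub_eq_zero, sub_neg_eq_add]
  refine eq_zero_of_forall_isExact_pairing fun X => ?_
  have h := (isExact_evol_jetHam k X).sub (isExact_evol_sub_pairing (star_jetHam k) X)
  convert h using 1
  simp only [pairing, dot, Function.comp_apply, ← star_eq_jconj, Pi.add_apply, star_add, add_mul,
    Finset.sum_add_distrib]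
  ring

/-- The antiderivatives in H are the diagonal blocks of a skew-Hermitian matrix: they are chosen so
that its covariant derivative has no diagonal part, and the off-diagonal part is the value of H. The
factor i turns the skew-Hermitian S of H into the Hermitian block used in `blockMat`. -/
lemma blockMat_of_opH {ξ X : Fin n → DiffPoly n} {s : DiffPoly n}
    {S : Matrix (Fin n) (Fin n) (DiffPoly n)} (hs : jconj n s = s) (hS : (S.map (jconj n))ᵀ = -S)
    (hds : totalD n s = hdot (jconj n) (jvbar n) (Complex.I • ξ))
    (hdS : S.map (totalD n) = hwedge (jconj n) (jvbar n) ξ)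
    (hX : X = (fun j => totalD n (ξ j)) - (2 * Complex.I : ℂ) • (s • jv n) + jv n ᵥ* S) :
    jetCov n (blockMat ξ s (Complex.I • S)) = offMat X := by
  have hS' : (Complex.I • S)ᴴ = Complex.I • S := by
    have : Sᴴ = -S := hS
    rw [Matrix.conjTranspose_smul, this, Complex.star_def, Complex.conj_I, smul_neg, neg_smul,
      neg_neg]
  rw [jetCov_apply, matDeriv_blockMat totalD_star,
    blockMat_add_lie _ _ _ _ _ _ _ hs hS', offMat_eq_blockMat]
  congr 1
  · rw [hX, recValue]
    ext1 j
    simp only [Pi.neg_apply, Pi.smul_apply, Pi.add_apply, Pi.sub_apply, Matrix.vecMul_smul,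
      smul_add, smul_smul, Complex.I_mul_I]
    module
  · rw [hds, coe_jconj, jvbar_eq, sub_self]
  · ext1 i j
    have h := congrFun (congrFun hdS i) j
    simp only [Matrix.map_apply, hwedge, outer, Matrix.sub_apply, Matrix.of_apply,
      Function.comp_apply, jvbar_eq, ← star_eq_jconj, Pi.star_apply, star_star] at h
    simp only [Matrix.sub_apply, Matrix.map_apply, Matrix.smul_apply, Derivation.map_smul, h, hsym,
      outer, Matrix.add_apply, Matrix.of_apply, Function.comp_apply, Pi.star_apply, Pi.smul_apply,
      star_smul, star_star, Complex.star_def, Complex.conj_I, mul_smul_comm, smul_mul_assoc,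
      smul_sub, neg_smul, neg_mul, Matrix.zero_apply]
    abel

lemma exists_of_opH {ξ X : Fin n → DiffPoly n} (h : opH n ξ X) :
    ∃ M, HasOff M ξ ∧ jetCov n M = offMat X := by
  obtain ⟨s, S, hs, hS, hds, hdS, hX⟩ := h
  exact ⟨_, hasOff_blockMat _ _ _, blockMat_of_opH hs hS hds hdS hX⟩

/-- The operator whose values are `a` times the value of the covariant derivative plus `b` times
the commutator with `i p`. -/
def covOp (a b : ℂ) : JetMat n →ₗ[ℂ] JetMat n :=
  a • jetCov n + (b * Complex.I) • (LinearMap.mulLeft ℂ (projMat (DiffPoly n) n) -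
    LinearMap.mulRight ℂ (projMat (DiffPoly n) n))

lemma covOp_apply (a b : ℂ) (M : JetMat n) : covOp a b M =
    a • jetCov n M + (b * Complex.I) • ⁅projMat (DiffPoly n) n, M⁆ := rfl

lemma lie_projMat_of_hasOff {M : JetMat n} {ξ : Fin n → DiffPoly n} (h : HasOff M ξ) :
    Complex.I • ⁅projMat (DiffPoly n) n, M⁆ = offMat (Complex.I • ξ) := by
  obtain ⟨h1, h2, h3, h4⟩ := lie_projMat_apply M
  ext1 (i | i) (j | j) <;> rw [Matrix.smul_apply]
  · rw [h1]; simp [offMat]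
  · rw [h2, h.1]; simp [offMat]
  · rw [h3, h.2]; simp [offMat]
  · rw [h4]; simp [offMat]

lemma offMat_add (X Y : Fin n → DiffPoly n) : offMat (X + Y) = offMat X + offMat Y := by
  ext1 (i | i) (j | j) <;> simp [offMat, add_comm]

lemma offMat_real_smul (a : ℝ) (X : Fin n → DiffPoly n) :
    offMat ((a : ℂ) • X) = (a : ℂ) • offMat X := by
  ext1 (i | i) (j | j) <;> simp [offMat]

/-- The graph of a pencil of Hamiltonian operators in matrix form. -/
lemma exists_of_pencil {a b : ℝ} {ξ X : Fin n → DiffPoly n} (h : pencil a b (opH n) (opI n) ξ X) :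
    ∃ M, HasOff M ξ ∧ covOp (a : ℂ) (b : ℂ) M = offMat X := by
  obtain ⟨Y, Z, hY, hZ, rfl⟩ := h
  obtain ⟨M, hM, hM'⟩ := exists_of_opH hY
  refine ⟨M, hM, ?_⟩
  rw [covOp_apply, hM', mul_smul, lie_projMat_of_hasOff hM, offMat_add, offMat_real_smul,
    offMat_real_smul]
  rw [show Z = Complex.I • ξ from hZ]

/-- The covariant derivative and ad p are derivations and the trace kills commutators, so only a
total derivative remains: the operator is skew for the trace form. -/
lemma covOp_trace (a b : ℂ) (M N : JetMat n) :
    (covOp a b M * N).trace + (M * covOp a b N).trace = a • totalD n (M * N).trace := by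
  have h1 : totalD n (M * N).trace = (jetCov n M * N).trace + (M * jetCov n N).trace := by
    rw [← Matrix.trace_add, ← jetCov_mul, jetCov_apply, Matrix.trace_add, trace_lie, add_zero,
      matDeriv_trace]
  have h2 : (⁅projMat (DiffPoly n) n, M⁆ * N).trace + (M * ⁅projMat (DiffPoly n) n, N⁆).trace =
      0 := by
    rw [← Matrix.trace_add, ← brk_mul, trace_lie]
  rw [h1, covOp_apply, covOp_apply, add_mul, mul_add, smul_mul_assoc, smul_mul_assoc,
    mul_smul_comm, mul_smul_comm, Matrix.trace_add, Matrix.trace_add, Matrix.trace_smul,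
    Matrix.trace_smul, Matrix.trace_smul, Matrix.trace_smul, eq_neg_of_add_eq_zero_left h2]
  module

lemma covOp_lie (a b : ℂ) (M N : JetMat n) :
    covOp a b ⁅M, N⁆ = ⁅covOp a b M, N⁆ + ⁅M, covOp a b N⁆ := by
  have h : ∀ M N : JetMat n, covOp a b (M * N) = covOp a b M * N + M * covOp a b N := fun M N => by
    rw [covOp_apply, covOp_apply, covOp_apply, jetCov_mul, brk_mul, smul_add, smul_add, add_mul,
      mul_add, smul_mul_assoc, smul_mul_assoc, mul_smul_comm, mul_smul_comm]
    abel
  exact derivation_lie h M N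

lemma isExact_covOp (a b : ℂ) (M N : JetMat n) :
    IsExact ((covOp a b M * N).trace + (M * covOp a b N).trace) := by
  rw [covOp_trace]; exact IsExact.smul a ⟨_, rfl⟩

lemma HasOff.evol {M : JetMat n} {ξ : Fin n → DiffPoly n} (h : HasOff M ξ)
    (X : Fin n → DiffPoly n) :
    HasOff (matDeriv _ (evol X) M) fun j => evol X (ξ j) :=
  ⟨fun i j => by rw [matDeriv_apply, h.1],
    fun i j => by rw [matDeriv_apply, h.2, map_neg, evol_star]⟩

lemma evol_covOp (a b : ℂ) (X : Fin n → DiffPoly n) (M : JetMat n) :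
    matDeriv _ (evol X) (covOp a b M) =
      covOp a b (matDeriv _ (evol X) M) + a • ⁅offMat X, M⁆ := by
  have hp0 : matDeriv _ (evol X) (projMat (DiffPoly n) n) = 0 := by
    ext1 (i | i) (j | j) <;> simp [matDeriv_apply, projMat]
  rw [covOp_apply, covOp_apply, map_add, map_smul, map_smul, matDeriv_evol_jetCov, matDeriv_lie,
    hp0]
  simp only [Ring.lie_def, zero_mul, mul_zero, sub_zero, zero_add, smul_add]
  abel

/-- The variation of X₁ along X₃ is read off by differentiating `covOp a b M₁ = offMat X₁`. The last
term arises because the covariant derivative itself depends on v. -/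
lemma liePairing_eq {a b : ℂ} {ξ₂ X₁ X₃ : Fin n → DiffPoly n} {M₁ M₂ M₃ : JetMat n}
    (h2 : HasOff M₂ ξ₂) (e1 : covOp a b M₁ = offMat X₁) (e3 : covOp a b M₃ = offMat X₃) :
    liePairing X₁ ξ₂ X₃ = -(matDeriv _ (evol X₁) M₂ * covOp a b M₃).trace -
      (M₂ * covOp a b (matDeriv _ (evol X₃) M₁)).trace -
      a • (M₂ * ⁅covOp a b M₃, M₁⁆).trace := by
  have h := evol_covOp a b X₃ M₁
  rw [e1, matDeriv_offMat (evol_star X₃)] at h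
  rw [liePairing, ← neg_neg (pairing _ X₃), ← trace_mul_offMat (h2.evol X₁), ← e3,
    ← neg_neg (pairing ξ₂ _), ← trace_mul_offMat h2, h, ← e3, mul_add, Matrix.trace_add,
    mul_smul_comm, Matrix.trace_smul]
  abel

/-- Skewness of P is skewness of `covOp`. In the cyclic sum the terms with variations of the Mᵢ
cancel in pairs by the same skewness, and the cubic terms are a times the total derivative of the
invariant 3-form tr(M₁[M₂, M₃]). As a and b are arbitrary, this covers H and the whole pencil. -/
lemma isHamiltonianOp_of_graph {P : Operator n} (a b : ℂ)
    (hP : ∀ ξ X, P ξ X → ∃ M, HasOff M ξ ∧ covOp a b M = offMat X) : IsHamiltonianOp P := by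
  constructor
  · intro ξ X η Y h1 h2
    obtain ⟨M, hM, hM'⟩ := hP _ _ h1
    obtain ⟨N, hN, hN'⟩ := hP _ _ h2
    have h := (isExact_covOp a b M N).neg
    rw [hM', hN', Matrix.trace_mul_comm, trace_mul_offMat hN, trace_mul_offMat hM] at h
    convert h using 1
    abel
  · intro ξ₁ X₁ ξ₂ X₂ ξ₃ X₃ h1 h2 h3
    obtain ⟨M₁, hM₁, e₁⟩ := hP _ _ h1
    obtain ⟨M₂, hM₂, e₂⟩ := hP _ _ h2
    obtain ⟨M₃, hM₃, e₃⟩ := hP _ _ h3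
    rw [liePairing_eq hM₂ e₁ e₃, liePairing_eq hM₃ e₂ e₁, liePairing_eq hM₁ e₃ e₂]
    have x1 := isExact_covOp a b M₂ (matDeriv _ (evol X₃) M₁)
    have x2 := isExact_covOp a b M₃ (matDeriv _ (evol X₁) M₂)
    have x3 := isExact_covOp a b M₁ (matDeriv _ (evol X₂) M₃)
    have x4 := (isExact_covOp a b M₁ ⁅M₂, M₃⁆).smul a
    rw [covOp_lie, mul_add, Matrix.trace_add] at x4
    have x5 := ((x1.add x2).add (x3.add x4)).neg
    convert x5 using 1
    rw [Matrix.trace_mul_comm (covOp a b M₂), Matrix.trace_mul_comm (covOp a b M₃),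
      Matrix.trace_mul_comm (covOp a b M₁) (matDeriv _ _ _), trace_mul_lie M₂, trace_mul_lie M₃,
      trace_mul_lie M₁ M₂]
    rw [trace_mul_lie M₂ (covOp a b M₃) M₁]
    simp only [smul_add]
    abel

theorem isHamiltonianPair_opH_opI (n : ℕ) : IsHamiltonianPair (opH n) (opI n) := by
  refine ⟨isHamiltonianOp_of_graph 1 0 fun ξ X h => ?_, ⟨?_, ?_⟩, fun a b =>
    isHamiltonianOp_of_graph a b fun ξ X h => exists_of_pencil h⟩
  · obtain ⟨M, hM, hM'⟩ := exists_of_opH h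
    exact ⟨M, hM, by rw [covOp_apply, hM']; simp⟩
  · rintro ξ X η Y rfl rfl
    convert isExact_zero (n := n) using 1
    simp only [pairing, dot, Function.comp_apply, Pi.smul_apply, ← star_eq_jconj, star_smul,
      Complex.star_def, Complex.conj_I, ← Finset.sum_add_distrib]
    refine Finset.sum_eq_zero fun j _ => ?_
    simp only [neg_smul, mul_neg, mul_smul_comm]
    rw [mul_comm (η j), mul_comm (star (η j))]
    abel
  · rintro ξ₁ X₁ ξ₂ X₂ ξ₃ X₃ rfl rfl rfl
    convert isExact_zero (n := n) using 1
    simp only [liePairing, pairing, dot, Function.comp_apply, Pi.smul_apply, ← star_eq_jconj,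
      star_smul, Derivation.map_smul, Complex.star_def, Complex.conj_I, ← Finset.sum_add_distrib]
    refine Finset.sum_eq_zero fun j _ => ?_
    simp only [neg_smul, mul_neg, mul_smul_comm]
    rw [mul_comm (ξ₁ j), mul_comm (ξ₂ j), mul_comm (ξ₃ j), mul_comm (star (ξ₁ j)),
      mul_comm (star (ξ₂ j)), mul_comm (star (ξ₃ j))]
    abel

end HamiltonianStructure

/-! ### Bi-Hamiltonian form of the flows -/

section BiHamiltonian

variable {n : ℕ}

lemma opH_add_smul {ξ X η Y : Fin n → DiffPoly n} (h1 : opH n ξ X) (h2 : opH n η Y) (a : ℝ) :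
    opH n (ξ + (a : ℂ) • η) (X + (a : ℂ) • Y) := by
  obtain ⟨s, S, hs, hS, hds, hdS, rfl⟩ := h1
  obtain ⟨t, T, ht, hT, hdt, hdT, rfl⟩ := h2
  have hS' : Sᴴ = -S := hS
  have hT' : Tᴴ = -T := hT
  refine ⟨s + (a : ℂ) • t, S + (a : ℂ) • T, ?_, ?_, ?_, ?_, ?_⟩
  · rw [← star_eq_jconj] at *
    rw [star_add, star_smul, hs, ht]; simp
  · change (S + (a : ℂ) • T)ᴴ = _
    rw [Matrix.conjTranspose_add, Matrix.conjTranspose_smul, hS', hT']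
    simp only [Complex.star_def, Complex.conj_ofReal, smul_neg]
    abel
  · rw [map_add, Derivation.map_smul, hds, hdt]
    simp only [hdot, dot, Pi.smul_apply, Pi.add_apply, Function.comp_apply, ← star_eq_jconj,
      star_smul, star_add, smul_add, mul_add, add_mul, Finset.sum_add_distrib, mul_smul_comm,
      smul_mul_assoc, ← Finset.smul_sum, Complex.star_def, Complex.conj_I, Complex.conj_ofReal]
    module
  · ext1 i j
    have e1 := congrFun (congrFun hdS i) j
    have e2 := congrFun (congrFun hdT i) j
    simp only [Matrix.map_apply] at e1 e2
    simp only [Matrix.map_apply, Matrix.add_apply, Matrix.smul_apply, map_add, Derivation.map_smul,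
      e1, e2]
    simp only [hwedge, outer, Matrix.sub_apply, Matrix.of_apply, Function.comp_apply, Pi.add_apply,
      Pi.smul_apply, ← star_eq_jconj, star_add, star_smul, mul_add, add_mul, mul_smul_comm,
      smul_mul_assoc, Complex.star_def, Complex.conj_ofReal]
    module
  · ext1 j
    simp only [Pi.add_apply, Pi.sub_apply, Pi.smul_apply, map_add, Derivation.map_smul,
      Matrix.vecMul_add, Matrix.vecMul_smul, smul_eq_mul, add_mul, smul_mul_assoc]
    module

/-- A constant c/2 for D_x⁻¹0 already gives this value. It supplies the term -χiv of the flow for k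
= 0, where no Hamiltonian H⁽⁻¹⁾ is available. -/
lemma opH_zero_const (c : ℝ) : opH n 0 (-(Complex.I * c) • jv n) := by
  refine ⟨((c / 2 : ℝ) : ℂ) • 1, 0, ?_, ?_, ?_, ?_, ?_⟩
  · rw [← star_eq_jconj, star_smul, star_one]; simp
  · ext; simp
  · rw [Derivation.map_smul, Derivation.map_one_eq_zero, smul_zero]
    simp [hdot, dot]
  · ext; simp [hwedge, outer]
  · ext1 j
    simp only [Pi.add_apply, Pi.sub_apply, Pi.smul_apply, Pi.zero_apply, map_zero,
      Matrix.vecMul_zero, smul_eq_mul, smul_mul_assoc, one_mul, smul_smul, zero_sub, add_zero]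
    rw [← neg_smul]
    congr 1
    push_cast
    ring

/-- The recursion operator is H composed with multiplication by i: the antiderivatives -s⁽ᵏ⁾ and
iS⁽ᵏ⁾ in H turn it into the recursion step. -/
lemma opH_neg_jetH (k : ℕ) : opH n (-jetH n k) (Complex.I • jetH n (k + 1)) := by
  have hsucc := (jetHierarchy n).h_succ k
  have hds := (jetHierarchy n).s_deriv k
  have hdS := (jetHierarchy n).S_deriv k
  change Complex.I • jetH n (k + 1) = recValue (jv n)
    (fun j => totalD n (Complex.I • jetH n k j)) (jetS n k) (jetT n k) at hsucc
  change totalD n (jetS n k) = hdot (jconj n) (jvbar n) (Complex.I • jetH n k) at hds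
  change (jetT n k).map (totalD n) = hsym (jconj n) (jvbar n) (Complex.I • jetH n k) at hdS
  refine ⟨-jetS n k, Complex.I • jetT n k, ?_, ?_, ?_, ?_, ?_⟩
  · rw [← star_eq_jconj, star_neg, star_jetS]
  · change (Complex.I • jetT n k)ᴴ = _
    rw [Matrix.conjTranspose_smul, conjTranspose_jetT]; simp
  · rw [map_neg, hds]
    simp only [hdot, dot, Pi.smul_apply, Pi.neg_apply, Function.comp_apply, map_neg, smul_neg,
      mul_neg, neg_mul, Finset.sum_neg_distrib]
    abel
  · ext1 i j
    have e1 := congrFun (congrFun hdS i) j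
    simp only [Matrix.map_apply] at e1
    simp only [Matrix.map_apply, Matrix.smul_apply, Derivation.map_smul, e1]
    simp only [hsym, hwedge, outer, Matrix.sub_apply, Matrix.add_apply, Matrix.of_apply,
      Function.comp_apply, Pi.neg_apply, Pi.smul_apply, ← star_eq_jconj, star_neg, star_smul,
      mul_smul_comm, smul_mul_assoc, Complex.star_def, Complex.conj_I, neg_smul, smul_add,
      smul_neg, smul_smul, Complex.I_mul_I, mul_neg, neg_mul, one_smul]
    abel
  · rw [hsucc, recValue]
    ext1 j
    simp only [Pi.add_apply, Pi.sub_apply, Pi.smul_apply, Pi.neg_apply, map_neg,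
      Derivation.map_smul, Matrix.vecMul_smul, smul_eq_mul, neg_mul, smul_add, smul_smul,
      Complex.I_mul_I]
    module

theorem jetHierarchy_biHamiltonian (k : ℕ) :
    opH n (varDeriv (jetHam n (k + 1) - (chi n : ℂ) • (if k = 0 then 0 else jetHam n (k - 1))))
      ((jetHierarchy n).flow k) ∧
    opI n (-varDeriv (jetHam n (k + 2) - (chi n : ℂ) • jetHam n k)) ((jetHierarchy n).flow k) := by
  constructor
  · rcases k with _ | k
    · have h := opH_add_smul (opH_neg_jetH (n := n) 1) (opH_zero_const (n := n) (chi n)) 1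
      rw [if_pos rfl, smul_zero, sub_zero, varDeriv_jetHam]
      convert h using 1
      · simp
      · rw [Hierarchy.flow, (jetHierarchy n).h_zero]
        change Complex.I • (jetH n 2 - _) = _
        rw [smul_sub, smul_smul]
        simp only [Complex.ofReal_one, one_smul, neg_smul]
        rw [sub_eq_add_neg]
    · have h := opH_add_smul (opH_neg_jetH (n := n) (k + 2)) (opH_neg_jetH (n := n) k) (-chi n)
      rw [if_neg (Nat.succ_ne_zero k), varDeriv_sub, varDeriv_smul, varDeriv_jetHam,
        Nat.add_sub_cancel, varDeriv_jetHam]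
      convert h using 1
      · push_cast
        module
      · rw [Hierarchy.flow]
        change Complex.I • (jetH n (k + 3) - (chi n : ℂ) • jetH n (k + 1)) = _
        push_cast
        module
  · rw [varDeriv_sub, varDeriv_smul, varDeriv_jetHam, varDeriv_jetHam]
    change Complex.I • (jetH n (k + 2) - (chi n : ℂ) • jetH n k) = Complex.I • _
    congr 1
    module

end BiHamiltonian

/-! ### The flows as polynomials in the covariant derivatives of γ_x -/

section GeometricPolynomials

variable {n : ℕ}

lemma chi_pos (hn : 1 ≤ n) : 0 < chi n := by
  have : (0 : ℝ) < n := by exact_mod_cast hn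
  unfold chi; positivity

lemma kappa_ne_zero (hn : 1 ≤ n) : (kappa n : ℂ) ≠ 0 := by
  rw [kappa]; exact_mod_cast (Real.sqrt_pos.2 (chi_pos hn)).ne'

lemma kappa_sq (hn : 1 ≤ n) : (kappa n : ℂ) * kappa n = chi n := by
  rw [kappa, ← Complex.ofReal_mul, Real.mul_self_sqrt (chi_pos hn).le]

/-- The constant matrix `e_x` over a commutative algebra. -/
def frameConst (A : Type*) [CommRing A] [Algebra ℂ A] (n : ℕ) :
    Matrix (Unit ⊕ Fin n) (Unit ⊕ Fin n) A :=
  (-(Complex.I * kappa n)) • (projMat A n - (1 / (n + 1) : ℂ) • 1)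

/-- The frame components `Yⱼ` of `∇ₓʲ γₓ` as differential polynomials. -/
def jetNormal (n : ℕ) (j : ℕ) : JetMat n := (jetCov n)^[j] (frameConst (DiffPoly n) n)

lemma jetNormal_zero : jetNormal n 0 = frameConst (DiffPoly n) n := rfl

lemma jetNormal_succ' (j : ℕ) : jetNormal n (j + 1) = jetCov n (jetNormal n j) :=
  Function.iterate_succ_apply' _ _ _

lemma jetNormal_succ (j : ℕ) : jetNormal n (j + 1) =
    (-(Complex.I * kappa n)) • (jetCov n)^[j + 1] (projMat (DiffPoly n) n) := by
  induction j with
  | zero =>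
    rw [jetNormal_succ', jetNormal_zero, frameConst, map_smul, map_sub, map_smul,
      derivation_one jetCov_mul, smul_zero, sub_zero]
    rfl
  | succ j ih => rw [jetNormal_succ', ih, map_smul, ← Function.iterate_succ_apply' (jetCov n)]

lemma projMat_eq_smul (hn : 1 ≤ n) (A : Type*) [CommRing A] [Algebra ℂ A] :
    projMat A n = (Complex.I / kappa n) • frameConst A n + (1 / (n + 1) : ℂ) • 1 := by
  have : Complex.I / kappa n * -(Complex.I * kappa n) = 1 := by
    rw [div_mul_eq_mul_div, mul_neg, ← mul_assoc, Complex.I_mul_I, neg_mul, one_mul, neg_neg,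
      div_self (kappa_ne_zero hn)]
  rw [frameConst, smul_smul, this, one_smul, sub_add_cancel]

/-- Up to a scalar matrix, which D annihilates, e_x is a nonzero multiple of p. Polynomials in the
Dʲp are therefore polynomials in the frame matrices of ∇_xʲγ_x, of the same order. -/
lemma genBy_proj_le (hn : 1 ≤ n) (m : ℕ) :
    genBy (fun j => (jetCov n)^[j] (projMat (DiffPoly n) n)) m ≤ genBy (jetNormal n) m := by
  refine Algebra.adjoin_le ?_
  rintro _ ⟨j, hj, rfl⟩
  have hm := mem_genBy (jetNormal n) (m := m) (j := j) hj
  rcases j with _ | j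
  · change projMat (DiffPoly n) n ∈ genBy (jetNormal n) m
    rw [projMat_eq_smul hn]
    exact add_mem (Subalgebra.smul_mem _ hm _) (Subalgebra.smul_mem _ (one_mem _) _)
  · rw [jetNormal_succ] at hm
    have h := Subalgebra.smul_mem _ hm (-(Complex.I * kappa n))⁻¹
    rwa [smul_smul, inv_mul_cancel₀ (neg_ne_zero.2 (mul_ne_zero Complex.I_ne_zero
      (kappa_ne_zero hn))), one_smul] at h

lemma exists_freeAlgebra_of_genBy {R : Type*} [Ring R] [Algebra ℂ R] {Y : ℕ → R} {m : ℕ} {x : R}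
    {g : FreeAlgebra ℂ ℕ} (hx : x - FreeAlgebra.lift ℂ Y g ∈ genBy Y m) :
    ∃ f, SameLeading m f g ∧ FreeAlgebra.lift ℂ Y f = x := by
  have : genBy Y m = (Algebra.adjoin ℂ (FreeAlgebra.ι ℂ '' {j : ℕ | j < m})).map
      (FreeAlgebra.lift ℂ Y) := by
    have hY : ⇑(FreeAlgebra.lift ℂ Y) ∘ FreeAlgebra.ι ℂ = Y := by
      funext j; simp
    rw [AlgHom.map_adjoin, ← Set.image_comp, hY]
    rfl
  rw [this] at hx
  obtain ⟨a, ha, hax⟩ := hx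
  refine ⟨a + g, ?_, ?_⟩
  · rw [SameLeading, add_sub_cancel_right]; exact ha
  · rw [map_add]
    change (FreeAlgebra.lift ℂ Y) a = _ at hax
    rw [hax, sub_add_cancel]

lemma frameConst_lie_jetNormal (j : ℕ) : ⁅jetNormal n 0, jetNormal n (j + 1)⁆ =
    (-(kappa n * kappa n : ℂ)) • ⁅projMat (DiffPoly n) n, (jetCov n)^[j + 1] (projMat (DiffPoly n) n)⁆ := by
  rw [jetNormal_succ, jetNormal_zero, frameConst]
  simp only [Ring.lie_def, smul_sub, sub_mul, mul_sub, smul_mul_assoc, mul_smul_comm, one_mul,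
    mul_one, smul_smul]
  have : -(Complex.I * (kappa n : ℂ)) * -(Complex.I * kappa n) = -(kappa n * kappa n) := by
    linear_combination (kappa n * kappa n : ℂ) * Complex.I_mul_I
  rw [this]
  module

/-- The leading term is that of `projSeq_leading`, rescaled by [Y₀, Yⱼ] = -κ²[p, Dʲp] for j ≥ 1. -/
theorem exists_geometric_even (hn : 1 ≤ n) (m : ℕ) : ∃ f : FreeAlgebra ℂ ℕ,
    SameLeading (2 * m + 1) f
      (((-1) ^ m * (kappa n : ℂ)⁻¹) • ⁅FreeAlgebra.ι ℂ 0, FreeAlgebra.ι ℂ (2 * m + 1)⁆) ∧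
    FreeAlgebra.lift ℂ (jetNormal n) f = (kappa n * Complex.I : ℂ) • jetProj n (2 * m + 1) := by
  refine exists_freeAlgebra_of_genBy ?_
  have h := (projSeq_leading (p := projMat (DiffPoly n) n) projMat_mul_self jetCov_mul m).2.1
  have h2 := Subalgebra.smul_mem _ (genBy_proj_le hn _ h) (kappa n * Complex.I : ℂ)
  convert h2 using 1
  rw [map_smul, Ring.lie_def, map_sub, map_mul, map_mul, FreeAlgebra.lift_ι_apply,
    FreeAlgebra.lift_ι_apply, ← Ring.lie_def, frameConst_lie_jetNormal, smul_sub, smul_smul,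
    smul_smul, jetProj]
  congr 2
  have := kappa_ne_zero hn
  field_simp
  rw [Complex.I_sq]

theorem exists_geometric_odd (hn : 1 ≤ n) (m : ℕ) : ∃ f : FreeAlgebra ℂ ℕ,
    SameLeading (2 * m + 2) f (((-1) ^ m : ℂ) • FreeAlgebra.ι ℂ (2 * m + 2)) ∧
    FreeAlgebra.lift ℂ (jetNormal n) f = (kappa n * Complex.I : ℂ) • jetProj n (2 * m + 2) := by
  refine exists_freeAlgebra_of_genBy ?_
  have h := (projSeq_leading (p := projMat (DiffPoly n) n) projMat_mul_self jetCov_mul (m + 1)).1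
  have h2 := Subalgebra.smul_mem _ (genBy_proj_le hn _ h) (kappa n * Complex.I : ℂ)
  change _ ∈ genBy (jetNormal n) (2 * (m + 1))
  convert h2 using 1
  rw [map_smul, FreeAlgebra.lift_ι_apply, jetNormal_succ, smul_sub, smul_smul,
    smul_smul, jetProj]
  congr 2
  rw [pow_succ]; ring

theorem exists_geometric (hn : 1 ≤ n) : ∃ f : ℕ → FreeAlgebra ℂ ℕ,
    (∀ m, SameLeading (2 * m + 1) (f (2 * m))
      (((-1) ^ m * (kappa n : ℂ)⁻¹) • ⁅FreeAlgebra.ι ℂ 0, FreeAlgebra.ι ℂ (2 * m + 1)⁆)) ∧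
    (∀ m, SameLeading (2 * m + 2) (f (2 * m + 1))
      (((-1) ^ m : ℂ) • FreeAlgebra.ι ℂ (2 * m + 2))) ∧
    ∀ k, FreeAlgebra.lift ℂ (jetNormal n) (f k) =
      (kappa n : ℂ) • blockMat (jetH n k) (jetS n k) (jetT n k) := by
  choose fe he he' using exists_geometric_even hn
  choose fo ho ho' using exists_geometric_odd hn
  refine ⟨fun k => if k % 2 = 0 then fe (k / 2) else fo (k / 2), fun m => ?_, fun m => ?_,
    fun k => ?_⟩
  · dsimp only
    rw [if_pos (by omega), show 2 * m / 2 = m by omega]; exact he m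
  · dsimp only
    rw [if_neg (by omega), show (2 * m + 1) / 2 = m by omega]; exact ho m
  · rw [blockMat_jet, smul_smul]
    obtain ⟨m, rfl | rfl⟩ := Nat.even_or_odd' k
    · simp only
      rw [if_pos (by omega), show 2 * m / 2 = m by omega, he']
    · simp only
      rw [if_neg (by omega), show (2 * m + 1) / 2 = m by omega, ho']

end GeometricPolynomials

/-! ### Calculus of functions and matrices on an open set of the plane -/

section Calculus

variable {l m k : Type*} [Fintype l] [Fintype m] [Fintype k] {U : Set (ℝ × ℝ)} {p : ℝ × ℝ}
  {w u : ℝ × ℝ}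

/-- Entrywise directional derivative. -/
def matD (w : ℝ × ℝ) (F : ℝ × ℝ → Matrix m k ℂ) (p : ℝ × ℝ) : Matrix m k ℂ :=
  Matrix.of fun i j => fderiv ℝ (fun q => F q i j) p w

/-- Entrywise smoothness of a rectangular matrix function. -/
def SmoothOn (F : ℝ × ℝ → Matrix m k ℂ) (U : Set (ℝ × ℝ)) : Prop :=
  ∀ i j, ContDiffOn ℝ ∞ (fun q => F q i j) U

lemma differentiableAt_of_smooth {E : Type*} [NormedAddCommGroup E] [NormedSpace ℝ E]
    {f : ℝ × ℝ → E} (hf : ContDiffOn ℝ ∞ f U) (hU : IsOpen U) (hp : p ∈ U) :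
    DifferentiableAt ℝ f p :=
  (hf.differentiableOn (by simp)).differentiableAt (hU.mem_nhds hp)

lemma contDiffOn_fderiv_apply {f : ℝ × ℝ → ℂ} (hf : ContDiffOn ℝ ∞ f U) (hU : IsOpen U)
    (w : ℝ × ℝ) : ContDiffOn ℝ ∞ (fun q => fderiv ℝ f q w) U :=
  (hf.fderiv_of_isOpen hU (by simp)).clm_apply contDiffOn_const

lemma fderiv_congr_of_eqOn {E : Type*} [NormedAddCommGroup E] [NormedSpace ℝ E]
    {f g : ℝ × ℝ → E} (h : Set.EqOn f g U) (hU : IsOpen U) (hp : p ∈ U) :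
    fderiv ℝ f p = fderiv ℝ g p :=
  (h.eventuallyEq_of_mem (hU.mem_nhds hp)).fderiv_eq

lemma fderiv_star_apply {f : ℝ × ℝ → ℂ} :
    fderiv ℝ (fun q => star (f q)) p w = star (fderiv ℝ f p w) := by
  rw [fderiv_star]; rfl

lemma fderiv_comm {f : ℝ × ℝ → ℂ} (hf : ContDiffOn ℝ ∞ f U) (hU : IsOpen U) (hp : p ∈ U)
    (w u : ℝ × ℝ) : fderiv ℝ (fun q => fderiv ℝ f q w) p u =
      fderiv ℝ (fun q => fderiv ℝ f q u) p w := by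
  have hd : DifferentiableAt ℝ (fderiv ℝ f) p :=
    differentiableAt_of_smooth (hf.fderiv_of_isOpen hU (m := ∞) (by simp)) hU hp
  have hs : IsSymmSndFDerivAt ℝ f p :=
    (hf.contDiffAt (hU.mem_nhds hp)).isSymmSndFDerivAt
      (by simpa using WithTop.coe_le_coe.2 (le_top : (2 : ℕ∞) ≤ ⊤))
  have key (a : ℝ × ℝ) : fderiv ℝ (fun q => fderiv ℝ f q a) p =
      (fderiv ℝ (fderiv ℝ f) p).flip a := by
    have := hd.hasFDerivAt.clm_apply (hasFDerivAt_const a p)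
    rw [this.fderiv]; ext <;> simp
  rw [key, key]
  exact hs u w

lemma dx_eq_fderiv {f : ℝ × ℝ → ℂ} (hf : DifferentiableAt ℝ f p) :
    dx f p = fderiv ℝ f p (0, 1) := by
  have h : HasDerivAt (fun y : ℝ => (p.1, y)) ((0 : ℝ), (1 : ℝ)) p.2 :=
    (hasDerivAt_const _ _).prodMk (hasDerivAt_id _)
  exact (HasFDerivAt.comp_hasDerivAt p.2 (f := fun y : ℝ => (p.1, y)) hf.hasFDerivAt h).deriv

lemma dt_eq_fderiv {f : ℝ × ℝ → ℂ} (hf : DifferentiableAt ℝ f p) :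
    dt f p = fderiv ℝ f p (1, 0) := by
  have h : HasDerivAt (fun y : ℝ => (y, p.2)) ((1 : ℝ), (0 : ℝ)) p.1 :=
    (hasDerivAt_id _).prodMk (hasDerivAt_const _ _)
  exact (HasFDerivAt.comp_hasDerivAt p.1 (f := fun y : ℝ => (y, p.2)) hf.hasFDerivAt h).deriv

lemma contDiffOn_dx {f : ℝ × ℝ → ℂ} (hf : ContDiffOn ℝ ∞ f U) (hU : IsOpen U) :
    ContDiffOn ℝ ∞ (dx f) U :=
  (contDiffOn_fderiv_apply hf hU (0, 1)).congr fun _ hq =>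
    dx_eq_fderiv (differentiableAt_of_smooth hf hU hq)

lemma contDiffOn_iterate_dx {f : ℝ × ℝ → ℂ} (hf : ContDiffOn ℝ ∞ f U) (hU : IsOpen U) (j : ℕ) :
    ContDiffOn ℝ ∞ (dx^[j] f) U := by
  induction j with
  | zero => exact hf
  | succ j ih => rw [Function.iterate_succ_apply']; exact contDiffOn_dx ih hU

lemma SmoothOn.congr {F G : ℝ × ℝ → Matrix m k ℂ} (hF : SmoothOn F U) (h : Set.EqOn G F U) :
    SmoothOn G U := fun i j => (hF i j).congr fun q hq => by rw [h hq]

lemma SmoothOn.add {F G : ℝ × ℝ → Matrix m k ℂ} (hF : SmoothOn F U) (hG : SmoothOn G U) :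
    SmoothOn (fun q => F q + G q) U := fun i j => (hF i j).add (hG i j)

lemma SmoothOn.sub {F G : ℝ × ℝ → Matrix m k ℂ} (hF : SmoothOn F U) (hG : SmoothOn G U) :
    SmoothOn (fun q => F q - G q) U := fun i j => (hF i j).sub (hG i j)

lemma SmoothOn.const (M : Matrix m k ℂ) : SmoothOn (fun _ => M) U :=
  fun _ _ => contDiffOn_const

lemma SmoothOn.smul {F : ℝ × ℝ → Matrix m k ℂ} {f : ℝ × ℝ → ℂ} (hf : ContDiffOn ℝ ∞ f U)
    (hF : SmoothOn F U) : SmoothOn (fun q => f q • F q) U :=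
  fun i j => hf.mul (hF i j)

lemma SmoothOn.const_smul {F : ℝ × ℝ → Matrix m k ℂ} (c : ℂ) (hF : SmoothOn F U) :
    SmoothOn (fun q => c • F q) U :=
  SmoothOn.smul (f := fun _ => c) contDiffOn_const hF

lemma SmoothOn.mul {F : ℝ × ℝ → Matrix l m ℂ} {G : ℝ × ℝ → Matrix m k ℂ} (hF : SmoothOn F U)
    (hG : SmoothOn G U) : SmoothOn (fun q => F q * G q) U := fun i j => by
  simp only [Matrix.mul_apply]
  exact ContDiffOn.sum fun a _ => (hF i a).mul (hG a j)

lemma contDiffOn_star {f : ℝ × ℝ → ℂ} (hf : ContDiffOn ℝ ∞ f U) :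
    ContDiffOn ℝ ∞ (fun q => star (f q)) U :=
  (starL' ℝ (A := ℂ)).contDiff.comp_contDiffOn hf

lemma SmoothOn.conjTranspose {F : ℝ × ℝ → Matrix m k ℂ} (hF : SmoothOn F U) :
    SmoothOn (fun q => (F q)ᴴ) U := fun i j => contDiffOn_star (hF j i)

lemma SmoothOn.matD {F : ℝ × ℝ → Matrix m k ℂ} (hF : SmoothOn F U) (hU : IsOpen U) (w : ℝ × ℝ) :
    SmoothOn (matD w F) U := fun i j => contDiffOn_fderiv_apply (hF i j) hU w

lemma contDiffOn_trace {F : ℝ × ℝ → Matrix m m ℂ} (hF : SmoothOn F U) :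
    ContDiffOn ℝ ∞ (fun q => (F q).trace) U := by
  simp only [Matrix.trace, Matrix.diag]
  exact ContDiffOn.sum fun i _ => hF i i

variable (hU : IsOpen U) (hp : p ∈ U)
include hU hp

lemma matD_congr {F G : ℝ × ℝ → Matrix m k ℂ} (h : Set.EqOn F G U) :
    matD w F p = matD w G p := by
  ext i j
  simp only [matD, Matrix.of_apply]
  rw [fderiv_congr_of_eqOn (U := U) (fun q hq => by rw [h hq]) hU hp]

lemma matD_add {F G : ℝ × ℝ → Matrix m k ℂ} (hF : SmoothOn F U) (hG : SmoothOn G U) :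
    matD w (fun q => F q + G q) p = matD w F p + matD w G p := by
  ext i j
  simp only [matD, Matrix.of_apply, Matrix.add_apply]
  rw [fderiv_fun_add (differentiableAt_of_smooth (hF i j) hU hp)
    (differentiableAt_of_smooth (hG i j) hU hp)]
  rfl

lemma matD_sub {F G : ℝ × ℝ → Matrix m k ℂ} (hF : SmoothOn F U) (hG : SmoothOn G U) :
    matD w (fun q => F q - G q) p = matD w F p - matD w G p := by
  ext i j
  simp only [matD, Matrix.of_apply, Matrix.sub_apply]
  rw [fderiv_fun_sub (differentiableAt_of_smooth (hF i j) hU hp)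
    (differentiableAt_of_smooth (hG i j) hU hp)]
  rfl

lemma matD_smul {F : ℝ × ℝ → Matrix m k ℂ} {f : ℝ × ℝ → ℂ} (hf : ContDiffOn ℝ ∞ f U)
    (hF : SmoothOn F U) :
    matD w (fun q => f q • F q) p = f p • matD w F p + fderiv ℝ f p w • F p := by
  ext i j
  simp only [matD, Matrix.of_apply, Matrix.add_apply, Matrix.smul_apply, smul_eq_mul]
  rw [fderiv_fun_mul (differentiableAt_of_smooth hf hU hp)
    (differentiableAt_of_smooth (hF i j) hU hp)]
  simp [mul_comm]

lemma matD_mul {F : ℝ × ℝ → Matrix l m ℂ} {G : ℝ × ℝ → Matrix m k ℂ} (hF : SmoothOn F U)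
    (hG : SmoothOn G U) :
    matD w (fun q => F q * G q) p = matD w F p * G p + F p * matD w G p := by
  ext i j
  simp only [matD, Matrix.of_apply, Matrix.add_apply, Matrix.mul_apply]
  rw [fderiv_fun_sum fun a _ => (differentiableAt_of_smooth (hF i a) hU hp).fun_mul
    (differentiableAt_of_smooth (hG a j) hU hp), sum_apply,
    ← Finset.sum_add_distrib]
  refine Finset.sum_congr rfl fun a _ => ?_
  rw [fderiv_fun_mul (differentiableAt_of_smooth (hF i a) hU hp)
    (differentiableAt_of_smooth (hG a j) hU hp)]
  simp [mul_comm, add_comm]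

lemma matD_comm {F : ℝ × ℝ → Matrix m k ℂ} (hF : SmoothOn F U) :
    matD u (matD w F) p = matD w (matD u F) p := by
  ext i j
  exact fderiv_comm (hF i j) hU hp w u

lemma fderiv_trace {F : ℝ × ℝ → Matrix m m ℂ} (hF : SmoothOn F U) :
    fderiv ℝ (fun q => (F q).trace) p w = (matD w F p).trace := by
  simp only [Matrix.trace, Matrix.diag, matD, Matrix.of_apply]
  rw [fderiv_fun_sum fun a _ => differentiableAt_of_smooth (hF a a) hU hp,
    sum_apply]

omit hU hp

lemma matD_const (M : Matrix m k ℂ) : matD w (fun _ => M) p = 0 := by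
  ext i j; simp [matD]

lemma matD_const_smul (hU : IsOpen U) (hp : p ∈ U) {F : ℝ × ℝ → Matrix m k ℂ} (c : ℂ)
    (hF : SmoothOn F U) : matD w (fun q => c • F q) p = c • matD w F p := by
  rw [matD_smul hU hp (f := fun _ => c) contDiffOn_const hF]
  simp

lemma matD_conjTranspose {F : ℝ × ℝ → Matrix m k ℂ} :
    matD w (fun q => (F q)ᴴ) p = (matD w F p)ᴴ := by
  ext i j
  simp only [matD, Matrix.of_apply, Matrix.conjTranspose_apply]
  exact fderiv_star_apply

lemma mdx_eq_matD {n : ℕ} {F : ℝ × ℝ → Mat n} (hF : SmoothMat F U) (hU : IsOpen U) (hp : p ∈ U) :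
    mdx F p = matD (0, 1) F p := by
  ext i j
  exact dx_eq_fderiv (differentiableAt_of_smooth (hF i j) hU hp)

lemma mdt_eq_matD {n : ℕ} {F : ℝ × ℝ → Mat n} (hF : SmoothMat F U) (hU : IsOpen U) (hp : p ∈ U) :
    mdt F p = matD (1, 0) F p := by
  ext i j
  exact dt_eq_fderiv (differentiableAt_of_smooth (hF i j) hU hp)

lemma dx_congr {f g : ℝ × ℝ → ℂ} (hU : IsOpen U) (hp : p ∈ U) (h : Set.EqOn f g U) :
    dx f p = dx g p := by
  refine Filter.EventuallyEq.deriv_eq ?_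
  have hc : ContinuousAt (fun y : ℝ => (p.1, y)) p.2 := by fun_prop
  filter_upwards [hc.preimage_mem_nhds (hU.mem_nhds hp)] with y hy using h hy

end Calculus

/-! ### Evaluation of differential polynomials -/

section Evaluation

variable {n : ℕ} {U : Set (ℝ × ℝ)} {p : ℝ × ℝ} {v : ℝ × ℝ → Fin n → ℂ}

lemma contDiffOn_evalJet (hU : IsOpen U) (hv : ∀ j, ContDiffOn ℝ ∞ (fun q => v q j) U)
    (Q : DiffPoly n) : ContDiffOn ℝ ∞ (fun q => evalJet v q Q) U := by
  induction Q using MvPolynomial.induction_on with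
  | C a => simp only [evalJet, MvPolynomial.aeval_C]; exact contDiffOn_const
  | add P Q hP hQ => simp only [map_add]; exact hP.add hQ
  | mul_X P i hP =>
    simp only [map_mul]
    refine hP.mul ?_
    simp only [evalJet, MvPolynomial.aeval_X]
    rcases i with a | a
    · exact contDiffOn_iterate_dx (hv a.1) hU a.2
    · exact contDiffOn_star (contDiffOn_iterate_dx (hv a.1) hU a.2)

/-- Substitution of v intertwines D_x with ∂/∂x; both sides are derivations over the substitution,
so the jet coordinates suffice. -/
lemma fderiv_evalJet (hU : IsOpen U) (hv : ∀ j, ContDiffOn ℝ ∞ (fun q => v q j) U) (hp : p ∈ U)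
    (Q : DiffPoly n) :
    fderiv ℝ (fun q => evalJet v q Q) p (0, 1) = evalJet v p (totalD n Q) := by
  have hs (Q : DiffPoly n) := differentiableAt_of_smooth (contDiffOn_evalJet hU hv Q) hU hp
  induction Q using MvPolynomial.induction_on with
  | C a =>
    have : totalD n (MvPolynomial.C a) = 0 := (totalD n).map_algebraMap a
    simp [evalJet, MvPolynomial.aeval_C, this]
  | add P Q hP hQ =>
    simp only [map_add]
    rw [fderiv_fun_add (hs P) (hs Q), add_apply, hP, hQ]
  | mul_X P i hP =>
    simp only [map_mul, Derivation.leibniz, map_add, smul_eq_mul]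
    rw [fderiv_fun_mul (hs P) (hs _)]
    have hX : fderiv ℝ (fun q => evalJet v q (MvPolynomial.X i)) p (0, 1) =
        evalJet v p (totalD n (MvPolynomial.X i)) := by
      rcases i with a | a
      · rw [totalD_X_inl]
        simp only [evalJet, MvPolynomial.aeval_X, Sum.elim_inl, Function.iterate_succ_apply']
        exact (dx_eq_fderiv (differentiableAt_of_smooth
          (contDiffOn_iterate_dx (hv a.1) hU a.2) hU hp)).symm
      · rw [totalD_X_inr]
        simp only [evalJet, MvPolynomial.aeval_X, Sum.elim_inr, Function.iterate_succ_apply']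
        rw [fderiv_star_apply, dx_eq_fderiv (differentiableAt_of_smooth
          (contDiffOn_iterate_dx (hv a.1) hU a.2) hU hp)]
    simp only [add_apply, smul_apply, smul_eq_mul, hX, hP]

lemma evalJet_star (Q : DiffPoly n) : evalJet v p (star Q) = star (evalJet v p Q) := by
  induction Q using MvPolynomial.induction_on with
  | C a => simp [star_C, evalJet, MvPolynomial.aeval_C]
  | add P Q hP hQ => simp only [star_add, map_add, hP, hQ]
  | mul_X P i hP =>
    simp only [star_mul', map_mul, hP, star_X]
    congr 1
    rcases i with a | a <;> simp [evalJet]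

/-- Entrywise evaluation of a matrix of differential polynomials. -/
def evalMat (v : ℝ × ℝ → Fin n → ℂ) (p : ℝ × ℝ) : JetMat n →ₐ[ℂ] Mat n :=
  (evalJet v p).mapMatrix

lemma smoothOn_evalMat (hU : IsOpen U) (hv : ∀ j, ContDiffOn ℝ ∞ (fun q => v q j) U)
    (M : JetMat n) : SmoothOn (fun q => evalMat v q M) U :=
  fun i j => contDiffOn_evalJet hU hv (M i j)

lemma matD_evalMat (hU : IsOpen U) (hv : ∀ j, ContDiffOn ℝ ∞ (fun q => v q j) U) (hp : p ∈ U)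
    (M : JetMat n) :
    matD (0, 1) (fun q => evalMat v q M) p = evalMat v p (matDeriv _ (totalD n) M) := by
  ext i j
  exact fderiv_evalJet hU hv hp (M i j)

lemma evalMat_blockMat (b : Fin n → DiffPoly n) (s : DiffPoly n)
    (S : Matrix (Fin n) (Fin n) (DiffPoly n)) :
    evalMat v p (blockMat b s S) =
      blockMat (fun j => evalJet v p (b j)) (evalJet v p s) (S.map (evalJet v p)) := by
  ext (i | i) (j | j) <;>
    simp [evalMat, blockMat, Matrix.fromBlocks, AlgHom.mapMatrix_apply, evalJet_star]

lemma evalMat_offMat : evalMat v p (offMat (jv n)) = connMatrix (v p) := by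
  ext (i | i) (j | j) <;>
    simp [evalMat, offMat, connMatrix, Matrix.fromBlocks, AlgHom.mapMatrix_apply, evalJet_star] <;>
    simp [evalJet, jv]

lemma evalMat_projMat : evalMat v p (projMat (DiffPoly n) n) = projMat ℂ n := by
  ext (i | i) (j | j) <;>
    simp [evalMat, projMat, Matrix.fromBlocks, AlgHom.mapMatrix_apply]

lemma evalMat_frameConst : evalMat v p (frameConst (DiffPoly n) n) = frameConst ℂ n := by
  simp only [frameConst, map_smul, map_sub, evalMat_projMat, map_one]

lemma frameConst_eq_unitFrame : frameConst ℂ n = unitFrame n := by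
  have : (n : ℂ) + 1 ≠ 0 := by exact_mod_cast Nat.succ_ne_zero n
  ext (i | i) (j | j)
  · simp [frameConst, projMat, unitFrame]; field_simp; ring
  · simp [frameConst, projMat, unitFrame]
  · simp [frameConst, projMat, unitFrame]
  · simp only [frameConst, projMat, unitFrame, Matrix.smul_apply, Matrix.sub_apply,
      Matrix.fromBlocks_apply₂₂, Matrix.one_apply, Sum.inr.injEq, Matrix.zero_apply]
    split_ifs
    · simp [div_eq_mul_inv, mul_comm, mul_left_comm]
    · simp

lemma connMatrix_eq_offMat (a : Fin n → ℂ) : connMatrix a = offMat a := rfl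

lemma flowMatrix_eq_blockMat (b : Fin n → ℂ) (s : ℂ) (S : Matrix (Fin n) (Fin n) ℂ) :
    flowMatrix b (-2 * s) (-(Complex.I • S)) = (kappa n : ℂ) • blockMat b s S := by
  ext (i | i) (j | j) <;> simp [flowMatrix, blockMat, Matrix.fromBlocks]
  left; ring

end Evaluation

/-! ### The derivative of the determinant at the identity -/

section Determinant

variable {m : Type*} [Fintype m] [DecidableEq m]

/-- A nontrivial permutation moves at least two points, so deleting one factor leaves an
off-diagonal entry of the identity. Hence only the trivial permutation contributes to the derivative
of the determinant at the identity. -/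
lemma prod_erase_one_perm {σ : Equiv.Perm m} (hσ : σ ≠ 1) (i : m) :
    ∏ j ∈ Finset.univ.erase i, (1 : Matrix m m ℂ) (σ j) j = 0 := by
  obtain ⟨j, hj, hji⟩ : ∃ j, σ j ≠ j ∧ j ≠ i := by
    by_contra! h
    refine hσ (Equiv.ext fun a => ?_)
    by_contra ha
    have hai := h a ha
    have : σ (σ a) ≠ σ a := fun h => ha (σ.injective h)
    exact ha ((h _ this).trans hai.symm)
  exact Finset.prod_eq_zero (Finset.mem_erase.2 ⟨hji, Finset.mem_univ j⟩) (Matrix.one_apply_ne hj)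

theorem hasFDerivAt_det {E : Type*} [NormedAddCommGroup E] [NormedSpace ℝ E] {p : E}
    {F : E → Matrix m m ℂ} {F' : m → m → E →L[ℝ] ℂ}
    (h : ∀ i j, HasFDerivAt (fun q => F q i j) (F' i j) p) (h1 : F p = 1) :
    HasFDerivAt (fun q => (F q).det) (∑ i, F' i i) p := by
  simp only [Matrix.det_apply]
  have key (σ : Equiv.Perm m) := (HasFDerivAt.finsetProd (u := Finset.univ)
    fun i _ => h (σ i) i).const_smul (Equiv.Perm.sign σ : ℤ)
  refine (HasFDerivAt.fun_sum fun σ (_ : σ ∈ Finset.univ) => key σ).congr_fderiv ?_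
  rw [Finset.sum_eq_single 1]
  · simp [h1]
  · intro σ _ hσ
    rw [Finset.sum_eq_zero, smul_zero]
    intro i _
    rw [h1, prod_erase_one_perm hσ]
    exact zero_smul ℂ (F' (σ i) i)
  · simp

end Determinant

/-! ### Maurer-Cartan forms -/

section MaurerCartan

variable {m : Type*} [Fintype m] [DecidableEq m] {U : Set (ℝ × ℝ)} {p w u : ℝ × ℝ}
  {ψ φ : ℝ × ℝ → Matrix m m ℂ}

/-- The pullback `ψ† dψ` of the Maurer-Cartan form, along the direction `w`. -/
def maurerCartan (ψ : ℝ × ℝ → Matrix m m ℂ) (w p : ℝ × ℝ) : Matrix m m ℂ := (ψ p)ᴴ * matD w ψ p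

lemma smoothOn_maurerCartan (hU : IsOpen U) (hψ : SmoothOn ψ U) (w : ℝ × ℝ) :
    SmoothOn (maurerCartan ψ w) U := hψ.conjTranspose.mul (hψ.matD hU w)

variable (hU : IsOpen U) (hψ : SmoothOn ψ U) (hu : ∀ p ∈ U, (ψ p)ᴴ * ψ p = 1) (hp : p ∈ U)
include hU hψ hu hp

lemma matD_eq_mul_maurerCartan (w : ℝ × ℝ) : matD w ψ p = ψ p * maurerCartan ψ w p := by
  rw [maurerCartan, ← mul_assoc, mul_eq_one_comm.1 (hu p hp), one_mul]

lemma maurerCartan_conjTranspose (w : ℝ × ℝ) :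
    (maurerCartan ψ w p)ᴴ = -maurerCartan ψ w p := by
  have h : matD w (fun q => (ψ q)ᴴ * ψ q) p = 0 := by
    rw [matD_congr (G := fun _ => (1 : Matrix m m ℂ)) hU hp fun q hq => hu q hq, matD_const]
  rw [matD_mul hU hp hψ.conjTranspose hψ, matD_conjTranspose] at h
  rw [maurerCartan, Matrix.conjTranspose_mul, Matrix.conjTranspose_conjTranspose]
  exact eq_neg_of_add_eq_zero_left h

lemma maurerCartan_flat (w u : ℝ × ℝ) : matD u (maurerCartan ψ w) p -
    matD w (maurerCartan ψ u) p = ⁅maurerCartan ψ w p, maurerCartan ψ u p⁆ := by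
  have key (w u : ℝ × ℝ) : matD u (maurerCartan ψ w) p =
      -(maurerCartan ψ u p * maurerCartan ψ w p) + (ψ p)ᴴ * matD u (matD w ψ) p := by
    change matD u (fun q => (ψ q)ᴴ * matD w ψ q) p = _
    rw [matD_mul hU hp hψ.conjTranspose (hψ.matD hU w), matD_conjTranspose,
      matD_eq_mul_maurerCartan hU hψ hu hp u, matD_eq_mul_maurerCartan hU hψ hu hp w,
      Matrix.conjTranspose_mul, maurerCartan_conjTranspose hU hψ hu hp,
      mul_assoc, ← mul_assoc (ψ p)ᴴ, hu p hp, one_mul, neg_mul]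
  rw [key, key, matD_comm hU hp hψ (w := w) (u := u), Ring.lie_def]
  abel

/-- The map q ↦ ψ(p)†ψ(q) is the identity at p and has constant determinant, and the derivative of
the determinant there is the trace. -/
lemma maurerCartan_trace (hd : ∀ p ∈ U, (ψ p).det = 1) (w : ℝ × ℝ) :
    (maurerCartan ψ w p).trace = 0 := by
  have hs : SmoothOn (fun q => (ψ p)ᴴ * ψ q) U := (SmoothOn.const _).mul hψ
  have h := hasFDerivAt_det (F := fun q => (ψ p)ᴴ * ψ q)
    (fun i j => (differentiableAt_of_smooth (hs i j) hU hp).hasFDerivAt) (hu p hp)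
  have h0 : HasFDerivAt (fun q => ((ψ p)ᴴ * ψ q).det) (0 : ℝ × ℝ →L[ℝ] ℂ) p := by
    refine (hasFDerivAt_const ((ψ p)ᴴ.det) p).congr_of_eventuallyEq ?_
    filter_upwards [hU.mem_nhds hp] with q hq
    rw [Matrix.det_mul, hd q hq, mul_one]
  have h2 := congrArg (fun L : ℝ × ℝ →L[ℝ] ℂ => L w) (h.unique h0)
  simp only [sum_apply, zero_apply] at h2
  have h3 := matD_mul (w := w) hU hp (SmoothOn.const (ψ p)ᴴ) hψ
  rw [matD_const, zero_mul, zero_add] at h3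
  rw [maurerCartan, ← h3]
  exact h2

end MaurerCartan

/-! ### Structure equations of a parallel frame -/

section Frames

variable {n : ℕ} {U : Set (ℝ × ℝ)} {p w u : ℝ × ℝ} {γ ψ φ : ℝ × ℝ → Mat n}
  {v : ℝ × ℝ → Fin n → ℂ}

/-- The half difference of the Maurer-Cartan forms along `w`. -/
def frameD (ψ φ : ℝ × ℝ → Mat n) (w p : ℝ × ℝ) : Mat n :=
  (1 / 2 : ℂ) • (maurerCartan ψ w p - maurerCartan φ w p)

/-- The half sum of the Maurer-Cartan forms along `w`. -/
def conD (ψ φ : ℝ × ℝ → Mat n) (w p : ℝ × ℝ) : Mat n :=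
  (1 / 2 : ℂ) • (maurerCartan ψ w p + maurerCartan φ w p)

lemma conD_add_frameD : conD ψ φ w p + frameD ψ φ w p = maurerCartan ψ w p := by
  rw [conD, frameD]; module

lemma conD_sub_frameD : conD ψ φ w p - frameD ψ φ w p = maurerCartan φ w p := by
  rw [conD, frameD]; module

/-- A smooth pair of maps to `SU(N)`. -/
structure IsSmoothLift (ψ φ : ℝ × ℝ → Mat n) (U : Set (ℝ × ℝ)) : Prop where
  isOpen : IsOpen U
  left : SmoothOn ψ U
  right : SmoothOn φ U
  unitary_left : ∀ p ∈ U, (ψ p)ᴴ * ψ p = 1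
  unitary_right : ∀ p ∈ U, (φ p)ᴴ * φ p = 1
  det_left : ∀ p ∈ U, (ψ p).det = 1
  det_right : ∀ p ∈ U, (φ p).det = 1

lemma mem_specialUnitaryGroup_iff {M : Mat n} :
    M ∈ Matrix.specialUnitaryGroup (Unit ⊕ Fin n) ℂ ↔ Mᴴ * M = 1 ∧ M.det = 1 := by
  rw [Matrix.mem_specialUnitaryGroup_iff, Matrix.mem_unitaryGroup_iff']; rfl

lemma IsParallelFrame.isSmoothLift (h : IsParallelFrame γ ψ φ v U) (hU : IsOpen U) :
    IsSmoothLift ψ φ U where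
  isOpen := hU
  left := h.smooth_left
  right := h.smooth_right
  unitary_left p hp := (mem_specialUnitaryGroup_iff.1 (h.mem_left p hp)).1
  unitary_right p hp := (mem_specialUnitaryGroup_iff.1 (h.mem_right p hp)).1
  det_left p hp := (mem_specialUnitaryGroup_iff.1 (h.mem_left p hp)).2
  det_right p hp := (mem_specialUnitaryGroup_iff.1 (h.mem_right p hp)).2

namespace IsSmoothLift

variable (h : IsSmoothLift ψ φ U) (hp : p ∈ U)
include h

lemma smoothOn_frameD (w : ℝ × ℝ) : SmoothOn (frameD ψ φ w) U :=
  ((smoothOn_maurerCartan h.isOpen h.left w).sub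
    (smoothOn_maurerCartan h.isOpen h.right w)).const_smul _

lemma smoothOn_conD (w : ℝ × ℝ) : SmoothOn (conD ψ φ w) U :=
  ((smoothOn_maurerCartan h.isOpen h.left w).add
    (smoothOn_maurerCartan h.isOpen h.right w)).const_smul _

include hp

lemma frameX_eq : frameX ψ φ p = frameD ψ φ (0, 1) p := by
  rw [frameX, mdx_eq_matD h.left h.isOpen hp, mdx_eq_matD h.right h.isOpen hp]; rfl

lemma frameT_eq : frameT ψ φ p = frameD ψ φ (1, 0) p := by
  rw [frameT, mdt_eq_matD h.left h.isOpen hp, mdt_eq_matD h.right h.isOpen hp]; rfl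

lemma conX_eq : conX ψ φ p = conD ψ φ (0, 1) p := by
  rw [conX, mdx_eq_matD h.left h.isOpen hp, mdx_eq_matD h.right h.isOpen hp]; rfl

lemma conT_eq : conT ψ φ p = conD ψ φ (1, 0) p := by
  rw [conT, mdt_eq_matD h.left h.isOpen hp, mdt_eq_matD h.right h.isOpen hp]; rfl

lemma frameD_conjTranspose (w : ℝ × ℝ) : (frameD ψ φ w p)ᴴ = -frameD ψ φ w p := by
  rw [frameD, Matrix.conjTranspose_smul, Matrix.conjTranspose_sub,
    maurerCartan_conjTranspose h.isOpen h.left h.unitary_left hp,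
    maurerCartan_conjTranspose h.isOpen h.right h.unitary_right hp]
  simp
  module

lemma conD_conjTranspose (w : ℝ × ℝ) : (conD ψ φ w p)ᴴ = -conD ψ φ w p := by
  rw [conD, Matrix.conjTranspose_smul, Matrix.conjTranspose_add,
    maurerCartan_conjTranspose h.isOpen h.left h.unitary_left hp,
    maurerCartan_conjTranspose h.isOpen h.right h.unitary_right hp]
  simp
  module

lemma frameD_trace (w : ℝ × ℝ) : (frameD ψ φ w p).trace = 0 := by
  rw [frameD, Matrix.trace_smul, Matrix.trace_sub,
    maurerCartan_trace h.isOpen h.left h.unitary_left hp h.det_left,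
    maurerCartan_trace h.isOpen h.right h.unitary_right hp h.det_right, sub_zero, smul_zero]

lemma conD_trace (w : ℝ × ℝ) : (conD ψ φ w p).trace = 0 := by
  rw [conD, Matrix.trace_smul, Matrix.trace_add,
    maurerCartan_trace h.isOpen h.left h.unitary_left hp h.det_left,
    maurerCartan_trace h.isOpen h.right h.unitary_right hp h.det_right, add_zero, smul_zero]

/-- The half difference of the Maurer-Cartan equations of ψ and φ is Cartan's torsion equation;
their half sum, in the next lemma, is the curvature equation of the symmetric space. -/
lemma matD_frameD_sub (w u : ℝ × ℝ) : matD u (frameD ψ φ w) p - matD w (frameD ψ φ u) p =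
    ⁅conD ψ φ w p, frameD ψ φ u p⁆ + ⁅frameD ψ φ w p, conD ψ φ u p⁆ := by
  have key (w u : ℝ × ℝ) : matD u (frameD ψ φ w) p =
      (1 / 2 : ℂ) • (matD u (maurerCartan ψ w) p - matD u (maurerCartan φ w) p) := by
    change matD u (fun q => (1 / 2 : ℂ) • (maurerCartan ψ w q - maurerCartan φ w q)) p = _
    have h1 := smoothOn_maurerCartan h.isOpen h.left w
    have h2 := smoothOn_maurerCartan h.isOpen h.right w
    rw [matD_const_smul h.isOpen hp _ (h1.sub h2), matD_sub h.isOpen hp h1 h2]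
  have h1 := maurerCartan_flat h.isOpen h.left h.unitary_left hp w u
  have h2 := maurerCartan_flat h.isOpen h.right h.unitary_right hp w u
  rw [key, key, ← smul_sub, sub_sub_sub_comm, h1, h2,
    ← conD_add_frameD (ψ := ψ) (φ := φ) (w := w), ← conD_sub_frameD (ψ := ψ) (φ := φ) (w := w),
    ← conD_add_frameD (ψ := ψ) (φ := φ) (w := u), ← conD_sub_frameD (ψ := ψ) (φ := φ) (w := u)]
  simp only [Ring.lie_def, add_mul, mul_add, sub_mul, mul_sub]
  module

lemma matD_conD_sub (w u : ℝ × ℝ) : matD u (conD ψ φ w) p - matD w (conD ψ φ u) p =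
    ⁅conD ψ φ w p, conD ψ φ u p⁆ + ⁅frameD ψ φ w p, frameD ψ φ u p⁆ := by
  have key (w u : ℝ × ℝ) : matD u (conD ψ φ w) p =
      (1 / 2 : ℂ) • (matD u (maurerCartan ψ w) p + matD u (maurerCartan φ w) p) := by
    change matD u (fun q => (1 / 2 : ℂ) • (maurerCartan ψ w q + maurerCartan φ w q)) p = _
    have h1 := smoothOn_maurerCartan h.isOpen h.left w
    have h2 := smoothOn_maurerCartan h.isOpen h.right w
    rw [matD_const_smul h.isOpen hp _ (h1.add h2), matD_add h.isOpen hp h1 h2]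
  have h1 := maurerCartan_flat h.isOpen h.left h.unitary_left hp w u
  have h2 := maurerCartan_flat h.isOpen h.right h.unitary_right hp w u
  rw [key, key, ← smul_sub, add_sub_add_comm, h1, h2,
    ← conD_add_frameD (ψ := ψ) (φ := φ) (w := w), ← conD_sub_frameD (ψ := ψ) (φ := φ) (w := w),
    ← conD_add_frameD (ψ := ψ) (φ := φ) (w := u), ← conD_sub_frameD (ψ := ψ) (φ := φ) (w := u)]
  simp only [Ring.lie_def, add_mul, mul_add, sub_mul, mul_sub]
  module

end IsSmoothLift

/-! ### Vector fields along the flow in terms of the frame -/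

/-- Levi-Civita derivative along `γ` in the direction `w`. -/
def covD (γ : ℝ × ℝ → Mat n) (w : ℝ × ℝ) (Y : ℝ × ℝ → Mat n) (p : ℝ × ℝ) : Mat n :=
  γ p * (matD w (fun q => (γ q)ᴴ * Y q) p + (1 / 2 : ℂ) • ⁅(γ p)ᴴ * matD w γ p, (γ p)ᴴ * Y p⁆)

/-- The vector field along `γ = ψ φ†` with frame matrix `y`. -/
def frameVec (ψ φ : ℝ × ℝ → Mat n) (y : ℝ × ℝ → Mat n) (p : ℝ × ℝ) : Mat n :=
  (2 : ℂ) • (ψ p * y p * (φ p)ᴴ)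

lemma covX_eq_covD {Y : ℝ × ℝ → Mat n} (hU : IsOpen U) (hγ : SmoothMat γ U) (hY : SmoothMat Y U)
    (hp : p ∈ U) : covX γ Y p = covD γ (0, 1) Y p := by
  rw [covX, covD, mdx_eq_matD hγ hU hp,
    mdx_eq_matD (F := fun q => (γ q)ᴴ * Y q) ((SmoothOn.conjTranspose hγ).mul hY) hU hp]

lemma covT_eq_covD {Y : ℝ × ℝ → Mat n} (hU : IsOpen U) (hγ : SmoothMat γ U) (hY : SmoothMat Y U)
    (hp : p ∈ U) : covT γ Y p = covD γ (1, 0) Y p := by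
  rw [covT, covD, mdt_eq_matD hγ hU hp,
    mdt_eq_matD (F := fun q => (γ q)ᴴ * Y q) ((SmoothOn.conjTranspose hγ).mul hY) hU hp]

namespace IsSmoothLift

variable (h : IsSmoothLift ψ φ U)
include h

lemma smoothOn_frameVec {y : ℝ × ℝ → Mat n} (hy : SmoothOn y U) : SmoothOn (frameVec ψ φ y) U :=
  ((h.left.mul hy).mul h.right.conjTranspose).const_smul _

variable (hγ : ∀ q ∈ U, γ q = ψ q * (φ q)ᴴ)
include hγ

lemma smoothOn_curve : SmoothOn γ U := (h.left.mul h.right.conjTranspose).congr hγ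

variable (hp : p ∈ U)
include hp

lemma coframe_frameVec (y : ℝ × ℝ → Mat n) :
    coframe (γ p) (frameVec ψ φ y p) = φ p * y p * (φ p)ᴴ := by
  rw [coframe, frameVec, hγ p hp, Matrix.conjTranspose_mul, Matrix.conjTranspose_conjTranspose,
    mul_smul_comm, smul_smul, mul_assoc, ← mul_assoc (ψ p)ᴴ, ← mul_assoc (ψ p)ᴴ,
    h.unitary_left p hp, one_mul, mul_assoc]
  norm_num

lemma matD_curve (w : ℝ × ℝ) : matD w γ p = frameVec ψ φ (frameD ψ φ w) p := by
  rw [matD_congr h.isOpen hp (F := γ) (G := fun q => ψ q * (φ q)ᴴ) hγ,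
    matD_mul h.isOpen hp h.left h.right.conjTranspose, matD_conjTranspose,
    matD_eq_mul_maurerCartan h.isOpen h.left h.unitary_left hp,
    matD_eq_mul_maurerCartan h.isOpen h.right h.unitary_right hp, Matrix.conjTranspose_mul,
    maurerCartan_conjTranspose h.isOpen h.right h.unitary_right hp, frameVec, frameD]
  simp only [mul_smul_comm, smul_mul_assoc, smul_smul, mul_sub, sub_mul, mul_neg, neg_mul,
    mul_assoc]
  norm_num
  abel

/-- Differentiating φyφ† produces the commutator of y with φ†dφ = ω - e, and the term ½[γ†dγ, ·] of
the Levi-Civita derivative adds [e, y], leaving ω alone. -/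
lemma covD_frameVec {y : ℝ × ℝ → Mat n} (hy : SmoothOn y U) (w : ℝ × ℝ) :
    covD γ w (frameVec ψ φ y) p =
      frameVec ψ φ (fun q => matD w y q + ⁅conD ψ φ w q, y q⁆) p := by
  have hco (y : ℝ × ℝ → Mat n) {q : ℝ × ℝ} (hq : q ∈ U) :
      (γ q)ᴴ * frameVec ψ φ y q = (2 : ℂ) • (φ q * y q * (φ q)ᴴ) := by
    rw [← h.coframe_frameVec hγ hq, coframe, smul_smul]; norm_num
  have h1 : matD w (fun q => (γ q)ᴴ * frameVec ψ φ y q) p = (2 : ℂ) •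
      (φ p * (matD w y p + ⁅maurerCartan φ w p, y p⁆) * (φ p)ᴴ) := by
    rw [matD_congr h.isOpen hp (G := fun q => (2 : ℂ) • (φ q * y q * (φ q)ᴴ)) fun q hq => hco y hq,
      matD_const_smul h.isOpen hp _ ((h.right.mul hy).mul h.right.conjTranspose),
      matD_mul h.isOpen hp (h.right.mul hy) h.right.conjTranspose,
      matD_mul h.isOpen hp h.right hy, matD_conjTranspose,
      matD_eq_mul_maurerCartan h.isOpen h.right h.unitary_right hp, Matrix.conjTranspose_mul,
      maurerCartan_conjTranspose h.isOpen h.right h.unitary_right hp, Ring.lie_def]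
    congr 1
    noncomm_ring
  have hφ := h.unitary_right p hp
  have hconj (a b : Mat n) : (φ p * a * (φ p)ᴴ) * (φ p * b * (φ p)ᴴ) =
      φ p * (a * b) * (φ p)ᴴ := by
    calc _ = φ p * a * ((φ p)ᴴ * φ p) * b * (φ p)ᴴ := by noncomm_ring
      _ = _ := by rw [hφ]; noncomm_ring
  rw [covD, h1, h.matD_curve hγ hp, hco _ hp, hco _ hp, hγ p hp, frameVec,
    ← conD_sub_frameD (ψ := ψ)]
  simp only [Ring.lie_def, smul_mul_assoc, mul_smul_comm, hconj, smul_smul, ← smul_sub]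
  have hψ (a : Mat n) : ψ p * (φ p)ᴴ * (φ p * a * (φ p)ᴴ) = ψ p * a * (φ p)ᴴ := by
    calc _ = ψ p * ((φ p)ᴴ * φ p) * a * (φ p)ᴴ := by noncomm_ring
      _ = _ := by rw [hφ, mul_one]
  rw [mul_add, mul_smul_comm, mul_smul_comm, hψ, mul_sub (ψ p * (φ p)ᴴ), hψ, hψ]
  simp only [mul_add, add_mul, mul_sub, sub_mul]
  module

end IsSmoothLift

end Frames

/-! ### Linear differential equations with skew-Hermitian coefficients -/

section LinearODE

theorem exists_local_solution {E : Type*} [NormedAddCommGroup E] [NormedSpace ℝ E]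
    [CompleteSpace E] {L : ℝ → E →L[ℝ] E} {T : Set ℝ} (hT : IsOpen T) (hL : ContinuousOn L T)
    {c : ℝ} (hc : c ∈ T) (x₀ : E) : ∃ ε > 0, Set.Ioo (c - ε) (c + ε) ⊆ T ∧
      ∃ α : ℝ → E, α c = x₀ ∧ ∀ t ∈ Set.Ioo (c - ε) (c + ε), HasDerivAt α (L t (α t)) t := by
  obtain ⟨δ, hδ, hδT⟩ : ∃ δ > 0, ∀ t, dist t c < δ → t ∈ T ∧ ‖L t‖ < ‖L c‖ + 1 := by
    have h1 : ∀ᶠ t in nhds c, ‖L t‖ < ‖L c‖ + 1 :=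
      (hL.continuousAt (hT.mem_nhds hc)).norm.eventually_lt_const (by linarith)
    exact Metric.eventually_nhds_iff.1 (Filter.Eventually.and (hT.mem_nhds hc : ∀ᶠ t in nhds c, t ∈ T) h1)
  set K : ℝ := ‖L c‖ + 1 with hK
  have hK0 : 0 < K := by positivity
  -- K bounds the operators near c, and M bounds the vector field on the unit ball around x₀; a time
  -- ε ≤ 1/M keeps the solution inside this ball.
  set M : ℝ := K * (‖x₀‖ + 1) with hM
  have hM0 : 0 < M := by positivity
  set ε : ℝ := min (δ / 2) (1 / M) with hε
  have hε0 : 0 < ε := lt_min (by linarith) (by positivity)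
  have hIcc : ∀ t ∈ Set.Icc (c - ε) (c + ε), t ∈ T ∧ ‖L t‖ < K := fun t ht => by
    refine hδT t ?_
    rw [Real.dist_eq]
    have : ε ≤ δ / 2 := min_le_left _ _
    have : |t - c| ≤ ε := abs_le.2 ⟨by linarith [ht.1], by linarith [ht.2]⟩
    linarith
  obtain ⟨K', hK'⟩ : ∃ K' : NNReal, (K' : ℝ) = K := ⟨⟨K, hK0.le⟩, rfl⟩
  obtain ⟨M', hM'⟩ : ∃ M' : NNReal, (M' : ℝ) = M := ⟨⟨M, hM0.le⟩, rfl⟩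
  have hPL : IsPicardLindelof (fun t x => L t x) (tmin := c - ε) (tmax := c + ε)
      ⟨c, by constructor <;> linarith⟩ x₀ 1 0 M' K' := by
    refine ⟨fun t ht => ?_, fun x _ => ?_, fun t ht x hx => ?_, ?_⟩
    · exact ((L t).lipschitz.weaken (NNReal.coe_le_coe.1
        (by rw [hK', coe_nnnorm]; exact (hIcc t ht).2.le))).lipschitzOnWith
    · exact (hL.mono fun t ht => (hIcc t ht).1).clm_apply continuousOn_const
    · have h1 : ‖x‖ ≤ ‖x₀‖ + 1 := by
        have h2 : dist x x₀ ≤ 1 := hx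
        rw [dist_eq_norm] at h2
        calc ‖x‖ = ‖x₀ + (x - x₀)‖ := by rw [add_sub_cancel]
          _ ≤ ‖x₀‖ + ‖x - x₀‖ := norm_add_le _ _
          _ ≤ _ := by linarith
      rw [hM']
      calc ‖L t x‖ ≤ ‖L t‖ * ‖x‖ := (L t).le_opNorm x
        _ ≤ K * (‖x₀‖ + 1) := by
          have := (hIcc t ht).2.le
          gcongr
    · have h1 : M * ε ≤ 1 := by
        calc M * ε ≤ M * (1 / M) := by gcongr; exact min_le_right _ _
          _ = 1 := by field_simp
      simpa [hM'] using h1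
  obtain ⟨α, hα, hα'⟩ := hPL.exists_eq_forall_mem_Icc_hasDerivWithinAt₀
  refine ⟨ε, hε0, fun t ht => (hIcc t (Set.Ioo_subset_Icc_self ht)).1, α, hα, fun t ht => ?_⟩
  exact (hα' t (Set.Ioo_subset_Icc_self ht)).hasDerivAt (Icc_mem_nhds ht.1 ht.2)

variable {m : Type*} [Fintype m] [DecidableEq m] {A : ℝ → Matrix m m ℂ} {T I : Set ℝ} {c d e : ℝ}

/-- Entrywise derivative of a matrix function of a real variable. -/
def HasMatDeriv (F : ℝ → Matrix m m ℂ) (F' : Matrix m m ℂ) (t : ℝ) : Prop :=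
  ∀ i j, HasDerivAt (fun s => F s i j) (F' i j) t

lemma HasMatDeriv.mul {F G : ℝ → Matrix m m ℂ} {F' G' : Matrix m m ℂ} {t : ℝ}
    (hF : HasMatDeriv F F' t) (hG : HasMatDeriv G G' t) :
    HasMatDeriv (fun s => F s * G s) (F' * G t + F t * G') t := fun i j => by
  simp only [Matrix.mul_apply, Matrix.add_apply, ← Finset.sum_add_distrib]
  exact HasDerivAt.fun_sum fun k _ => (hF i k).mul (hG k j)

lemma HasMatDeriv.conjTranspose {F : ℝ → Matrix m m ℂ} {F' : Matrix m m ℂ} {t : ℝ}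
    (hF : HasMatDeriv F F' t) : HasMatDeriv (fun s => (F s)ᴴ) F'ᴴ t :=
  fun i j => (hF j i).star

lemma HasMatDeriv.const (M : Matrix m m ℂ) (t : ℝ) : HasMatDeriv (fun _ => M) 0 t :=
  fun _ _ => hasDerivAt_const _ _

lemma HasMatDeriv.congr {F G : ℝ → Matrix m m ℂ} {F' : Matrix m m ℂ} {t : ℝ}
    (hF : HasMatDeriv F F' t) (hI : IsOpen I) (ht : t ∈ I) (h : Set.EqOn G F I) :
    HasMatDeriv G F' t := fun i j =>
  (hF i j).congr_of_eventuallyEq (by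
    filter_upwards [hI.mem_nhds ht] with s hs using by rw [h hs])

lemma eq_of_hasMatDeriv_zero {F : ℝ → Matrix m m ℂ} (hI : IsOpen I) (hI' : IsPreconnected I)
    (h : ∀ t ∈ I, HasMatDeriv F 0 t) (hc : c ∈ I) (hd : d ∈ I) : F c = F d := by
  ext i j
  exact hI.is_const_of_deriv_eq_zero hI'
    (fun t ht => (h t ht i j).differentiableAt.differentiableWithinAt)
    (fun t ht => (h t ht i j).deriv) hc hd

/-- A unitary solution of `G' = A G` on `I`. -/
structure IsRotation (A : ℝ → Matrix m m ℂ) (I : Set ℝ) (G : ℝ → Matrix m m ℂ) : Prop where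
  unitary : ∀ t ∈ I, (G t)ᴴ * G t = 1
  deriv : ∀ t ∈ I, HasMatDeriv G (A t * G t) t

/-- Skewness of A makes the derivative of G†H vanish. This yields unitarity of solutions and their
uniqueness, which is all that gluing needs. -/
lemma conjTranspose_mul_const {G H : ℝ → Matrix m m ℂ} (hI : IsOpen I) (hI' : IsPreconnected I)
    (hA : ∀ t ∈ I, (A t)ᴴ = -A t) (hG : ∀ t ∈ I, HasMatDeriv G (A t * G t) t)
    (hH : ∀ t ∈ I, HasMatDeriv H (A t * H t) t) (hc : c ∈ I) (hd : d ∈ I) :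
    (G c)ᴴ * H c = (G d)ᴴ * H d := by
  refine eq_of_hasMatDeriv_zero (F := fun t => (G t)ᴴ * H t) hI hI' (fun t ht => ?_) hc hd
  have h := (hG t ht).conjTranspose.mul (hH t ht)
  have h0 : (A t * G t)ᴴ * H t + (G t)ᴴ * (A t * H t) = 0 := by
    rw [Matrix.conjTranspose_mul, hA t ht]; noncomm_ring
  rwa [h0] at h

section Local

attribute [local instance] Matrix.normedAddCommGroup Matrix.normedSpace

lemma exists_local_rotation (hT : IsOpen T) (hA : ∀ i j, ContinuousOn (fun t => A t i j) T)
    (hs : ∀ t ∈ T, (A t)ᴴ = -A t) (hc : c ∈ T) : ∃ ε > 0, Set.Ioo (c - ε) (c + ε) ⊆ T ∧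
      ∃ G, IsRotation A (Set.Ioo (c - ε) (c + ε)) G := by
  let B : Matrix m m ℂ →ₗ[ℝ] (Matrix m m ℂ →L[ℝ] Matrix m m ℂ) :=
    LinearMap.toContinuousLinearMap.toLinearMap ∘ₗ LinearMap.mul ℝ (Matrix m m ℂ)
  have hB : Continuous B := B.continuous_of_finiteDimensional
  have hA' : ContinuousOn A T := continuousOn_pi.2 fun i => continuousOn_pi.2 fun j => hA i j
  have : CompleteSpace (Matrix m m ℂ) := FiniteDimensional.complete ℝ _
  obtain ⟨ε, hε, hεT, G, hG1, hG⟩ := exists_local_solution hT (hB.comp_continuousOn hA') hc 1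
  have hd : ∀ t ∈ Set.Ioo (c - ε) (c + ε), HasMatDeriv G (A t * G t) t := fun t ht i j =>
    hasDerivAt_pi.1 (hasDerivAt_pi.1 (hG t ht) i) j
  refine ⟨ε, hε, hεT, G, fun t ht => ?_, hd⟩
  rw [conjTranspose_mul_const isOpen_Ioo isPreconnected_Ioo (fun t ht => hs t (hεT ht)) hd hd ht
    (d := c) ⟨by linarith, by linarith⟩, hG1]
  simp

end Local

/-- The points `c`, `d` lie in an open interval on which there is a unitary solution. -/
def Linked (A : ℝ → Matrix m m ℂ) (T : Set ℝ) (c d : ℝ) : Prop :=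
  ∃ I, IsOpen I ∧ IsPreconnected I ∧ c ∈ I ∧ d ∈ I ∧ I ⊆ T ∧ ∃ G, IsRotation A I G

lemma IsRotation.mul_const {G : ℝ → Matrix m m ℂ} (hG : IsRotation A I G) {M : Matrix m m ℂ}
    (hM : Mᴴ * M = 1) : IsRotation A I fun t => G t * M where
  unitary t ht := by
    rw [Matrix.conjTranspose_mul]
    calc _ = Mᴴ * ((G t)ᴴ * G t) * M := by noncomm_ring
      _ = 1 := by rw [hG.unitary t ht, mul_one, hM]
  deriv t ht := by
    have h := (hG.deriv t ht).mul (HasMatDeriv.const M t)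
    rwa [mul_zero, add_zero, mul_assoc] at h

lemma IsRotation.eqOn {G H : ℝ → Matrix m m ℂ} (hG : IsRotation A I G) (hH : IsRotation A I H)
    (hI : IsOpen I) (hI' : IsPreconnected I) (hA : ∀ t ∈ I, (A t)ᴴ = -A t) (hc : c ∈ I)
    (h : G c = H c) : Set.EqOn G H I := fun t ht => by
  have h1 := conjTranspose_mul_const hI hI' hA hG.deriv hH.deriv ht hc
  rw [h, hH.unitary c hc] at h1
  calc G t = G t * ((G t)ᴴ * H t) := by rw [h1, mul_one]
    _ = H t := by rw [← mul_assoc, mul_eq_one_comm.1 (hG.unitary t ht), one_mul]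

lemma IsRotation.mono {G : ℝ → Matrix m m ℂ} (hG : IsRotation A I G) {J : Set ℝ} (h : J ⊆ I) :
    IsRotation A J G := ⟨fun t ht => hG.unitary t (h ht), fun t ht => hG.deriv t (h ht)⟩

lemma IsRotation.congr {G H : ℝ → Matrix m m ℂ} (hG : IsRotation A I G) (hI : IsOpen I)
    (h : Set.EqOn H G I) : IsRotation A I H where
  unitary t ht := by rw [h ht]; exact hG.unitary t ht
  deriv t ht := by rw [h ht]; exact (hG.deriv t ht).congr hI ht h

lemma IsRotation.union {G : ℝ → Matrix m m ℂ} {J : Set ℝ} (hI : IsRotation A I G)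
    (hJ : IsRotation A J G) : IsRotation A (I ∪ J) G where
  unitary t ht := ht.elim (hI.unitary t) (hJ.unitary t)
  deriv t ht := ht.elim (hI.deriv t) (hJ.deriv t)

lemma IsRotation.normalize {G : ℝ → Matrix m m ℂ} (hG : IsRotation A I G) (hc : c ∈ I) :
    IsRotation A I (fun t => G t * (G c)ᴴ) ∧ G c * (G c)ᴴ = 1 := by
  have h := mul_eq_one_comm.1 (hG.unitary c hc)
  exact ⟨hG.mul_const (by rw [Matrix.conjTranspose_conjTranspose, h]), h⟩

lemma Linked.trans (hA : ∀ t ∈ T, (A t)ᴴ = -A t) (h₁ : Linked A T c d) (h₂ : Linked A T d e) :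
    Linked A T c e := by
  classical
  obtain ⟨I, hI, hI', hcI, hdI, hIT, G, hG⟩ := h₁
  obtain ⟨J, hJ, hJ', hdJ, heJ, hJT, H, hH⟩ := h₂
  obtain ⟨hG, hG1⟩ := hG.normalize hdI
  obtain ⟨hH, hH1⟩ := hH.normalize hdJ
  refine ⟨I ∪ J, hI.union hJ, hI'.union d hdI hdJ hJ', Or.inl hcI, Or.inr heJ,
    Set.union_subset hIT hJT, fun t => if t ∈ I then G t * (G d)ᴴ else H t * (H d)ᴴ, ?_⟩
  have hEqI : Set.EqOn (fun t => if t ∈ I then G t * (G d)ᴴ else H t * (H d)ᴴ)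
    (fun t => G t * (G d)ᴴ) I := fun t ht => if_pos ht
  have hIJ : Set.EqOn (fun t => G t * (G d)ᴴ) (fun t => H t * (H d)ᴴ) (I ∩ J) :=
    (hG.mono Set.inter_subset_left).eqOn (hH.mono Set.inter_subset_right) (hI.inter hJ)
      (hI'.ordConnected.inter hJ'.ordConnected).isPreconnected (fun t ht => hA t (hIT ht.1))
      ⟨hdI, hdJ⟩ (hG1.trans hH1.symm)
  have hEqJ : Set.EqOn (fun t => if t ∈ I then G t * (G d)ᴴ else H t * (H d)ᴴ)
      (fun t => H t * (H d)ᴴ) J := fun t ht => by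
    by_cases hI : t ∈ I
    · exact (if_pos hI).trans (hIJ ⟨hI, ht⟩)
    · exact if_neg hI
  exact (hG.congr hI hEqI).union (hH.congr hJ hEqJ)

/-- Being linked holds locally by the local existence theorem and is symmetric and transitive, so it
holds throughout the connected set T. -/
lemma linked_of_mem (hT : IsOpen T) (hT' : IsPreconnected T)
    (hA : ∀ i j, ContinuousOn (fun t => A t i j) T) (hs : ∀ t ∈ T, (A t)ᴴ = -A t) (hc : c ∈ T)
    (hd : d ∈ T) : Linked A T c d := by
  refine hT'.induction₂ (Linked A T) (fun x hx => ?_) (fun x y z _ _ _ h₁ h₂ => h₁.trans hs h₂)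
    (fun x y _ _ h => ?_) hc hd
  · obtain ⟨ε, hε, hεT, G, hG⟩ := exists_local_rotation hT hA hs hx
    have : ∀ᶠ y in nhds x, y ∈ Set.Ioo (x - ε) (x + ε) :=
      Ioo_mem_nhds (by linarith) (by linarith)
    filter_upwards [nhdsWithin_le_nhds this] with y hy
    exact ⟨_, isOpen_Ioo, isPreconnected_Ioo, ⟨by linarith, by linarith⟩, hy, hεT, G, hG⟩
  · obtain ⟨I, hI, hI', hcI, hdI, hIT, hG⟩ := h
    exact ⟨I, hI, hI', hdI, hcI, hIT, hG⟩

/-- Solutions normalized at c agree on the intersections of their intervals, so they define one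
solution on T. -/
theorem exists_rotation (hT : IsOpen T) (hT' : IsPreconnected T)
    (hA : ∀ i j, ContinuousOn (fun t => A t i j) T) (hs : ∀ t ∈ T, (A t)ᴴ = -A t) (hc : c ∈ T) :
    ∃ g, IsRotation A T g ∧ g c = 1 := by
  have h : ∀ d : T, ∃ I, IsOpen I ∧ IsPreconnected I ∧ c ∈ I ∧ (d : ℝ) ∈ I ∧ I ⊆ T ∧
      ∃ G, IsRotation A I G ∧ G c = 1 := fun d => by
    obtain ⟨I, hI, hI', hcI, hdI, hIT, G, hG⟩ := linked_of_mem hT hT' hA hs hc d.2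
    exact ⟨I, hI, hI', hcI, hdI, hIT, _, (hG.normalize hcI).1, (hG.normalize hcI).2⟩
  choose I hI hI' hcI hdI hIT G hG hG1 using h
  classical
  let g : ℝ → Matrix m m ℂ := fun t => if ht : t ∈ T then G ⟨t, ht⟩ t else 1
  have hg (d : T) : Set.EqOn g (G d) (I d) := fun t ht => by
    have htT := hIT d ht
    have : g t = G ⟨t, htT⟩ t := dif_pos htT
    rw [this]
    exact ((hG ⟨t, htT⟩).mono Set.inter_subset_left).eqOn ((hG d).mono Set.inter_subset_right)
      ((hI _).inter (hI d)) ((hI' _).ordConnected.inter (hI' d).ordConnected).isPreconnected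
      (fun s hs' => hs s (hIT _ hs'.1)) ⟨hcI _, hcI d⟩ ((hG1 _).trans (hG1 d).symm)
      ⟨hdI ⟨t, htT⟩, ht⟩
  refine ⟨g, ⟨fun t ht => ?_, fun t ht => ?_⟩, ?_⟩
  · rw [hg ⟨t, ht⟩ (hdI ⟨t, ht⟩)]; exact (hG ⟨t, ht⟩).unitary t (hdI ⟨t, ht⟩)
  · rw [hg ⟨t, ht⟩ (hdI ⟨t, ht⟩)]
    exact ((hG ⟨t, ht⟩).deriv t (hdI ⟨t, ht⟩)).congr (hI _) (hdI ⟨t, ht⟩) (hg ⟨t, ht⟩)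
  · rw [hg ⟨c, hc⟩ (hcI _), hG1]

lemma IsRotation.contDiffOn {g : ℝ → Matrix m m ℂ} (hg : IsRotation A T g) (hT : IsOpen T)
    (hA : ∀ i j, ContDiffOn ℝ ∞ (fun t => A t i j) T) (i j : m) :
    ContDiffOn ℝ ∞ (fun t => g t i j) T := by
  have hd (i j : m) : DifferentiableOn ℝ (fun t => g t i j) T := fun t ht =>
    (hg.deriv t ht i j).differentiableAt.differentiableWithinAt
  refine contDiffOn_infty.2 fun N => ?_
  induction N generalizing i j with
  | zero => exact contDiffOn_zero.2 (hd i j).continuousOn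
  | succ N ih =>
    rw [Nat.cast_succ, contDiffOn_succ_iff_deriv_of_isOpen hT]
    refine ⟨hd i j, by simp, ?_⟩
    have : ContDiffOn ℝ N (fun t => ∑ k, A t i k * g t k j) T := ContDiffOn.sum fun k _ =>
      ((hA i k).of_le (by exact_mod_cast le_top)).mul (ih k j)
    exact this.congr fun t ht => by rw [(hg.deriv t ht i j).deriv, Matrix.mul_apply]

lemma IsRotation.det_eq_one {g : ℝ → Matrix m m ℂ} (hg : IsRotation A T g) (hT : IsOpen T)
    (hT' : IsPreconnected T) (htr : ∀ t ∈ T, (A t).trace = 0) (hc : c ∈ T) (h1 : g c = 1)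
    (hd : d ∈ T) : (g d).det = 1 := by
  have key : ∀ t ∈ T, HasDerivAt (fun s => (g s).det) 0 t := fun t ht => by
    have hu := mul_eq_one_comm.1 (hg.unitary t ht)
    have h := (hg.deriv t ht).mul (HasMatDeriv.const (g t)ᴴ t)
    have h2 := hasFDerivAt_det (fun i j => (h i j).hasFDerivAt) hu
    have h3 := (h2.hasDerivAt.mul_const (g t).det)
    have hz : (∑ i, ContinuousLinearMap.toSpanSingleton ℝ
        ((A t * g t * (g t)ᴴ + g t * 0 : Matrix m m ℂ) i i) : ℝ →L[ℝ] ℂ) 1 = 0 := by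
      simp only [sum_apply, ContinuousLinearMap.toSpanSingleton_apply, one_smul, mul_zero, add_zero,
        mul_assoc, hu, mul_one]
      exact htr t ht
    rw [hz, zero_mul] at h3
    refine h3.congr_of_eventuallyEq (Filter.Eventually.of_forall fun s => ?_)
    change _ = (g s * (g t)ᴴ).det * (g t).det
    rw [← Matrix.det_mul, mul_assoc, hg.unitary t ht, mul_one]
  rw [hT.is_const_of_deriv_eq_zero hT' (fun t ht => (key t ht).differentiableAt.differentiableWithinAt)
    (fun t ht => (key t ht).deriv) hd hc, h1, Matrix.det_one]

/-- Mg solves the same equation as g, so g†Mg is constant and equal to its value M at c. -/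
lemma IsRotation.commute {g : ℝ → Matrix m m ℂ} (hg : IsRotation A T g) (hT : IsOpen T)
    (hT' : IsPreconnected T) (hs : ∀ t ∈ T, (A t)ᴴ = -A t) {M : Matrix m m ℂ}
    (hM : ∀ t ∈ T, Commute M (A t)) (hc : c ∈ T) (h1 : g c = 1)
    (hd : d ∈ T) : M * g d = g d * M := by
  have h : (g d)ᴴ * (M * g d) = (g c)ᴴ * (M * g c) := by
    refine conjTranspose_mul_const hT hT' hs hg.deriv (H := fun t => M * g t) (fun t ht => ?_) hd hc
    have h := (HasMatDeriv.const M t).mul (hg.deriv t ht)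
    rwa [zero_mul, zero_add, ← mul_assoc, (hM t ht).eq, mul_assoc] at h
  rw [h1, Matrix.conjTranspose_one, one_mul, mul_one] at h
  calc M * g d = g d * ((g d)ᴴ * (M * g d)) := by
        rw [← mul_assoc, mul_eq_one_comm.1 (hg.unitary d hd), one_mul]
    _ = _ := by rw [h]

end LinearODE

/-! ### The first two coefficients of the projector hierarchy -/

section LowOrder

variable {R : Type*} [Ring R] [Algebra ℂ R] {p : R} {D : R →ₗ[ℂ] R}

lemma projSeq_one : projSeq p D 1 = Complex.I • ⁅p, D p⁆ := by
  rw [projSeq_succ, projSeq_zero]; simp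

lemma projSeq_two (hp : p * p = p) (hD : ∀ a b, D (a * b) = D a * b + a * D b) :
    projSeq p D 2 = -D (D p) - (3 / 2 : ℂ) • ⁅D p, ⁅D p, p⁆⁆ := by
  -- The equation p² = p and its first two derivatives become rules that move p to the left past Dp
  -- and D²p; both sides are then compared in normal form.
  have hq : D p * p = D p - p * D p := by
    have h := hD p p
    rw [hp] at h
    exact eq_sub_of_add_eq h.symm
  have hr : D (D p) * p = D (D p) - (2 : ℂ) • (D p * D p) - p * D (D p) := by
    have h := congrArg D hq
    rw [map_sub, hD, hD] at h
    rw [eq_sub_of_add_eq h, two_smul]; abel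
  have hp' (x : R) : p * (p * x) = p * x := by rw [← mul_assoc, hp]
  have hq' (x : R) : D p * (p * x) = D p * x - p * (D p * x) := by
    rw [← mul_assoc, hq, sub_mul, mul_assoc]
  have hdq : D (Complex.I • ⁅p, D p⁆) = Complex.I • ⁅p, D (D p)⁆ := by
    rw [map_smul, Ring.lie_def, map_sub, hD, hD, Ring.lie_def]; congr 1; abel
  rw [projSeq_succ, projSeq_one, hdq]
  simp only [Finset.range_one, Finset.sum_singleton, zero_add, Nat.sub_zero, projSeq_one]
  simp only [Ring.lie_def, smul_mul_assoc, mul_smul_comm, smul_sub, smul_smul, Complex.I_mul_I,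
    mul_sub, sub_mul, mul_assoc, hp, hp', hq, hq', hr, one_mul, two_mul, add_mul]
  match_scalars <;> ring_nf <;> (try simp only [Complex.I_sq]) <;> norm_num

end LowOrder

/-! ### Flow equations as geometric equations for γ -/

section FlowsOfCurves

variable {n : ℕ} {U : Set (ℝ × ℝ)} {p w u : ℝ × ℝ} {γ ψ φ : ℝ × ℝ → Mat n}
  {v : ℝ × ℝ → Fin n → ℂ}

lemma jetNormal_one_lie (hn : 1 ≤ n) : ((kappa n : ℂ)⁻¹) • ⁅jetNormal n 0, jetNormal n 1⁆ =
    (kappa n : ℂ) • blockMat (jetH n 0) (jetS n 0) (jetT n 0) := by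
  have hk := kappa_ne_zero hn
  rw [frameConst_lie_jetNormal, blockMat_jet, jetProj, projSeq_one, smul_smul, smul_smul, smul_smul]
  change _ • ⁅projMat (DiffPoly n) n, jetCov n (projMat (DiffPoly n) n)⁆ = _
  congr 1
  field_simp
  linear_combination (-1 : ℂ) * Complex.I_sq

/-- The closed form of Π₂ from `projSeq_two`, written in ∇_xʲγ_x; the cube of -iκ in the double
bracket is absorbed by χ⁻¹ = κ⁻². -/
lemma jetNormal_two_lie (hn : 1 ≤ n) : jetNormal n 2 - (3 / 2 * (chi n : ℂ)⁻¹) •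
      ⁅jetNormal n 1, ⁅jetNormal n 1, jetNormal n 0⁆⁆ =
    (kappa n : ℂ) • blockMat (jetH n 1) (jetS n 1) (jetT n 1) := by
  have hk := kappa_ne_zero hn
  rw [blockMat_jet, jetProj, projSeq_two projMat_mul_self jetCov_mul, jetNormal_succ,
    jetNormal_succ, jetNormal_zero, frameConst, ← kappa_sq hn]
  change -(Complex.I * (kappa n : ℂ)) • jetCov n (jetCov n (projMat (DiffPoly n) n)) - _ •
    ⁅-(Complex.I * (kappa n : ℂ)) • jetCov n (projMat (DiffPoly n) n),
      ⁅-(Complex.I * (kappa n : ℂ)) • jetCov n (projMat (DiffPoly n) n), _⁆⁆ = _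
  have h1 : -(Complex.I * (kappa n : ℂ)) * (-(Complex.I * kappa n) * -(Complex.I * kappa n)) =
      Complex.I * (kappa n * kappa n) * kappa n := by
    linear_combination (-(Complex.I * kappa n ^ 3)) * Complex.I_mul_I
  simp only [Ring.lie_def, smul_mul_assoc, mul_smul_comm, smul_sub, smul_smul, mul_sub, sub_mul,
    one_mul, mul_one, smul_neg]
  have h2 : 3 / 2 * ((kappa n : ℂ) * kappa n)⁻¹ *
      (-(Complex.I * kappa n) * (-(Complex.I * kappa n) * -(Complex.I * kappa n))) =
      kappa n * (Complex.I * (3 / 2)) := by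
    rw [h1]; field_simp
  have h3 : -(Complex.I * (kappa n : ℂ)) * (-(Complex.I * kappa n) * -(Complex.I * kappa n)) =
    -(Complex.I * (kappa n : ℂ)) * -(Complex.I * kappa n) * -(Complex.I * kappa n) := by ring
  simp only [← mul_assoc] at h2 ⊢
  simp only [mul_comm, mul_left_comm] at h2 ⊢
  simp only [h2]
  module

lemma frameVec_inj (h : IsSmoothLift ψ φ U) (hp : p ∈ U) {y z : ℝ × ℝ → Mat n} :
    frameVec ψ φ y p = frameVec ψ φ z p ↔ y p = z p := by
  refine ⟨fun he => ?_, fun he => by rw [frameVec, he, frameVec]⟩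
  have key (y : ℝ × ℝ → Mat n) :
      (1 / 2 : ℂ) • ((ψ p)ᴴ * frameVec ψ φ y p * φ p) = y p := by
    rw [frameVec, mul_smul_comm, smul_mul_assoc, smul_smul]
    calc _ = (1 / 2 * 2 : ℂ) • (((ψ p)ᴴ * ψ p) * y p * ((φ p)ᴴ * φ p)) := by
          congr 1; noncomm_ring
      _ = y p := by rw [h.unitary_left p hp, h.unitary_right p hp]; norm_num
  rw [← key y, he, key z]

lemma adT_frameVec (h : IsSmoothLift ψ φ U) (hγ : ∀ q ∈ U, γ q = ψ q * (φ q)ᴴ) (hp : p ∈ U)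
    (y z : ℝ × ℝ → Mat n) : adT (γ p) (frameVec ψ φ y p) (frameVec ψ φ z p) =
      frameVec ψ φ (fun q => ⁅y q, z q⁆) p := by
  have hφ := h.unitary_right p hp
  rw [adT, h.coframe_frameVec hγ hp, h.coframe_frameVec hγ hp, hγ p hp, frameVec]
  congr 1
  simp only [Ring.lie_def]
  calc _ = ψ p * ((φ p)ᴴ * φ p) * (y p * ((φ p)ᴴ * φ p) * z p - z p * ((φ p)ᴴ * φ p) * y p) *
        (φ p)ᴴ := by noncomm_ring
    _ = _ := by rw [hφ]; noncomm_ring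

/-- Conjugation is an algebra automorphism, so noncommutative polynomials do not see whether vectors
are written in the parallel frame or in the left-invariant coframe. -/
lemma lift_conj {a : ℕ → Mat n} {g : Mat n} (hg : gᴴ * g = 1) (f : FreeAlgebra ℂ ℕ) :
    FreeAlgebra.lift ℂ (fun j => g * a j * gᴴ) f = g * FreeAlgebra.lift ℂ a f * gᴴ := by
  have hg' := mul_eq_one_comm.1 hg
  induction f using FreeAlgebra.induction with
  | grade0 c =>
    rw [AlgHom.commutes, AlgHom.commutes, ← Algebra.commutes, mul_assoc, hg', mul_one]
  | grade1 j => simp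
  | mul x y hx hy =>
    rw [map_mul, hx, hy, map_mul]
    calc _ = g * FreeAlgebra.lift ℂ a x * (gᴴ * g) * FreeAlgebra.lift ℂ a y * gᴴ := by
          noncomm_ring
      _ = _ := by rw [hg]; noncomm_ring
  | add x y hx hy => rw [map_add, hx, hy, map_add]; noncomm_ring

lemma connMatrix_lie_unitFrame (a : Fin n → ℂ) :
    ⁅connMatrix a, unitFrame n⁆ = flowMatrix (Complex.I • a) 0 0 := by
  rw [← frameConst_eq_unitFrame, frameConst, Ring.lie_def, connMatrix, projMat, flowMatrix]
  simp only [mul_smul_comm, smul_mul_assoc, mul_sub, sub_mul, mul_one, one_mul,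
    Matrix.fromBlocks_multiply]
  ext (i | i) (j | j) <;> simp <;> ring

lemma flowMatrix_eq_unitFrame :
    flowMatrix 0 (1 - 1 / (n + 1)) ((Complex.I / (n + 1)) • 1) = unitFrame n := by
  have : (n : ℂ) + 1 ≠ 0 := by exact_mod_cast Nat.succ_ne_zero n
  ext (i | i) (j | j)
  · simp [flowMatrix, unitFrame]; field_simp; ring
  · simp [flowMatrix, unitFrame]
  · simp [flowMatrix, unitFrame]
  · simp [flowMatrix, unitFrame, Matrix.one_apply]; split_ifs <;> field_simp

namespace IsParallelFrame

variable (hf : IsParallelFrame γ ψ φ v U) (hU : IsOpen U)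
include hf hU

lemma frameD_x (hp : p ∈ U) : frameD ψ φ (0, 1) p = unitFrame n := by
  rw [← (hf.isSmoothLift hU).frameX_eq hp, hf.frame p hp]

lemma conD_x (hp : p ∈ U) : conD ψ φ (0, 1) p = connMatrix (v p) := by
  rw [← (hf.isSmoothLift hU).conX_eq hp, hf.conn p hp]

lemma contDiffOn_conn (j : Fin n) : ContDiffOn ℝ ∞ (fun q => v q j) U := by
  refine ((hf.isSmoothLift hU).smoothOn_conD (0, 1) (Sum.inl ()) (Sum.inr j)).congr fun q hq => ?_
  rw [hf.conD_x hU hq]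
  simp [connMatrix]

lemma smoothOn_eval (M : JetMat n) : SmoothOn (fun q => evalMat v q M) U :=
  smoothOn_evalMat hU (hf.contDiffOn_conn hU) M

lemma matD_eval (hp : p ∈ U) (M : JetMat n) :
    matD (0, 1) (fun q => evalMat v q M) p + ⁅connMatrix (v p), evalMat v p M⁆ =
      evalMat v p (jetCov n M) := by
  rw [jetCov_apply, map_add, matD_evalMat hU (hf.contDiffOn_conn hU) hp, Ring.lie_def, Ring.lie_def,
    map_sub, map_mul, map_mul, evalMat_offMat]

lemma mdx_curve (hp : p ∈ U) :
    mdx γ p = frameVec ψ φ (fun q => evalMat v q (jetNormal n 0)) p := by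
  have h := hf.isSmoothLift hU
  rw [mdx_eq_matD (h.smoothOn_curve hf.lift) hU hp, h.matD_curve hf.lift hp, frameVec_inj h hp,
    hf.frameD_x hU hp, jetNormal_zero, evalMat_frameConst, frameConst_eq_unitFrame]

lemma mdt_curve (hp : p ∈ U) : mdt γ p = frameVec ψ φ (frameT ψ φ) p := by
  have h := hf.isSmoothLift hU
  rw [mdt_eq_matD (h.smoothOn_curve hf.lift) hU hp, h.matD_curve hf.lift hp, frameVec_inj h hp,
    h.frameT_eq hp]

lemma covX_of_eqOn {Y : ℝ × ℝ → Mat n} {M : JetMat n}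
    (hY : Set.EqOn Y (frameVec ψ φ fun q => evalMat v q M) U) :
    Set.EqOn (covX γ Y) (frameVec ψ φ fun q => evalMat v q (jetCov n M)) U := fun p hp => by
  have h := hf.isSmoothLift hU
  have hγ := h.smoothOn_curve hf.lift
  rw [covX_eq_covD hU hγ ((h.smoothOn_frameVec (hf.smoothOn_eval hU M)).congr hY) hp]
  have : covD γ (0, 1) Y p = covD γ (0, 1) (frameVec ψ φ fun q => evalMat v q M) p := by
    rw [covD, covD, hY hp, matD_congr hU hp
      (G := fun q => (γ q)ᴴ * frameVec ψ φ (fun q => evalMat v q M) q)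
      (fun q hq => by simp only [hY hq])]
  rw [this, h.covD_frameVec hf.lift hp (hf.smoothOn_eval hU M), frameVec_inj h hp,
    hf.conD_x hU hp, hf.matD_eval hU hp]

/-- This is the bridge from geometry to jets: e_x is constant and ∇_x acts on frame matrices as D_x
+ [W, ·] evaluated at v. -/
lemma iterate_covX (j : ℕ) :
    Set.EqOn ((covX γ)^[j] (mdx γ)) (frameVec ψ φ fun q => evalMat v q (jetNormal n j)) U := by
  induction j with
  | zero => exact fun p hp => hf.mdx_curve hU hp
  | succ j ih =>
    rw [Function.iterate_succ_apply', jetNormal_succ']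
    exact hf.covX_of_eqOn hU ih

lemma principalNormal (hp : p ∈ U) : (φ p)ᴴ * coframe (γ p) (covX γ (mdx γ) p) * φ p =
    flowMatrix (Complex.I • v p) 0 0 := by
  have h := hf.isSmoothLift hU
  have h1 := hf.iterate_covX hU 1 hp
  rw [Function.iterate_one] at h1
  rw [h1, h.coframe_frameVec hf.lift hp, jetNormal_succ', jetNormal_zero, ← hf.matD_eval hU hp]
  simp only [evalMat_frameConst]
  rw [matD_const, zero_add, frameConst_eq_unitFrame, connMatrix_lie_unitFrame]
  have hφ := h.unitary_right p hp
  calc _ = ((φ p)ᴴ * φ p) * flowMatrix (Complex.I • v p) 0 0 * ((φ p)ᴴ * φ p) := by noncomm_ring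
    _ = _ := by rw [hφ, one_mul, mul_one]

theorem isZeroFlow_iff :
    IsZeroFlow ψ φ U ↔ ∀ p ∈ U, mdt γ p = mdx γ p := by
  have h := hf.isSmoothLift hU
  refine forall₂_congr fun p hp => ?_
  rw [hf.mdt_curve hU hp, hf.mdx_curve hU hp, frameVec_inj h hp, flowMatrix_eq_unitFrame,
    jetNormal_zero, evalMat_frameConst, frameConst_eq_unitFrame]

lemma isFlow_iff_frameT (k : ℕ) : IsFlow (jetHierarchy n) k ψ φ v U ↔ ∀ p ∈ U, frameT ψ φ p =
    evalMat v p ((kappa n : ℂ) • blockMat (jetH n k) (jetS n k) (jetT n k)) := by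
  refine forall₂_congr fun p hp => ?_
  rw [map_smul, evalMat_blockMat, ← flowMatrix_eq_blockMat]
  rfl

theorem isFlow_iff_isGeometricMap {f : FreeAlgebra ℂ ℕ} {k : ℕ}
    (hk : FreeAlgebra.lift ℂ (jetNormal n) f =
      (kappa n : ℂ) • blockMat (jetH n k) (jetS n k) (jetT n k)) :
    IsFlow (jetHierarchy n) k ψ φ v U ↔ IsGeometricMap f γ U := by
  have h := hf.isSmoothLift hU
  rw [hf.isFlow_iff_frameT hU]
  refine forall₂_congr fun p hp => ?_
  have hφ := h.unitary_right p hp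
  have h1 : (fun j : ℕ => coframe (γ p) ((covX γ)^[j] (mdx γ) p)) =
      fun j => φ p * evalMat v p (jetNormal n j) * (φ p)ᴴ := funext fun j => by
    rw [hf.iterate_covX hU j hp, h.coframe_frameVec hf.lift hp]
  have h2 : FreeAlgebra.lift ℂ (fun j => evalMat v p (jetNormal n j)) f =
      evalMat v p (FreeAlgebra.lift ℂ (jetNormal n) f) := by
    have : FreeAlgebra.lift ℂ (fun j => evalMat v p (jetNormal n j)) =
        (evalMat v p).comp (FreeAlgebra.lift ℂ (jetNormal n)) := by
      ext j; simp
    rw [this]; rfl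
  rw [h1, lift_conj hφ, h2, hk, hf.mdt_curve hU hp, h.coframe_frameVec hf.lift hp]
  refine ⟨fun he => by rw [he], fun he => ?_⟩
  have key (a : Mat n) : (φ p)ᴴ * (φ p * a * (φ p)ᴴ) * φ p = a := by
    calc _ = ((φ p)ᴴ * φ p) * a * ((φ p)ᴴ * φ p) := by noncomm_ring
      _ = a := by rw [hφ, one_mul, mul_one]
  rw [← key (frameT ψ φ p), he, key]

theorem isFlow_iff_isSchrodingerMap (hn : 1 ≤ n) :
    IsFlow (jetHierarchy n) 0 ψ φ v U ↔ IsSchrodingerMap γ U := by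
  have h := hf.isSmoothLift hU
  rw [hf.isFlow_iff_frameT hU]
  refine forall₂_congr fun p hp => ?_
  have h1 := hf.iterate_covX hU 1 hp
  rw [Function.iterate_one] at h1
  rw [h1, hf.mdx_curve hU hp, adT_frameVec h hf.lift hp, hf.mdt_curve hU hp, ← jetNormal_one_lie hn]
  have h2 (c : ℂ) (y : ℝ × ℝ → Mat n) : c • frameVec ψ φ y p = frameVec ψ φ (fun q => c • y q) p := by
    simp only [frameVec, mul_smul_comm, smul_mul_assoc, smul_comm c]
  rw [h2, frameVec_inj h hp, map_smul, Ring.lie_def, Ring.lie_def, map_sub, map_mul, map_mul]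

theorem isFlow_iff_isMKdVMap (hn : 1 ≤ n) :
    IsFlow (jetHierarchy n) 1 ψ φ v U ↔ IsMKdVMap γ U := by
  have h := hf.isSmoothLift hU
  rw [hf.isFlow_iff_frameT hU]
  refine forall₂_congr fun p hp => ?_
  have h1 := hf.iterate_covX hU 1 hp
  have h3 := hf.iterate_covX hU 2 hp
  rw [Function.iterate_one] at h1
  change covX γ (covX γ (mdx γ)) p = _ at h3
  have h2 (c : ℂ) (y z : ℝ × ℝ → Mat n) : frameVec ψ φ y p - c • frameVec ψ φ z p =
      frameVec ψ φ (fun q => y q - c • z q) p := by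
    simp only [frameVec, mul_smul_comm, smul_mul_assoc, smul_comm c, mul_sub, sub_mul, smul_sub]
  rw [h1, h3, hf.mdx_curve hU hp, adT_frameVec h hf.lift hp, adT_frameVec h hf.lift hp,
    hf.mdt_curve hU hp, ← jetNormal_two_lie hn, h2, frameVec_inj h hp]
  simp only [map_smul, Ring.lie_def, map_sub, map_mul]

end IsParallelFrame

end FlowsOfCurves

/-! ### Block diagonal and off-diagonal matrices -/

section BlockParts

variable {n : ℕ}

/-- Block off-diagonal matrices. -/
def IsOffDiag (M : Mat n) : Prop := projMat ℂ n * M + M * projMat ℂ n = M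

lemma IsOffDiag.add {M K : Mat n} (hM : IsOffDiag M) (hK : IsOffDiag K) : IsOffDiag (M + K) := by
  unfold IsOffDiag at *
  rw [mul_add, add_mul, add_add_add_comm, hM, hK]

lemma IsOffDiag.smul {M : Mat n} (hM : IsOffDiag M) (c : ℂ) : IsOffDiag (c • M) := by
  unfold IsOffDiag at *
  rw [mul_smul_comm, smul_mul_assoc, ← smul_add, hM]

lemma IsOffDiag.neg {M : Mat n} (hM : IsOffDiag M) : IsOffDiag (-M) := by
  simpa using hM.smul (-1)

lemma IsOffDiag.sub {M K : Mat n} (hM : IsOffDiag M) (hK : IsOffDiag K) : IsOffDiag (M - K) := by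
  rw [sub_eq_add_neg]; exact hM.add hK.neg

lemma IsOffDiag.lie_right {M K : Mat n} (hM : IsOffDiag M) (hK : Commute (projMat ℂ n) K) :
    IsOffDiag ⁅M, K⁆ := by
  unfold IsOffDiag at *
  have h1 : projMat ℂ n * K * M = K * (projMat ℂ n * M) := by rw [hK.eq, mul_assoc]
  have h2 : M * (K * projMat ℂ n) = M * projMat ℂ n * K := by rw [← hK.eq, mul_assoc]
  calc _ = projMat ℂ n * M * K - projMat ℂ n * K * M + M * (K * projMat ℂ n) -
        K * (M * projMat ℂ n) := by rw [Ring.lie_def]; noncomm_ring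
    _ = ⁅projMat ℂ n * M + M * projMat ℂ n, K⁆ := by rw [h1, h2, Ring.lie_def]; noncomm_ring
    _ = _ := by rw [hM]

lemma isOffDiag_lie_projMat (M : Mat n) : IsOffDiag ⁅projMat ℂ n, M⁆ :=
  lie_isOffDiag projMat_mul_self M

lemma unitFrame_lie (M : Mat n) :
    ⁅unitFrame n, M⁆ = (-(Complex.I * kappa n)) • ⁅projMat ℂ n, M⁆ := by
  rw [← frameConst_eq_unitFrame, frameConst]
  simp only [Ring.lie_def, smul_sub, sub_mul, mul_sub, smul_mul_assoc, mul_smul_comm, one_mul,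
    mul_one]
  abel

lemma isOffDiag_lie_unitFrame (M : Mat n) : IsOffDiag ⁅unitFrame n, M⁆ := by
  rw [unitFrame_lie]; exact (isOffDiag_lie_projMat M).smul _

lemma isOffDiag_connMatrix (a : Fin n → ℂ) : IsOffDiag (connMatrix a) := by
  simp [IsOffDiag, connMatrix, projMat, Matrix.fromBlocks_multiply, Matrix.fromBlocks_add]

lemma IsOffDiag.eq_zero {M : Mat n} (hM : IsOffDiag M) (h : Commute (projMat ℂ n) M) : M = 0 := by
  unfold IsOffDiag at hM
  have h1 : projMat ℂ n * M = 0 := by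
    have h2 := congrArg (projMat ℂ n * ·) hM
    simp only [mul_add] at h2
    rw [← h.eq, ← mul_assoc, projMat_mul_self] at h2
    simpa using h2
  rw [← hM, ← h.eq, h1, add_zero]

lemma commute_projMat_of_lie (hn : 1 ≤ n) {M : Mat n} (h : ⁅unitFrame n, M⁆ = 0) :
    Commute (projMat ℂ n) M := by
  rw [unitFrame_lie, smul_eq_zero] at h
  rcases h with h | h
  · exact absurd h (neg_ne_zero.2 (mul_ne_zero Complex.I_ne_zero (kappa_ne_zero hn)))
  · exact sub_eq_zero.1 h

lemma eq_connMatrix {M : Mat n} (hM : IsOffDiag M) (hs : Mᴴ = -M) :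
    M = connMatrix fun j => M (Sum.inl ()) (Sum.inr j) := by
  unfold IsOffDiag at hM
  ext (i | i) (j | j)
  · have h := congrFun (congrFun hM (Sum.inl i)) (Sum.inl j)
    simpa [projMat, connMatrix, Matrix.mul_apply] using h
  · rfl
  · have h := congrFun (congrFun hs (Sum.inr i)) (Sum.inl j)
    simp only [Matrix.conjTranspose_apply, Matrix.neg_apply] at h
    simp only [connMatrix, Matrix.fromBlocks_apply₂₁, Matrix.neg_apply,
      Matrix.conjTranspose_apply, Matrix.replicateRow_apply]
    change _ = - star (M (Sum.inl j) (Sum.inr i))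
    rw [h, neg_neg]
  · have h := congrFun (congrFun hM (Sum.inr i)) (Sum.inr j)
    simp only [projMat, Matrix.add_apply, Matrix.mul_apply, Fintype.sum_sum_type] at h
    simp at h
    simp [connMatrix, ← h]

end BlockParts

/-! ### Gauge transformations of a parallel frame -/

section Gauge

variable {n : ℕ} {T X U : Set ℝ} {p w u : ℝ × ℝ} {γ ψ φ : ℝ × ℝ → Mat n}
  {v : ℝ × ℝ → Fin n → ℂ}

lemma eq_of_dx_eq_zero {f : ℝ × ℝ → ℂ} (hT : IsOpen T) (hX : IsOpen X) (hX' : X.OrdConnected)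
    (hf : ContDiffOn ℝ ∞ f (T ×ˢ X)) (h : ∀ p ∈ T ×ˢ X, fderiv ℝ f p (0, 1) = 0) {t x y : ℝ}
    (ht : t ∈ T) (hx : x ∈ X) (hy : y ∈ X) : f (t, x) = f (t, y) := by
  have key : ∀ z ∈ X, HasDerivAt (fun z => f (t, z)) 0 z := fun z hz => by
    have h1 : HasDerivAt (fun y : ℝ => (t, y)) ((0 : ℝ), (1 : ℝ)) z :=
      (hasDerivAt_const _ _).prodMk (hasDerivAt_id _)
    have h2 := HasFDerivAt.comp_hasDerivAt z (f := fun y : ℝ => (t, y))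
      (differentiableAt_of_smooth hf (hT.prod hX) (p := (t, z)) ⟨ht, hz⟩).hasFDerivAt h1
    rwa [h (t, z) ⟨ht, hz⟩] at h2
  exact hX.is_const_of_deriv_eq_zero hX'.isPreconnected
    (fun z hz => (key z hz).differentiableAt.differentiableWithinAt)
    (fun z hz => (key z hz).deriv) hx hy

/-- A change of the parallel frame by a map `g` to the isotropy group of `unitFrame`, with
`g_t = -Q g`. -/
structure IsGauge (Q : ℝ × ℝ → Mat n) (ψ φ : ℝ × ℝ → Mat n) (v : ℝ × ℝ → Fin n → ℂ)
    (ψ' φ' : ℝ × ℝ → Mat n) (v' : ℝ × ℝ → Fin n → ℂ) (g : ℝ × ℝ → Mat n)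
    (U : Set (ℝ × ℝ)) : Prop where
  unitary : ∀ p ∈ U, (g p)ᴴ * g p = 1
  left : ∀ p ∈ U, ψ' p = ψ p * g p
  right : ∀ p ∈ U, φ' p = φ p * g p
  conn : ∀ p ∈ U, connMatrix (v' p) = (g p)ᴴ * connMatrix (v p) * g p
  conT : ∀ p ∈ U, conT ψ' φ' p = (g p)ᴴ * (conT ψ φ p - Q p) * g p

/-- Solve g_t = -Qg in t alone. Then g is unitary of determinant 1 because Q is skew and traceless;
it commutes with p, so e_x is preserved; and g_x = 0, so ω_x is only conjugated and stays
off-diagonal. In ω_t the derivative of g subtracts Q. -/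
theorem exists_gauge (hT : IsOpen T) (hT' : T.OrdConnected) (hX : IsOpen X) (hX' : X.OrdConnected)
    (hf : IsParallelFrame γ ψ φ v (T ×ˢ X)) {Q : ℝ × ℝ → Mat n} (hQ : SmoothOn Q (T ×ˢ X))
    (hs : ∀ p ∈ T ×ˢ X, (Q p)ᴴ = -Q p) (htr : ∀ p ∈ T ×ˢ X, (Q p).trace = 0)
    (hP : ∀ p ∈ T ×ˢ X, Commute (projMat ℂ n) (Q p))
    (hx : ∀ p ∈ T ×ˢ X, matD (0, 1) Q p = 0) :
    ∃ ψ' φ' v' g, IsParallelFrame γ ψ' φ' v' (T ×ˢ X) ∧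
      IsGauge Q ψ φ v ψ' φ' v' g (T ×ˢ X) := by
  -- An empty domain offers no base point (c, x₀) for the initial value problem, but all conditions
  -- are then void.
  rcases (T ×ˢ X).eq_empty_or_nonempty with he | ⟨⟨c, x₀⟩, hc, hx₀⟩
  · refine ⟨ψ, φ, v, fun _ => 1, hf, ?_⟩
    rw [he]
    constructor <;> simp
  have hU := hT.prod hX
  have h := hf.isSmoothLift hU
  set A : ℝ → Mat n := fun t => -Q (t, x₀) with hAdef
  have hmem (t : ℝ) (ht : t ∈ T) : (t, x₀) ∈ T ×ˢ X := ⟨ht, hx₀⟩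
  have hA : ∀ i j, ContDiffOn ℝ ∞ (fun t => A t i j) T := fun i j =>
    ((hQ i j).comp (f := fun t : ℝ => (t, x₀)) (by fun_prop) hmem).neg
  have hAs : ∀ t ∈ T, (A t)ᴴ = -A t := fun t ht => by
    simp only [hAdef, Matrix.conjTranspose_neg, hs _ (hmem t ht)]
  have hAP : ∀ t ∈ T, Commute (projMat ℂ n) (A t) := fun t ht => (hP _ (hmem t ht)).neg_right
  have hAtr : ∀ t ∈ T, (A t).trace = 0 := fun t ht => by
    simp only [hAdef, Matrix.trace_neg, htr _ (hmem t ht), neg_zero]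
  have hAQ : ∀ p ∈ T ×ˢ X, A p.1 = -Q p := fun p hp => by
    ext i j
    simp only [hAdef, Matrix.neg_apply]
    rw [eq_of_dx_eq_zero hT hX hX' (hQ i j) (fun p hp => congrFun (congrFun (hx p hp) i) j)
      hp.1 hx₀ hp.2]
  obtain ⟨g₀, hg₀, hg1⟩ := exists_rotation hT hT'.isPreconnected
    (fun i j => (hA i j).continuousOn) hAs hc
  set g : ℝ × ℝ → Mat n := fun p => g₀ p.1 with hg
  have hgs : SmoothOn g (T ×ˢ X) := fun i j =>
    (hg₀.contDiffOn hT hA i j).comp (f := Prod.fst) contDiffOn_fst fun p hp => hp.1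
  have hgu : ∀ p ∈ T ×ˢ X, (g p)ᴴ * g p = 1 := fun p hp => hg₀.unitary p.1 hp.1
  have hgd : ∀ p ∈ T ×ˢ X, (g p).det = 1 := fun p hp =>
    hg₀.det_eq_one hT hT'.isPreconnected hAtr hc hg1 hp.1
  have hgP : ∀ p ∈ T ×ˢ X, Commute (projMat ℂ n) (g p) := fun p hp =>
    hg₀.commute hT hT'.isPreconnected hAs hAP hc hg1 hp.1
  have hgx : ∀ p ∈ T ×ˢ X, matD (0, 1) g p = 0 := fun p hp => by
    rw [← mdx_eq_matD hgs hU hp]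
    ext i j
    simp [mdx, dx, hg]
  have hgt : ∀ p ∈ T ×ˢ X, matD (1, 0) g p = -Q p * g p := fun p hp => by
    rw [← mdt_eq_matD hgs hU hp, ← hAQ p hp]
    ext i j
    exact (hg₀.deriv p.1 hp.1 i j).deriv
  have hmc {ψ : ℝ × ℝ → Mat n} (hψ : SmoothOn ψ (T ×ˢ X)) (hψu : ∀ p ∈ T ×ˢ X, (ψ p)ᴴ * ψ p = 1)
      {p : ℝ × ℝ} (hp : p ∈ T ×ˢ X) (w : ℝ × ℝ) : maurerCartan (fun q => ψ q * g q) w p =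
        (g p)ᴴ * maurerCartan ψ w p * g p + (g p)ᴴ * matD w g p := by
    rw [maurerCartan, matD_mul hU hp hψ hgs, Matrix.conjTranspose_mul, mul_add, maurerCartan]
    congr 1
    · noncomm_ring
    · calc _ = (g p)ᴴ * ((ψ p)ᴴ * ψ p) * matD w g p := by noncomm_ring
        _ = _ := by rw [hψu p hp, mul_one]
  have hF {p : ℝ × ℝ} (hp : p ∈ T ×ˢ X) (w : ℝ × ℝ) :
      frameD (fun q => ψ q * g q) (fun q => φ q * g q) w p = (g p)ᴴ * frameD ψ φ w p * g p := by
    rw [frameD, hmc h.left h.unitary_left hp, hmc h.right h.unitary_right hp, frameD,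
      add_sub_add_right_eq_sub, mul_smul_comm, smul_mul_assoc, mul_sub, sub_mul]
  have hC {p : ℝ × ℝ} (hp : p ∈ T ×ˢ X) (w : ℝ × ℝ) :
      conD (fun q => ψ q * g q) (fun q => φ q * g q) w p =
        (g p)ᴴ * conD ψ φ w p * g p + (g p)ᴴ * matD w g p := by
    rw [conD, hmc h.left h.unitary_left hp, hmc h.right h.unitary_right hp, conD,
      mul_smul_comm, smul_mul_assoc, mul_add, add_mul]
    module
  have hsu {ψ : ℝ × ℝ → Mat n}
      (hψ : ∀ p ∈ T ×ˢ X, ψ p ∈ Matrix.specialUnitaryGroup (Unit ⊕ Fin n) ℂ) :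
      ∀ p ∈ T ×ˢ X, ψ p * g p ∈ Matrix.specialUnitaryGroup (Unit ⊕ Fin n) ℂ := fun p hp =>
    mul_mem (hψ p hp) (mem_specialUnitaryGroup_iff.2 ⟨hgu p hp, hgd p hp⟩)
  have hl : IsSmoothLift (fun q => ψ q * g q) (fun q => φ q * g q) (T ×ˢ X) := by
    refine ⟨hU, h.left.mul hgs, h.right.mul hgs, ?_, ?_, ?_, ?_⟩
    · exact fun p hp => (mem_specialUnitaryGroup_iff.1 (hsu hf.mem_left p hp)).1
    · exact fun p hp => (mem_specialUnitaryGroup_iff.1 (hsu hf.mem_right p hp)).1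
    · exact fun p hp => (mem_specialUnitaryGroup_iff.1 (hsu hf.mem_left p hp)).2
    · exact fun p hp => (mem_specialUnitaryGroup_iff.1 (hsu hf.mem_right p hp)).2
  have hgPs {p : ℝ × ℝ} (hp : p ∈ T ×ˢ X) : Commute (projMat ℂ n) (g p)ᴴ := by
    have h1 := congrArg Matrix.conjTranspose (hgP p hp).eq
    rw [Matrix.conjTranspose_mul, Matrix.conjTranspose_mul, projMat_conjTranspose] at h1
    exact h1.symm
  set v' : ℝ × ℝ → Fin n → ℂ := fun p j =>
    ((g p)ᴴ * connMatrix (v p) * g p) (Sum.inl ()) (Sum.inr j) with hv'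
  have hconn : ∀ p ∈ T ×ˢ X, connMatrix (v' p) = (g p)ᴴ * connMatrix (v p) * g p := fun p hp => by
    refine (eq_connMatrix ?_ ?_).symm
    · have h1 := isOffDiag_connMatrix (v p)
      unfold IsOffDiag at h1 ⊢
      conv_rhs => rw [← h1]
      calc _ = (projMat ℂ n * (g p)ᴴ) * connMatrix (v p) * g p +
            (g p)ᴴ * connMatrix (v p) * (g p * projMat ℂ n) := by noncomm_ring
        _ = _ := by rw [(hgPs hp).eq, ← (hgP p hp).eq]; noncomm_ring
    · simp only [Matrix.conjTranspose_mul, Matrix.conjTranspose_conjTranspose,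
        connMatrix_eq_offMat, offMat_conjTranspose]
      noncomm_ring
  refine ⟨fun q => ψ q * g q, fun q => φ q * g q, v', g, ⟨hl.left, hl.right, hsu hf.mem_left,
    hsu hf.mem_right, fun p hp => ?_, fun p hp => ?_, fun p hp => ?_⟩,
    ⟨hgu, fun _ _ => rfl, fun _ _ => rfl, hconn, fun p hp => ?_⟩⟩
  · rw [hf.lift p hp, Matrix.conjTranspose_mul]
    calc _ = ψ p * 1 * (φ p)ᴴ := by rw [mul_one]
      _ = _ := by rw [← mul_eq_one_comm.1 (hgu p hp)]; noncomm_ring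
  · rw [hl.frameX_eq hp, hF hp, hf.frameD_x hU hp, ← frameConst_eq_unitFrame, frameConst]
    have h1 : (g p)ᴴ * projMat ℂ n * g p = projMat ℂ n := by
      rw [mul_assoc, (hgP p hp).eq, ← mul_assoc, hgu p hp, one_mul]
    rw [mul_smul_comm, smul_mul_assoc, mul_sub, sub_mul, h1, mul_smul_comm, smul_mul_assoc,
      mul_one, hgu p hp]
  · rw [hl.conX_eq hp, hC hp, hf.conD_x hU hp, hgx p hp, mul_zero, add_zero, hconn p hp]
  · rw [hl.conT_eq hp, hC hp, hgt p hp, h.conT_eq hp]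
    noncomm_ring

/-- Both frames describe the same vectors ∇_xʲγ_x, so their frame matrices are conjugate by g, and
so are polynomials in them. -/
lemma IsGauge.evalMat_lift {U : Set (ℝ × ℝ)} {Q g ψ' φ' : ℝ × ℝ → Mat n} {v' : ℝ × ℝ → Fin n → ℂ}
    (hg : IsGauge Q ψ φ v ψ' φ' v' g U) (hU : IsOpen U) (hf : IsParallelFrame γ ψ φ v U)
    (hf' : IsParallelFrame γ ψ' φ' v' U) (hp : p ∈ U) (f : FreeAlgebra ℂ ℕ) :
    evalMat v' p (FreeAlgebra.lift ℂ (jetNormal n) f) =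
      (g p)ᴴ * evalMat v p (FreeAlgebra.lift ℂ (jetNormal n) f) * g p := by
  have h (j : ℕ) : evalMat v' p (jetNormal n j) =
      (g p)ᴴ * evalMat v p (jetNormal n j) * (g p)ᴴᴴ := by
    have h1 := hf.iterate_covX hU j hp
    rw [hf'.iterate_covX hU j hp] at h1
    have h2 : frameVec ψ φ (fun q => evalMat v q (jetNormal n j)) p =
        frameVec ψ' φ' (fun q => (g q)ᴴ * evalMat v q (jetNormal n j) * g q) p := by
      rw [frameVec, frameVec, hg.left p hp, hg.right p hp, Matrix.conjTranspose_mul]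
      congr 1
      calc _ = ψ p * 1 * evalMat v p (jetNormal n j) * 1 * (φ p)ᴴ := by rw [mul_one, mul_one]
        _ = _ := by rw [← mul_eq_one_comm.1 (hg.unitary p hp)]; noncomm_ring
    rw [h2, frameVec_inj (hf'.isSmoothLift hU) hp] at h1
    rw [Matrix.conjTranspose_conjTranspose]
    exact h1
  have key (v : ℝ × ℝ → Fin n → ℂ) : evalMat v p (FreeAlgebra.lift ℂ (jetNormal n) f) =
      FreeAlgebra.lift ℂ (fun j => evalMat v p (jetNormal n j)) f := by
    have : FreeAlgebra.lift ℂ (fun j => evalMat v p (jetNormal n j)) =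
        (evalMat v p).comp (FreeAlgebra.lift ℂ (jetNormal n)) := by
      ext j; simp
    rw [this]; rfl
  rw [key, key, funext h, lift_conj (by
    rw [Matrix.conjTranspose_conjTranspose]; exact mul_eq_one_comm.1 (hg.unitary p hp)),
    Matrix.conjTranspose_conjTranspose]

end Gauge

/-! ### Evolution of the connection in a suitable parallel frame -/

section Evolution

variable {n : ℕ} {T X : Set ℝ} {U : Set (ℝ × ℝ)} {p w u : ℝ × ℝ} {γ ψ φ : ℝ × ℝ → Mat n}
  {v : ℝ × ℝ → Fin n → ℂ}

lemma evalMat_conjTranspose (M : JetMat n) : evalMat v p Mᴴ = (evalMat v p M)ᴴ := by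
  ext i j
  exact evalJet_star _

lemma commute_matD (hU : IsOpen U) (hp : p ∈ U) {F : ℝ × ℝ → Mat n} (hF : SmoothOn F U)
    (h : ∀ q ∈ U, Commute (projMat ℂ n) (F q)) : Commute (projMat ℂ n) (matD w F p) := by
  have h1 := matD_congr (w := w) hU hp (F := fun q => projMat ℂ n * F q)
    (G := fun q => F q * projMat ℂ n) fun q hq => (h q hq).eq
  rw [matD_mul hU hp (SmoothOn.const _) hF, matD_mul hU hp hF (SmoothOn.const _), matD_const,
    zero_mul, zero_add, mul_zero, add_zero] at h1
  exact h1

lemma isOffDiag_matD (hU : IsOpen U) (hp : p ∈ U) {F : ℝ × ℝ → Mat n} (hF : SmoothOn F U)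
    (h : ∀ q ∈ U, IsOffDiag (F q)) : IsOffDiag (matD w F p) := by
  have h1 := matD_congr (w := w) hU hp (F := fun q => projMat ℂ n * F q + F q * projMat ℂ n)
    (G := F) fun q hq => h q hq
  rw [matD_add hU hp ((SmoothOn.const _).mul hF) (hF.mul (SmoothOn.const _)),
    matD_mul hU hp (SmoothOn.const _) hF, matD_mul hU hp hF (SmoothOn.const _), matD_const,
    zero_mul, zero_add, mul_zero, add_zero] at h1
  exact h1

namespace IsParallelFrame

variable (hf : IsParallelFrame γ ψ φ v U) (hU : IsOpen U)
include hf hU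

lemma smoothOn_connMatrix : SmoothOn (fun q => connMatrix (v q)) U :=
  ((hf.isSmoothLift hU).smoothOn_conD (0, 1)).congr fun _ hq => (hf.conD_x hU hq).symm

lemma smoothOn_frameT : SmoothOn (frameT ψ φ) U :=
  ((hf.isSmoothLift hU).smoothOn_frameD (1, 0)).congr fun _ hq =>
    (hf.isSmoothLift hU).frameT_eq hq

lemma smoothOn_conT : SmoothOn (conT ψ φ) U :=
  ((hf.isSmoothLift hU).smoothOn_conD (1, 0)).congr fun _ hq =>
    (hf.isSmoothLift hU).conT_eq hq

/-- The torsion equation. -/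
lemma matD_frameT (hp : p ∈ U) : matD (0, 1) (frameT ψ φ) p + ⁅connMatrix (v p), frameT ψ φ p⁆ =
    -⁅unitFrame n, conT ψ φ p⁆ := by
  have h := hf.isSmoothLift hU
  have h1 := h.matD_frameD_sub hp (1, 0) (0, 1)
  rw [matD_congr hU hp (F := frameD ψ φ (0, 1)) (G := fun _ => unitFrame n)
    (fun q hq => hf.frameD_x hU hq), matD_const, sub_zero, hf.frameD_x hU hp, hf.conD_x hU hp,
    ← matD_congr hU hp (F := frameT ψ φ) (fun q hq => h.frameT_eq hq), ← h.frameT_eq hp,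
    ← h.conT_eq hp] at h1
  rw [h1]
  simp only [Ring.lie_def]
  abel

/-- The curvature equation. -/
lemma matD_conT (hp : p ∈ U) : matD (0, 1) (conT ψ φ) p + ⁅connMatrix (v p), conT ψ φ p⁆ =
    matD (1, 0) (fun q => connMatrix (v q)) p - ⁅unitFrame n, frameT ψ φ p⁆ := by
  have h := hf.isSmoothLift hU
  have h1 := h.matD_conD_sub hp (1, 0) (0, 1)
  rw [matD_congr hU hp (F := conD ψ φ (0, 1)) (G := fun q => connMatrix (v q))
    (fun q hq => hf.conD_x hU hq), hf.frameD_x hU hp, hf.conD_x hU hp,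
    ← matD_congr hU hp (F := conT ψ φ) (fun q hq => h.conT_eq hq), ← h.frameT_eq hp,
    ← h.conT_eq hp] at h1
  rw [sub_eq_iff_eq_add] at h1
  rw [h1]
  simp only [Ring.lie_def]
  abel

lemma conT_conjTranspose (hp : p ∈ U) : (conT ψ φ p)ᴴ = -conT ψ φ p := by
  rw [(hf.isSmoothLift hU).conT_eq hp, (hf.isSmoothLift hU).conD_conjTranspose hp]

lemma conT_trace (hp : p ∈ U) : (conT ψ φ p).trace = 0 := by
  rw [(hf.isSmoothLift hU).conT_eq hp, (hf.isSmoothLift hU).conD_trace hp]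

lemma frameT_conjTranspose (hp : p ∈ U) : (frameT ψ φ p)ᴴ = -frameT ψ φ p := by
  rw [(hf.isSmoothLift hU).frameT_eq hp, (hf.isSmoothLift hU).frameD_conjTranspose hp]

lemma frameT_trace (hp : p ∈ U) : (frameT ψ φ p).trace = 0 := by
  rw [(hf.isSmoothLift hU).frameT_eq hp, (hf.isSmoothLift hU).frameD_trace hp]

end IsParallelFrame

/-- If the block off-diagonal part of `ω_t` is the value of `-N`, then in a suitable parallel frame
`ω_t` equals the value of `-N` up to a multiple of the identity. -/
theorem exists_adapted_frame (hn : 1 ≤ n) (hT : IsOpen T) (hT' : T.OrdConnected) (hX : IsOpen X)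
    (hX' : X.OrdConnected) (hf : IsParallelFrame γ ψ φ v (T ×ˢ X)) (N : JetMat n)
    (hcov : ∀ Q ψ' φ' v' g, IsParallelFrame γ ψ' φ' v' (T ×ˢ X) →
      IsGauge Q ψ φ v ψ' φ' v' g (T ×ˢ X) →
      ∀ p ∈ T ×ˢ X, evalMat v' p N = (g p)ᴴ * evalMat v p N * g p)
    (hs : Nᴴ = -N) (hoff : ∀ v p, IsOffDiag (evalMat v p (jetCov n N)))
    (hcomm : ∀ p ∈ T ×ˢ X, ⁅unitFrame n, conT ψ φ p + evalMat v p N⁆ = 0) :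
    ∃ ψ' φ' v', IsParallelFrame γ ψ' φ' v' (T ×ˢ X) ∧
      (∀ p ∈ T ×ˢ X, ∃ τ : ℂ, conT ψ' φ' p + evalMat v' p N = τ • 1) ∧
      ∀ p ∈ T ×ˢ X, matD (1, 0) (fun q => connMatrix (v' q)) p =
        ⁅unitFrame n, frameT ψ' φ' p⁆ - evalMat v' p (jetCov n N) := by
  have hU := hT.prod hX
  have h := hf.isSmoothLift hU
  set R : ℝ × ℝ → Mat n := fun q => conT ψ φ q + evalMat v q N with hR
  have hRs : SmoothOn R (T ×ˢ X) := (hf.smoothOn_conT hU).add (hf.smoothOn_eval hU N)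
  have hRP : ∀ p ∈ T ×ˢ X, Commute (projMat ℂ n) (R p) := fun p hp =>
    commute_projMat_of_lie hn (hcomm p hp)
  -- R commutes with p, hence so does its x-derivative. The curvature equation makes the same
  -- derivative off-diagonal, so it is zero.
  have hRx : ∀ p ∈ T ×ˢ X, matD (0, 1) R p = 0 := fun p hp => by
    have h1 : matD (0, 1) R p = matD (1, 0) (fun q => connMatrix (v q)) p -
        ⁅unitFrame n, frameT ψ φ p⁆ + evalMat v p (jetCov n N) - ⁅connMatrix (v p), R p⁆ := by
      rw [← hf.matD_conT hU hp, ← hf.matD_eval hU hp, hR,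
        matD_add hU hp (hf.smoothOn_conT hU) (hf.smoothOn_eval hU N)]
      simp only [Ring.lie_def, mul_add, add_mul]
      abel
    refine IsOffDiag.eq_zero ?_ (commute_matD hU hp hRs hRP)
    rw [h1]
    exact (((isOffDiag_matD hU hp (hf.smoothOn_connMatrix hU) fun q _ =>
      isOffDiag_connMatrix (v q)).sub (isOffDiag_lie_unitFrame _)).add (hoff v p)).sub
      ((isOffDiag_connMatrix _).lie_right (hRP p hp))
  have hRskew : ∀ p ∈ T ×ˢ X, (R p)ᴴ = -R p := fun p hp => by
    simp only [hR, Matrix.conjTranspose_add, hf.conT_conjTranspose hU hp,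
      ← evalMat_conjTranspose, hs, map_neg]
    abel
  -- The gauge must stay in SU(N), so only the traceless part of R can be removed. The scalar rest τ
  -- is harmless, as it commutes with everything.
  set τ : ℝ × ℝ → ℂ := fun q => (1 / (n + 1) : ℂ) * (R q).trace with hτ
  have hτs : ContDiffOn ℝ ∞ τ (T ×ˢ X) := contDiffOn_const.mul (contDiffOn_trace hRs)
  have hτx : ∀ p ∈ T ×ˢ X, fderiv ℝ τ p (0, 1) = 0 := fun p hp => by
    rw [hτ, fderiv_const_mul (differentiableAt_of_smooth (contDiffOn_trace hRs) hU hp),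
      smul_apply, fderiv_trace hU hp hRs, hRx p hp, Matrix.trace_zero, smul_zero]
  have hτskew : ∀ p ∈ T ×ˢ X, star (τ p) = -τ p := fun p hp => by
    simp only [hτ, star_mul', ← Matrix.trace_conjTranspose, hRskew p hp, Matrix.trace_neg]
    simp
  have hQs : SmoothOn (fun q => R q - τ q • (1 : Mat n)) (T ×ˢ X) :=
    hRs.sub (SmoothOn.smul hτs (SmoothOn.const _))
  have hn1 : (n : ℂ) + 1 ≠ 0 := by exact_mod_cast Nat.succ_ne_zero n
  obtain ⟨ψ', φ', v', g, hf', hg⟩ := exists_gauge hT hT' hX hX' hf hQs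
    (fun p hp => by
      rw [Matrix.conjTranspose_sub, hRskew p hp, Matrix.conjTranspose_smul, hτskew p hp,
        Matrix.conjTranspose_one]
      module)
    (fun p hp => by
      simp only [Matrix.trace_sub, Matrix.trace_smul, Matrix.trace_one, hτ, smul_eq_mul]
      simp
      field_simp
      ring)
    (fun p hp => (hRP p hp).sub_right ((Commute.one_right _).smul_right _))
    (fun p hp => by
      rw [matD_sub hU hp hRs (SmoothOn.smul hτs (SmoothOn.const _)), hRx p hp,
        matD_smul hU hp hτs (SmoothOn.const _), matD_const, hτx p hp]
      simp)
  have hcon : ∀ p ∈ T ×ˢ X, conT ψ' φ' p + evalMat v' p N = τ p • 1 := fun p hp => by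
    rw [hg.conT p hp, hcov _ _ _ _ _ hf' hg p hp]
    calc _ = (g p)ᴴ * (conT ψ φ p + evalMat v p N - (R p - τ p • 1)) * g p := by noncomm_ring
      _ = τ p • ((g p)ᴴ * g p) := by
        simp only [hR, sub_sub_cancel, mul_smul_comm, smul_mul_assoc, mul_one]
      _ = _ := by rw [hg.unitary p hp]
  refine ⟨ψ', φ', v', hf', fun p hp => ⟨τ p, hcon p hp⟩, fun p hp => ?_⟩
  have h1 := hf'.matD_conT hU hp
  have hE : Set.EqOn (conT ψ' φ') (fun q => τ q • (1 : Mat n) - evalMat v' q N) (T ×ˢ X) :=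
    fun q hq => eq_sub_of_add_eq (hcon q hq)
  rw [matD_congr hU hp hE, matD_sub hU hp (SmoothOn.smul hτs (SmoothOn.const _))
    (hf'.smoothOn_eval hU N), matD_smul hU hp hτs (SmoothOn.const _), matD_const, hτx p hp,
    hE hp] at h1
  rw [← hf'.matD_eval hU hp, ← sub_eq_iff_eq_add'.2 (sub_eq_iff_eq_add.1 h1.symm)]
  simp only [Ring.lie_def, mul_sub, sub_mul, mul_smul_comm, smul_mul_assoc, mul_one, one_mul]
  module

lemma vdt_eq (hf : IsParallelFrame γ ψ φ v U) (hU : IsOpen U) (hp : p ∈ U) {M : Mat n}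
    (h : matD (1, 0) (fun q => connMatrix (v q)) p = M) :
    vdt v p = fun j => M (Sum.inl ()) (Sum.inr j) := by
  ext j
  rw [← h]
  exact dt_eq_fderiv (differentiableAt_of_smooth (hf.contDiffOn_conn hU j) hU hp)

/-- With e_t = e_x the torsion equation says that ω_t - W commutes with e_x, so the adapted frame is
taken with N = -W. The derivative DN = -W_x then gives v_t = v_x. -/
theorem IsParallelFrame.exists_zeroFlow_frame (hn : 1 ≤ n) (hT : IsOpen T) (hT' : T.OrdConnected)
    (hX : IsOpen X) (hX' : X.OrdConnected) (hf : IsParallelFrame γ ψ φ v (T ×ˢ X))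
    (h0 : ∀ p ∈ T ×ˢ X, mdt γ p = mdx γ p) :
    ∃ ψ' φ' v', IsParallelFrame γ ψ' φ' v' (T ×ˢ X) ∧ ∀ p ∈ T ×ˢ X, vdt v' p = vdx v' p := by
  have hU := hT.prod hX
  have hE {ψ φ v} (hf : IsParallelFrame γ ψ φ v (T ×ˢ X)) :
      ∀ p ∈ T ×ˢ X, frameT ψ φ p = unitFrame n := fun p hp => by
    rw [(hf.isZeroFlow_iff hU).2 h0 p hp, flowMatrix_eq_unitFrame]
  have hcov : jetCov n (-offMat (jv n)) = -offMat fun j => totalD n (jv n j) := by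
    rw [jetCov_apply, map_neg, matDeriv_offMat totalD_star, Ring.lie_def]
    noncomm_ring
  have heval (v : ℝ × ℝ → Fin n → ℂ) (p : ℝ × ℝ) :
      evalMat v p (offMat fun j => totalD n (jv n j)) =
        connMatrix fun j => evalJet v p (totalD n (jv n j)) := by
    rw [offMat_eq_blockMat, evalMat_blockMat, connMatrix_eq_offMat, offMat_eq_blockMat]
    rw [map_zero, Matrix.map_zero _ (map_zero _)]
  obtain ⟨ψ', φ', v', hf', -, h1⟩ := exists_adapted_frame hn hT hT' hX hX' hf (-offMat (jv n))
    (fun Q ψ' φ' v' g hf' hg p hp => by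
      rw [map_neg, map_neg, evalMat_offMat, evalMat_offMat, hg.conn p hp]; noncomm_ring)
    (by rw [Matrix.conjTranspose_neg, offMat_conjTranspose])
    (fun v p => by
      rw [hcov, map_neg, heval]
      exact (isOffDiag_connMatrix _).neg)
    (fun p hp => by
      have h2 := hf.matD_frameT hU hp
      rw [matD_congr hU hp (hE hf), matD_const, hE hf p hp] at h2
      rw [map_neg, evalMat_offMat]
      simp only [Ring.lie_def] at h2 ⊢
      rw [mul_add, add_mul, mul_neg, neg_mul]
      rw [zero_add, eq_neg_iff_add_eq_zero] at h2
      rw [← h2]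
      abel)
  refine ⟨ψ', φ', v', hf', fun p hp => ?_⟩
  rw [vdt_eq hf' hU hp (h1 p hp), hE hf' p hp, hcov, map_neg, heval, Ring.lie_def]
  ext j
  simp only [connMatrix, sub_self, zero_sub, neg_neg, Matrix.fromBlocks_apply₁₂,
    Matrix.replicateRow_apply, jv, totalD_X_inl, evalJet, MvPolynomial.aeval_X, Sum.elim_inl]
  rfl

lemma jetCov_smul_blockMat (k : ℕ) :
    jetCov n ((kappa n : ℂ) • blockMat (jetH n k) (jetS n k) (jetT n k)) =
      (kappa n : ℂ) • ⁅projMat (DiffPoly n) n, jetProj n (k + 2)⁆ := by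
  rw [blockMat_jet, map_smul, map_smul, jetCov_jetProj, smul_neg, smul_smul, Complex.I_mul_I,
    neg_one_smul, neg_neg]

lemma evalMat_lie_projMat (M : JetMat n) :
    evalMat v p ⁅projMat (DiffPoly n) n, M⁆ = ⁅projMat ℂ n, evalMat v p M⁆ := by
  rw [Ring.lie_def, Ring.lie_def, map_sub, map_mul, map_mul, evalMat_projMat]

/-- Put Bₖ = iΠₖ₊₁, so e_t = κBₖ. The torsion equation gives [e_x, ω_t] = -κ[p, Πₖ₊₂] = -[e_x,
Bₖ₊₁], so the adapted frame is taken with N = Bₖ₊₁. The curvature equation becomes W_t = χ[p, Πₖ₊₁]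
- [p, Πₖ₊₃], whose first row is i(h⁽ᵏ⁺²⁾ - χh⁽ᵏ⁾). -/
theorem IsParallelFrame.exists_flow_frame (hn : 1 ≤ n) (hT : IsOpen T) (hT' : T.OrdConnected)
    (hX : IsOpen X) (hX' : X.OrdConnected) (hf : IsParallelFrame γ ψ φ v (T ×ˢ X)) {k : ℕ}
    (hk : IsFlow (jetHierarchy n) k ψ φ v (T ×ˢ X)) :
    ∃ ψ' φ' v', IsParallelFrame γ ψ' φ' v' (T ×ˢ X) ∧
      IsFlow (jetHierarchy n) k ψ' φ' v' (T ×ˢ X) ∧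
      ∀ p ∈ T ×ˢ X, vdt v' p = fun j => evalJet v' p ((jetHierarchy n).flow k j) := by
  have hU := hT.prod hX
  have hκ := kappa_ne_zero hn
  obtain ⟨f, -, -, hfk⟩ := exists_geometric hn
  have hN : blockMat (jetH n (k + 1)) (jetS n (k + 1)) (jetT n (k + 1)) =
      (kappa n : ℂ)⁻¹ • FreeAlgebra.lift ℂ (jetNormal n) (f (k + 1)) := by
    rw [hfk, smul_smul, inv_mul_cancel₀ hκ, one_smul]
  have hcovN : jetCov n (blockMat (jetH n (k + 1)) (jetS n (k + 1)) (jetT n (k + 1))) =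
      ⁅projMat (DiffPoly n) n, jetProj n (k + 3)⁆ := by
    have h1 := jetCov_smul_blockMat (n := n) (k + 1)
    rw [map_smul] at h1
    exact smul_right_injective _ hκ h1
  obtain ⟨ψ', φ', v', hf', -, h1⟩ := exists_adapted_frame hn hT hT' hX hX' hf
    (blockMat (jetH n (k + 1)) (jetS n (k + 1)) (jetT n (k + 1)))
    (fun Q ψ' φ' v' g hf' hg p hp => by
      rw [hN, map_smul, map_smul, hg.evalMat_lift hU hf hf' hp, mul_smul_comm, smul_mul_assoc])
    (by rw [blockMat_jet, Matrix.conjTranspose_smul, jetProj_conjTranspose]; simp)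
    (fun v p => by
      rw [hcovN, evalMat_lie_projMat]
      exact isOffDiag_lie_projMat _)
    (fun p hp => by
      have h2 := hf.matD_frameT hU hp
      have h3 := (hf.isFlow_iff_frameT hU k).1 hk
      rw [matD_congr hU hp h3, h3 p hp, hf.matD_eval hU hp, jetCov_smul_blockMat, map_smul,
        evalMat_lie_projMat] at h2
      have h4 : ⁅unitFrame n, conT ψ φ p +
          evalMat v p (blockMat (jetH n (k + 1)) (jetS n (k + 1)) (jetT n (k + 1)))⁆ =
          ⁅unitFrame n, conT ψ φ p⁆ + ⁅unitFrame n,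
            evalMat v p (blockMat (jetH n (k + 1)) (jetS n (k + 1)) (jetT n (k + 1)))⁆ := by
        rw [brk_add]
      rw [h4, eq_neg_of_add_eq_zero_right (by rw [h2]; exact neg_add_cancel _ :
        (kappa n : ℂ) • ⁅projMat ℂ n, evalMat v p (jetProj n (k + 2))⁆ +
          ⁅unitFrame n, conT ψ φ p⁆ = 0), blockMat_jet, map_smul, unitFrame_lie, brk_smul,
        smul_smul, show -(Complex.I * (kappa n : ℂ)) * Complex.I = kappa n by
          linear_combination (-(kappa n : ℂ)) * Complex.I_mul_I]
      exact neg_add_cancel _)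
  have hk' : IsFlow (jetHierarchy n) k ψ' φ' v' (T ×ˢ X) :=
    (hf'.isFlow_iff_isGeometricMap hU (hfk k)).2 ((hf.isFlow_iff_isGeometricMap hU (hfk k)).1 hk)
  refine ⟨ψ', φ', v', hf', hk', fun p hp => ?_⟩
  rw [vdt_eq hf' hU hp (h1 p hp), (hf'.isFlow_iff_frameT hU k).1 hk' p hp, hcovN,
    evalMat_lie_projMat, unitFrame_lie, map_smul, brk_smul, smul_smul]
  ext j
  rw [Matrix.sub_apply, Matrix.smul_apply, (lie_projMat_apply _).2.1, (lie_projMat_apply _).2.1,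
    blockMat_jet, map_smul, Matrix.smul_apply]
  simp only [Hierarchy.flow, jetHierarchy, Pi.smul_apply, Pi.sub_apply, map_smul, map_sub,
    jetH, smul_eq_mul, ← kappa_sq hn, evalMat, AlgHom.mapMatrix_apply, Matrix.map_apply]
  linear_combination (-(evalJet v' p (jetProj n (k + 3) (Sum.inl ()) (Sum.inr j)))) *
    Complex.I_mul_I
end Evolution

/-! ### The first members of the hierarchy -/

section FirstFlows

variable {n : ℕ}

/-- The jet coordinates `v_x`. -/
def jvx (n : ℕ) : Fin n → DiffPoly n := fun j => totalD n (jv n j)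

lemma jetCov_projMat : jetCov n (projMat (DiffPoly n) n) =
    ⁅offMat (jv n), projMat (DiffPoly n) n⁆ := by
  rw [jetCov_apply]
  have : matDeriv _ (totalD n) (projMat (DiffPoly n) n) = 0 := by
    ext1 (i | i) (j | j) <;> simp [matDeriv_apply, projMat]
  rw [this, zero_add]

lemma jetProj_one : jetProj n 1 = -(Complex.I • offMat (jv n)) := by
  rw [jetProj, projSeq_one, jetCov_projMat, ← smul_neg]
  congr 1
  simp only [Ring.lie_def, offMat, projMat, Matrix.fromBlocks_multiply]
  ext1 (i | i) (j | j) <;> simp [Matrix.fromBlocks_multiply, mul_sub, sub_mul]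

lemma jetProj_eq_blockMat (k : ℕ) : jetProj n (k + 1) =
    -(Complex.I • blockMat (jetH n k) (jetS n k) (jetT n k)) := by
  rw [blockMat_jet, smul_smul, Complex.I_mul_I, neg_one_smul, neg_neg]

lemma one_sub_projMat_mul (M : JetMat n) :
    (∀ i j, ((1 - 2 * projMat (DiffPoly n) n) * M : JetMat n) (Sum.inl i) (Sum.inl j) =
      -M (Sum.inl i) (Sum.inl j)) ∧
    ∀ i j, ((1 - 2 * projMat (DiffPoly n) n) * M : JetMat n) (Sum.inr i) (Sum.inr j) =
      M (Sum.inr i) (Sum.inr j) := by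
  have h : (1 - 2 * projMat (DiffPoly n) n) * M =
      M - (projMat (DiffPoly n) n * M + projMat (DiffPoly n) n * M) := by noncomm_ring
  rw [h]
  refine ⟨fun i j => ?_, fun i j => ?_⟩ <;>
    simp [projMat, Matrix.mul_apply, Fintype.sum_sum_type]

/-- The commutator term of the series has no diagonal blocks, so s and S come from the quadratic sum
alone, without integration. -/
lemma jetS_succ (k : ℕ) : jetS n (k + 1) = -((1 / 2 : ℂ) •
    (∑ i ∈ Finset.range (k + 1), jetProj n (i + 1) * jetProj n (k + 1 - i))
      (Sum.inl ()) (Sum.inl ())) := by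
  rw [jetS, jetProj, projSeq_succ, Matrix.add_apply, Matrix.smul_apply, (lie_projMat_apply _).1,
    smul_zero, zero_add, (one_sub_projMat_mul _).1, smul_neg]

lemma jetT_succ (k : ℕ) (i j : Fin n) : jetT n (k + 1) i j =
    -(∑ i ∈ Finset.range (k + 1), jetProj n (i + 1) * jetProj n (k + 1 - i))
      (Sum.inr i) (Sum.inr j) := by
  rw [jetT, Matrix.of_apply, jetProj, projSeq_succ, Matrix.add_apply, Matrix.smul_apply,
    (lie_projMat_apply _).2.2.2, smul_zero, zero_add, (one_sub_projMat_mul _).2]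

lemma jetH_succ (k : ℕ) (j : Fin n) : jetH n (k + 1) j =
    Complex.I • totalD n (jetH n k j) + (2 : ℂ) • (jetS n k * jv n j) +
      ∑ i, jv n i * jetT n k i j := by
  have h := congrFun ((jetHierarchy n).h_succ k) j
  change Complex.I • jetH n (k + 1) j = Complex.I • (totalD n (Complex.I • jetH n k j) +
    (2 : ℂ) • (jetS n k * jv n j) + ∑ i, jv n i * jetT n k i j) at h
  rw [Derivation.map_smul] at h
  exact smul_right_injective _ Complex.I_ne_zero h

lemma jetH_zero : jetH n 0 = jv n := (jetHierarchy n).h_zero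

lemma jetS_zero : jetS n 0 = 0 := by
  rw [jetS, jetProj_one]; simp [offMat]

lemma jetT_zero : jetT n 0 = 0 := by
  ext1 i j
  rw [jetT, Matrix.of_apply, jetProj_one]; simp [offMat]

lemma jetH_one (j : Fin n) : jetH n 1 j = Complex.I • jvx n j := by
  rw [jetH_succ, jetH_zero, jetS_zero, jetT_zero]
  simp [jvx]

lemma jetS_one : jetS n 1 = -((1 / 2 : ℂ) • dot (jv n) (star (jv n))) := by
  rw [jetS_succ, Finset.sum_range_one, jetProj_one]
  congr 2
  simp [offMat, Matrix.mul_apply, Fintype.sum_sum_type, smul_smul, dot]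

lemma jetT_one (i j : Fin n) : jetT n 1 i j = -(star (jv n i) * jv n j) := by
  rw [jetT_succ, Finset.sum_range_one, jetProj_one]
  congr 1
  simp [offMat, Matrix.mul_apply, Fintype.sum_sum_type, smul_smul]

lemma jetH_two (j : Fin n) : jetH n 2 j =
    -totalD n (jvx n j) - (2 : ℂ) • (dot (jv n) (star (jv n)) * jv n j) := by
  rw [jetH_succ, jetH_one, jetS_one]
  have h : ∑ i, jv n i * jetT n 1 i j = -(dot (jv n) (star (jv n)) * jv n j) := by
    rw [dot, Finset.sum_mul, ← Finset.sum_neg_distrib]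
    refine Finset.sum_congr rfl fun i _ => ?_
    rw [jetT_one, Pi.star_apply]; ring
  rw [h, Derivation.map_smul, smul_smul, Complex.I_mul_I, neg_mul, smul_mul_assoc]
  module

lemma jetProj_mul_sum : ∑ i ∈ Finset.range 2, jetProj n (i + 1) * jetProj n (2 - i) =
    -(offMat (jv n) * blockMat (jetH n 1) (jetS n 1) (jetT n 1) +
      blockMat (jetH n 1) (jetS n 1) (jetT n 1) * offMat (jv n)) := by
  rw [Finset.sum_range_succ, Finset.sum_range_one]
  change jetProj n 1 * jetProj n (1 + 1) + jetProj n (1 + 1) * jetProj n 1 = _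
  rw [jetProj_one, jetProj_eq_blockMat]
  simp only [neg_mul_neg, smul_mul_assoc, mul_smul_comm, smul_smul, Complex.I_mul_I, neg_one_smul]
  abel

lemma jetS_two : jetS n 2 = (Complex.I / 2) • (dot (jv n) (star (jvx n)) -
    dot (jvx n) (star (jv n))) := by
  rw [jetS_succ, jetProj_mul_sum]
  simp only [offMat, blockMat, Matrix.neg_apply, Matrix.add_apply, Matrix.mul_apply,
    Fintype.sum_sum_type, smul_neg, neg_neg, dot, Finset.smul_sum, ← Finset.sum_sub_distrib,
    ← Finset.sum_add_distrib, smul_add]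
  simp [jetH_one, Finset.sum_add_distrib, Finset.smul_sum, smul_smul, smul_sub,
    Finset.sum_sub_distrib]
  rw [sub_eq_add_neg, ← Finset.sum_neg_distrib, ← Finset.sum_neg_distrib,
    ← Finset.sum_add_distrib, ← Finset.sum_add_distrib]
  refine Finset.sum_congr rfl fun i _ => ?_
  module

lemma jetT_two (i j : Fin n) : jetT n 2 i j = Complex.I •
    (star (jvx n i) * jv n j - star (jv n i) * jvx n j) := by
  rw [jetT_succ, jetProj_mul_sum]
  simp [offMat, blockMat, Matrix.neg_apply, Matrix.add_apply, Matrix.mul_apply,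
    Fintype.sum_sum_type, jetH_one]
  module

lemma totalD_dot : totalD n (dot (jv n) (star (jv n))) =
    dot (jvx n) (star (jv n)) + dot (jv n) (star (jvx n)) := by
  simp only [dot, map_sum, Derivation.leibniz, Pi.star_apply, totalD_star, smul_eq_mul, jvx,
    ← Finset.sum_add_distrib]
  exact Finset.sum_congr rfl fun i _ => by ring

lemma jetH_three (j : Fin n) : jetH n 3 j = -(Complex.I • (totalD n (totalD n (jvx n j)) +
    (3 : ℂ) • (dot (jv n) (star (jv n)) * jvx n j) +
    (3 : ℂ) • (dot (jvx n) (star (jv n)) * jv n j))) := by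
  rw [jetH_succ, jetH_two, jetS_two]
  have h : ∑ i, jv n i * jetT n 2 i j = Complex.I • (dot (jv n) (star (jvx n)) * jv n j -
      dot (jv n) (star (jv n)) * jvx n j) := by
    rw [dot, dot, Finset.sum_mul, Finset.sum_mul, ← Finset.sum_sub_distrib, Finset.smul_sum]
    refine Finset.sum_congr rfl fun i _ => ?_
    rw [jetT_two, Pi.star_apply, Pi.star_apply, mul_smul_comm]
    congr 1; ring
  have hD : totalD n (jv n j) = jvx n j := rfl
  rw [h, map_sub, map_neg, Derivation.map_smul, Derivation.leibniz, totalD_dot, hD]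
  simp only [smul_eq_mul, smul_mul_assoc, sub_mul, mul_comm (jv n j), add_mul]
  module

variable {T X : Set ℝ} {U : Set (ℝ × ℝ)} {p : ℝ × ℝ} {γ ψ φ : ℝ × ℝ → Mat n}
  {v : ℝ × ℝ → Fin n → ℂ}

lemma evalJet_jv (j : Fin n) : evalJet v p (jv n j) = v p j := by
  simp [evalJet, jv]

lemma evalJet_jvx (j : Fin n) : evalJet v p (jvx n j) = vdx v p j := by
  rw [jvx, jv, totalD_X_inl]; simp [evalJet]; rfl

lemma evalJet_totalD_jvx (j : Fin n) : evalJet v p (totalD n (jvx n j)) = vdx (vdx v) p j := by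
  rw [jvx, jv, totalD_X_inl, totalD_X_inl]; simp [evalJet]; rfl

lemma evalJet_totalD_totalD_jvx (j : Fin n) :
    evalJet v p (totalD n (totalD n (jvx n j))) = vdx (vdx (vdx v)) p j := by
  rw [jvx, jv, totalD_X_inl, totalD_X_inl, totalD_X_inl]; simp [evalJet]; rfl

lemma evalJet_dot (a b : Fin n → DiffPoly n) : evalJet v p (dot a (star b)) =
    dot (fun j => evalJet v p (a j)) (star fun j => evalJet v p (b j)) := by
  simp only [dot, map_sum, map_mul, Pi.star_apply, evalJet_star]

theorem IsParallelFrame.exists_schrodinger_frame (hn : 1 ≤ n) (hT : IsOpen T) (hT' : T.OrdConnected)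
    (hX : IsOpen X) (hX' : X.OrdConnected) (hf : IsParallelFrame γ ψ φ v (T ×ˢ X))
    (h : IsSchrodingerMap γ (T ×ˢ X)) :
    ∃ ψ' φ' v', IsParallelFrame γ ψ' φ' v' (T ×ˢ X) ∧
      ∀ p ∈ T ×ˢ X, Complex.I • vdt v' p =
        vdx (vdx v') p + (2 * dot (v' p) (star (v' p))) • v' p + (chi n : ℂ) • v' p := by
  obtain ⟨ψ', φ', v', hf', -, hv⟩ := hf.exists_flow_frame hn hT hT' hX hX'
    ((hf.isFlow_iff_isSchrodingerMap (hT.prod hX) hn).2 h)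
  refine ⟨ψ', φ', v', hf', fun p hp => ?_⟩
  rw [hv p hp]
  ext j
  simp only [Hierarchy.flow, jetHierarchy, Pi.smul_apply, Pi.sub_apply, Pi.add_apply, jetH_zero,
    zero_add, jetH_two, map_smul, map_sub, map_neg, map_mul, evalJet_dot, evalJet_totalD_jvx,
    evalJet_jv, smul_eq_mul]
  linear_combination (-vdx (vdx v') p j - 2 * (dot (v' p) (star (v' p)) * v' p j) -
    chi n * v' p j) * Complex.I_mul_I

theorem IsParallelFrame.exists_mKdV_frame (hn : 1 ≤ n) (hT : IsOpen T) (hT' : T.OrdConnected)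
    (hX : IsOpen X) (hX' : X.OrdConnected) (hf : IsParallelFrame γ ψ φ v (T ×ˢ X))
    (h : IsMKdVMap γ (T ×ˢ X)) :
    ∃ ψ' φ' v', IsParallelFrame γ ψ' φ' v' (T ×ˢ X) ∧
      ∀ p ∈ T ×ˢ X, vdt v' p =
        vdx (vdx (vdx v')) p + (3 * dot (v' p) (star (v' p))) • vdx v' p +
          (3 * dot (vdx v' p) (star (v' p))) • v' p + (chi n : ℂ) • vdx v' p := by
  obtain ⟨ψ', φ', v', hf', -, hv⟩ := hf.exists_flow_frame hn hT hT' hX hX'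
    ((hf.isFlow_iff_isMKdVMap (hT.prod hX) hn).2 h)
  refine ⟨ψ', φ', v', hf', fun p hp => ?_⟩
  rw [hv p hp]
  ext j
  simp only [Hierarchy.flow, jetHierarchy, Pi.smul_apply, Pi.sub_apply, Pi.add_apply, jetH_one,
    Nat.reduceAdd, jetH_three, map_smul, map_sub, map_neg, map_add, map_mul, evalJet_dot,
    evalJet_totalD_totalD_jvx, evalJet_jvx, evalJet_jv, smul_eq_mul]
  linear_combination (-vdx (vdx (vdx v')) p j - 3 * (dot (v' p) (star (v' p)) * vdx v' p j) -
    3 * (dot (vdx v' p) (star (v' p)) * v' p j) - chi n * vdx v' p j) * Complex.I_mul_I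

end FirstFlows

/-! ### The `-1` flow and chiral wave maps -/

section WaveMaps

variable {n : ℕ} {T X : Set ℝ} {U : Set (ℝ × ℝ)} {p : ℝ × ℝ} {γ ψ φ : ℝ × ℝ → Mat n}
  {v : ℝ × ℝ → Fin n → ℂ}

lemma skew_eq_blockMat {M : Mat n} (hM : Mᴴ = -M) :
    M = blockMat (fun j => M (Sum.inl ()) (Sum.inr j))
        ((2 * Complex.I)⁻¹ * M (Sum.inl ()) (Sum.inl ())) (Complex.I • M.toBlocks₂₂) := by
  ext (i | i) (j | j)
  · simp only [blockMat, Matrix.fromBlocks_apply₁₁, Matrix.of_apply, smul_eq_mul]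
    rw [mul_inv_cancel_left₀ (by simp)]
  · rfl
  · have h := congrFun (congrFun hM (Sum.inr i)) (Sum.inl j)
    simp only [Matrix.conjTranspose_apply, Matrix.neg_apply] at h
    simp only [blockMat, Matrix.fromBlocks_apply₂₁, Matrix.neg_apply,
      Matrix.conjTranspose_apply, Matrix.replicateRow_apply]
    change _ = - star (M (Sum.inl j) (Sum.inr i))
    rw [h, neg_neg]
  · simp only [blockMat, Matrix.fromBlocks_apply₂₂, smul_smul, Complex.I_mul_I, neg_one_smul,
      neg_neg]
    rfl

lemma blockMat_skew {b : Fin n → ℂ} {s : ℂ} {S : Matrix (Fin n) (Fin n) ℂ}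
    (h : (blockMat b s S)ᴴ = -blockMat b s S) : star s = s ∧ Sᴴ = S := by
  constructor
  · have h1 := congrFun (congrFun h (Sum.inl ())) (Sum.inl ())
    simp only [blockMat, Matrix.conjTranspose_apply, Matrix.neg_apply,
      Matrix.fromBlocks_apply₁₁, Matrix.of_apply, smul_eq_mul, star_mul'] at h1
    simp only [Complex.star_def, map_ofNat, Complex.conj_I] at h1 ⊢
    have h2 : (2 * Complex.I) * ((starRingEnd ℂ) s) = (2 * Complex.I) * s := by
      linear_combination -h1
    exact mul_left_cancel₀ (by simp) h2
  · ext i j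
    have h1 := congrFun (congrFun h (Sum.inr i)) (Sum.inr j)
    simp only [blockMat, Matrix.conjTranspose_apply, Matrix.neg_apply,
      Matrix.fromBlocks_apply₂₂, Matrix.smul_apply, smul_eq_mul, star_mul', star_neg] at h1
    simp only [Complex.star_def, Complex.conj_I] at h1
    rw [Matrix.conjTranspose_apply, Complex.star_def]
    have h2 : Complex.I * ((starRingEnd ℂ) (S j i)) = Complex.I * S i j := by
      linear_combination h1
    exact mul_left_cancel₀ Complex.I_ne_zero h2

lemma matD_blockMat (hU : IsOpen U) (hp : p ∈ U) {b : ℝ × ℝ → Fin n → ℂ} {s : ℝ × ℝ → ℂ}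
    {S : ℝ × ℝ → Matrix (Fin n) (Fin n) ℂ} (hb : ∀ j, ContDiffOn ℝ ∞ (fun q => b q j) U)
    (hs : ContDiffOn ℝ ∞ s U) (hS : SmoothOn S U) :
    matD (0, 1) (fun q => blockMat (b q) (s q) (S q)) p =
      blockMat (vdx b p) (dx s p) (Matrix.of fun i j => dx (fun q => S q i j) p) := by
  have db (j : Fin n) := differentiableAt_of_smooth (hb j) hU hp
  have ds := differentiableAt_of_smooth hs hU hp
  have dS (i j : Fin n) := differentiableAt_of_smooth (hS i j) hU hp
  ext (i | i) (j | j)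
  · simp only [matD, blockMat, Matrix.fromBlocks_apply₁₁, Matrix.of_apply, smul_eq_mul]
    rw [fderiv_const_mul ds, dx_eq_fderiv ds]; rfl
  · exact (dx_eq_fderiv (db j)).symm
  · simp only [matD, blockMat, Matrix.fromBlocks_apply₂₁, Matrix.of_apply, Matrix.neg_apply,
      Matrix.conjTranspose_apply, Matrix.replicateRow_apply, vdx]
    rw [fderiv_fun_neg, neg_apply, fderiv_star_apply, dx_eq_fderiv (db i)]
  · simp only [matD, blockMat, Matrix.fromBlocks_apply₂₂, Matrix.of_apply, Matrix.neg_apply,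
      Matrix.smul_apply, smul_eq_mul]
    rw [fderiv_fun_neg, neg_apply, fderiv_const_mul (dS i j), dx_eq_fderiv (dS i j)]; rfl

namespace IsParallelFrame

variable (hf : IsParallelFrame γ ψ φ v U) (hU : IsOpen U)
include hf hU

/-- The three arguments of the block matrix are the left sides of the -1 flow equations, so these
equations together say that e_t is covariantly constant along x. -/
lemma covD_frameT (hn : 1 ≤ n) (hp : p ∈ U) {b : ℝ × ℝ → Fin n → ℂ} {s : ℝ × ℝ → ℂ}
    {S : ℝ × ℝ → Matrix (Fin n) (Fin n) ℂ} (hb : ∀ j, ContDiffOn ℝ ∞ (fun q => b q j) U)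
    (hs : ContDiffOn ℝ ∞ s U) (hS : SmoothOn S U)
    (he : ∀ q ∈ U, frameT ψ φ q = (kappa n : ℂ) • blockMat (b q) (s q) (S q)) :
    matD (0, 1) (frameT ψ φ) p + ⁅connMatrix (v p), frameT ψ φ p⁆ =
      (kappa n : ℂ) • blockMat (-recValue (v p) (Complex.I • vdx b p) (s p) (S p))
        (dx s p - hdot star (star (v p)) (Complex.I • b p))
        ((Matrix.of fun i j => dx (fun q => S q i j) p) -
          hsym star (star (v p)) (Complex.I • b p)) := by
  have hk := kappa_ne_zero hn
  have hsm : SmoothOn (fun q => blockMat (b q) (s q) (S q)) U :=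
    ((hf.smoothOn_frameT hU).const_smul (kappa n : ℂ)⁻¹).congr fun q hq => by
      change _ = (kappa n : ℂ)⁻¹ • frameT ψ φ q
      rw [he q hq, smul_smul, inv_mul_cancel₀ hk, one_smul]
  have hsk : (blockMat (b p) (s p) (S p))ᴴ = -blockMat (b p) (s p) (S p) := by
    have h := hf.frameT_conjTranspose hU hp
    rw [he p hp, Matrix.conjTranspose_smul, Complex.star_def, Complex.conj_ofReal, ← smul_neg] at h
    exact smul_right_injective _ hk h
  obtain ⟨h1, h2⟩ := blockMat_skew hsk
  rw [matD_congr hU hp he, matD_const_smul hU hp _ hsm, he p hp, matD_blockMat hU hp hb hs hS,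
    brk_smul, ← smul_add, connMatrix_eq_offMat, blockMat_add_lie _ _ _ _ _ _ _ h1 h2]

/-- Since e_x is constant, the frame matrix of ∇_tγ_x is just [ω_t, e_x]. -/
lemma isWaveMap_iff : IsWaveMap γ U ↔ ∀ p ∈ U, ⁅unitFrame n, conT ψ φ p⁆ = 0 := by
  have h := hf.isSmoothLift hU
  refine forall₂_congr fun p hp => ?_
  have hx : Set.EqOn (mdx γ) (frameVec ψ φ fun _ => unitFrame n) U := fun q hq => by
    rw [hf.mdx_curve hU hq, frameVec_inj h hq, jetNormal_zero, evalMat_frameConst,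
      frameConst_eq_unitFrame]
  have hs : SmoothMat (mdx γ) U := (h.smoothOn_frameVec (SmoothOn.const _)).congr hx
  rw [covT_eq_covD hU (h.smoothOn_curve hf.lift) hs hp, covD, hx hp,
    matD_congr hU hp (F := fun q => (γ q)ᴴ * mdx γ q)
      (G := fun q => (γ q)ᴴ * frameVec ψ φ (fun _ => unitFrame n) q)
      (fun q hq => by simp only [hx hq]), ← covD,
    h.covD_frameVec hf.lift hp (SmoothOn.const _)]
  have h0 : (0 : Mat n) = frameVec ψ φ (fun _ => 0) p := by simp [frameVec]
  have key (M : ℝ × ℝ → Mat n) : frameVec ψ φ M p = 0 ↔ M p = 0 := by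
    have h1 := frameVec_inj h hp (y := M) (z := fun _ => 0)
    rwa [← h0] at h1
  rw [key, matD_const, zero_add, ← h.conT_eq hp, Ring.lie_def, Ring.lie_def,
    sub_eq_zero, sub_eq_zero, eq_comm]

lemma exists_blockMat (hn : 1 ≤ n) : ∃ (b : ℝ × ℝ → Fin n → ℂ) (s : ℝ × ℝ → ℂ)
    (S : ℝ × ℝ → Matrix (Fin n) (Fin n) ℂ), (∀ j, ContDiffOn ℝ ∞ (fun q => b q j) U) ∧
      ContDiffOn ℝ ∞ s U ∧ SmoothOn S U ∧
      ∀ q ∈ U, frameT ψ φ q = (kappa n : ℂ) • blockMat (b q) (s q) (S q) := by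
  have hk := kappa_ne_zero hn
  have hF := (hf.smoothOn_frameT hU).const_smul (kappa n : ℂ)⁻¹
  refine ⟨fun q j => ((kappa n : ℂ)⁻¹ • frameT ψ φ q) (Sum.inl ()) (Sum.inr j),
    fun q => (2 * Complex.I)⁻¹ * ((kappa n : ℂ)⁻¹ • frameT ψ φ q) (Sum.inl ()) (Sum.inl ()),
    fun q => Complex.I • ((kappa n : ℂ)⁻¹ • frameT ψ φ q).toBlocks₂₂, fun j => hF _ _,
    contDiffOn_const.mul (hF _ _), fun i j => contDiffOn_const.mul (hF (Sum.inr i) (Sum.inr j)),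
    fun q hq => ?_⟩
  rw [← skew_eq_blockMat, smul_smul, mul_inv_cancel₀ hk, one_smul]
  rw [Matrix.conjTranspose_smul, hf.frameT_conjTranspose hU hq, star_inv₀, Complex.star_def,
    Complex.conj_ofReal, smul_neg]

/-- The torsion equation identifies the covariant x-derivative of e_t with -[e_x, ω_t]; its
vanishing is the flow equation on one side and the wave map equation on the other. -/
theorem isMinusOneFlow_iff (hn : 1 ≤ n) : IsMinusOneFlow ψ φ v U ↔ IsWaveMap γ U := by
  have hk := kappa_ne_zero hn
  rw [hf.isWaveMap_iff hU]
  constructor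
  · rintro ⟨b, s, S, hb, hs, hS, h⟩ p hp
    have h1 := hf.covD_frameT hU hn hp hb hs hS fun q hq => by
      rw [(h q hq).1, flowMatrix_eq_blockMat]
    obtain ⟨-, h2, h3, h4⟩ := h p hp
    have h5 : (Matrix.of fun i j => dx (fun q => S q i j) p) =
        hsym star (star (v p)) (Complex.I • b p) := by
      ext i j; exact h3 i j
    rw [hf.matD_frameT hU hp, h2, h4, h5, sub_self, sub_self, neg_zero, ← offMat_eq_blockMat] at h1
    rw [← neg_eq_zero, h1]
    ext (i | i) (j | j) <;> simp [offMat]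
  · intro h
    obtain ⟨b, s, S, hb, hs, hS, he⟩ := hf.exists_blockMat hU hn
    refine ⟨b, s, S, hb, hs, hS, fun p hp => ?_⟩
    have h1 := hf.covD_frameT hU hn hp hb hs hS he
    rw [hf.matD_frameT hU hp, h p hp, neg_zero, eq_comm, smul_eq_zero_iff_right hk] at h1
    have h0 : (0 : Mat n) = blockMat 0 0 0 := by
      rw [← offMat_eq_blockMat]; ext (i | i) (j | j) <;> simp [offMat]
    rw [h0] at h1
    obtain ⟨h2, h3, h4⟩ := blockMat_inj h1
    exact ⟨by rw [he p hp, flowMatrix_eq_blockMat], sub_eq_zero.1 h3,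
      fun i j => congrFun (congrFun (sub_eq_zero.1 h4) i) j, neg_eq_zero.1 h2⟩

end IsParallelFrame

theorem IsParallelFrame.exists_wave_frame (hn : 1 ≤ n) (hT : IsOpen T) (hT' : T.OrdConnected)
    (hX : IsOpen X) (hX' : X.OrdConnected) (hf : IsParallelFrame γ ψ φ v (T ×ˢ X))
    (h : IsWaveMap γ (T ×ˢ X)) :
    ∃ ψ' φ' v', IsParallelFrame γ ψ' φ' v' (T ×ˢ X) ∧
      ∀ p ∈ T ×ˢ X, conT ψ' φ' p = 0 ∧
        vdt v' p = fun j => ⁅unitFrame n, frameT ψ' φ' p⁆ (Sum.inl ()) (Sum.inr j) := by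
  have hU := hT.prod hX
  obtain ⟨ψ', φ', v', hf', hτ, h1⟩ := exists_adapted_frame hn hT hT' hX hX' hf 0
    (fun Q ψ' φ' v' g hf' hg p hp => by simp) (by simp)
    (fun v p => by rw [map_zero, map_zero]; simp [IsOffDiag])
    (fun p hp => by rw [map_zero, add_zero]; exact (hf.isWaveMap_iff hU).1 h p hp)
  refine ⟨ψ', φ', v', hf', fun p hp => ⟨?_, ?_⟩⟩
  -- The adapted frame with N = 0 leaves ω_t scalar, and ω_t is traceless.
  · obtain ⟨τ, hτ⟩ := hτ p hp
    rw [map_zero, add_zero] at hτ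
    have h2 := hf'.conT_trace hU hp
    rw [hτ, Matrix.trace_smul, Matrix.trace_one, smul_eq_mul, mul_eq_zero] at h2
    rcases h2 with h2 | h2
    · rw [hτ, h2, zero_smul]
    · simp only [Fintype.card_sum, Fintype.card_unit, Fintype.card_fin] at h2
      exact absurd h2 (by exact_mod_cast (by omega : 1 + n ≠ 0))
  · rw [vdt_eq hf' hU hp (h1 p hp), map_zero, map_zero, sub_zero]

end WaveMaps

/-! ### Reduction of the `-1` flow to a hyperbolic equation -/

section Hyperbolic

variable {n : ℕ} {T X : Set ℝ} {U : Set (ℝ × ℝ)} {p : ℝ × ℝ} {γ ψ φ : ℝ × ℝ → Mat n}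
  {v : ℝ × ℝ → Fin n → ℂ}

lemma dot_comm {a b : Fin n → ℂ} : dot a b = dot b a := Finset.sum_congr rfl fun _ _ => mul_comm _ _

lemma dot_smul_left (c : ℂ) (a b : Fin n → ℂ) : dot (c • a) b = c * dot a b := by
  simp only [dot, Pi.smul_apply, smul_eq_mul, Finset.mul_sum, mul_assoc]

lemma dot_smul_right (c : ℂ) (a b : Fin n → ℂ) : dot a (c • b) = c * dot a b := by
  rw [dot_comm, dot_smul_left, dot_comm]

lemma dot_sub_left (a b c : Fin n → ℂ) : dot (a - b) c = dot a c - dot b c := by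
  simp only [dot, Pi.sub_apply, sub_mul, Finset.sum_sub_distrib]

lemma dot_star_self (a : Fin n → ℂ) : dot a (star a) = ((∑ j, ‖a j‖ ^ 2 : ℝ) : ℂ) := by
  simp only [dot, Pi.star_apply, Complex.star_def, Complex.mul_conj', Complex.ofReal_sum,
    Complex.ofReal_pow]

lemma dot_star_self_eq_zero {a : Fin n → ℂ} : dot a (star a) = 0 ↔ a = 0 := by
  rw [dot_star_self, Complex.ofReal_eq_zero, Finset.sum_eq_zero_iff_of_nonneg fun _ _ => by positivity]
  constructor
  · intro h; ext j; simpa using h j (Finset.mem_univ j)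
  · rintro rfl; simp

/-- The tensors `ā ⊗ b - b̄ ⊗ a`, `b̄ ⊗ b` and `1` can only be dependent with a vanishing
coefficient of the first one if `a`, `b` are linearly independent. -/
lemma coeff_eq_zero_of_linearIndependent {a b : Fin n → ℂ} (hab : LinearIndependent ℂ ![a, b])
    {c d e : ℂ} (h : ∀ i j, c * (star (a i) * b j - star (b i) * a j) - d * (star (b i) * b j) +
      e * (1 : Matrix (Fin n) (Fin n) ℂ) i j = 0) : c = 0 := by
  have hb : b ≠ 0 := hab.ne_zero 1
  have hρ : dot b (star b) ≠ 0 := fun h => hb (dot_star_self_eq_zero.1 h)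
  -- u is the component of a orthogonal to b. Contracting the tensor relation with u removes every
  -- term that begins with b̄.
  set μ : ℂ := dot a (star b) / dot b (star b) with hμ
  obtain ⟨u, hu⟩ : ∃ u : Fin n → ℂ, u = a - μ • b := ⟨_, rfl⟩
  have hub : dot u (star b) = 0 := by
    rw [hu, dot_sub_left, dot_smul_left, hμ, div_mul_cancel₀ _ hρ, sub_self]
  have hua : dot u (star a) = dot u (star u) := by
    have : star u = star a - star μ • star b := by
      rw [hu, star_sub, star_smul]
    rw [this, dot_comm (b := star a - _), dot_sub_left, dot_smul_left, dot_comm (b := u),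
      dot_comm (b := u), hub, mul_zero, sub_zero]
  have hsum (j : Fin n) : c * dot u (star a) * b j + e * u j = 0 := by
    have h1 : ∑ i, u i * (c * (star (a i) * b j - star (b i) * a j) - d * (star (b i) * b j) +
        e * (1 : Matrix (Fin n) (Fin n) ℂ) i j) = 0 :=
      Finset.sum_eq_zero fun i _ => by rw [h i j, mul_zero]
    have h2 : ∑ i, u i * (c * (star (a i) * b j - star (b i) * a j) - d * (star (b i) * b j) +
        e * (1 : Matrix (Fin n) (Fin n) ℂ) i j) = c * dot u (star a) * b j -
          dot u (star b) * (c * a j + d * b j) + e * ∑ i, u i * (1 : Matrix (Fin n) (Fin n) ℂ) i j := by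
      simp only [dot, Finset.mul_sum, Finset.sum_mul, ← Finset.sum_sub_distrib,
        ← Finset.sum_add_distrib, Pi.star_apply]
      exact Finset.sum_congr rfl fun i _ => by ring
    rw [h2, hub] at h1
    simpa [Matrix.one_apply] using h1
  -- A linear relation between a and b: its coefficients give e = 0 and c|u|² = 0, and u ≠ 0.
  have hvec : e • a + (c * dot u (star a) - e * μ) • b = 0 := by
    ext j
    have h1 := hsum j
    rw [hu] at h1 ⊢
    simp only [Pi.add_apply, Pi.smul_apply, Pi.sub_apply, Pi.zero_apply, smul_eq_mul] at h1 ⊢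
    linear_combination h1
  obtain ⟨h1, h2⟩ := LinearIndependent.pair_iff.1 hab _ _ hvec
  rw [h1, zero_mul, sub_zero, hua] at h2
  refine (mul_eq_zero.1 h2).resolve_right fun h0 => ?_
  have hu0 := dot_star_self_eq_zero.1 h0
  have h3 := (LinearIndependent.pair_iff.1 hab 1 (-μ) (by
    rw [← hu0, hu, one_smul, neg_smul, sub_eq_add_neg])).1
  exact one_ne_zero h3

lemma trace_outer (a b : Fin n → ℂ) : (outer a b).trace = dot a b := rfl

lemma outer_mul_outer (a b c d : Fin n → ℂ) : outer a b * outer c d = dot b c • outer a d := by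
  ext i j
  simp only [outer, Matrix.mul_apply, Matrix.of_apply, Matrix.smul_apply, dot, smul_eq_mul,
    Finset.sum_mul]
  exact Finset.sum_congr rfl fun _ _ => by ring

lemma trace_fromBlocks_add {l m R : Type*} [Fintype l] [Fintype m] [AddCommMonoid R]
    (A : Matrix l l R) (B : Matrix l m R) (C : Matrix m l R) (D : Matrix m m R) :
    (Matrix.fromBlocks A B C D).trace = A.trace + D.trace := by
  simp [Matrix.trace, Fintype.sum_sum_type]

lemma flowMatrix_trace (b : Fin n → ℂ) (h : ℂ) (M : Matrix (Fin n) (Fin n) ℂ) :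
    (flowMatrix b h M).trace = kappa n * (-(Complex.I * h) + M.trace) := by
  rw [flowMatrix, Matrix.trace_smul, trace_fromBlocks_add, smul_eq_mul]
  simp [Matrix.trace]

lemma flowMatrix_sq_trace (hn : 1 ≤ n) (b : Fin n → ℂ) (h : ℂ) (M : Matrix (Fin n) (Fin n) ℂ) :
    (flowMatrix b h M * flowMatrix b h M).trace =
      chi n * (-h ^ 2 - 2 * dot b (star b) + (M * M).trace) := by
  rw [flowMatrix, smul_mul_smul_comm, Matrix.trace_smul, Matrix.fromBlocks_multiply,
    trace_fromBlocks_add, smul_eq_mul, kappa_sq hn]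
  congr 1
  simp only [Matrix.trace_add, Matrix.trace, Matrix.diag, Matrix.mul_apply, Matrix.of_apply,
    Finset.univ_unique, Finset.sum_singleton, Matrix.add_apply, Matrix.neg_apply,
    Matrix.replicateRow_apply, Matrix.conjTranspose_apply, dot, Pi.star_apply, mul_neg, neg_mul,
    Finset.sum_neg_distrib, Finset.sum_add_distrib]
  have h1 : ∑ j, star (b j) * b j = ∑ j, b j * star (b j) :=
    Finset.sum_congr rfl fun _ _ => mul_comm _ _
  rw [h1]
  linear_combination h ^ 2 * Complex.I_mul_I

lemma metric_eq (h : IsSmoothLift ψ φ U) (hγ : ∀ q ∈ U, γ q = ψ q * (φ q)ᴴ) (hp : p ∈ U)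
    (y : ℝ × ℝ → Mat n) : metric (γ p) (frameVec ψ φ y p) (frameVec ψ φ y p) =
      -(1 / 2) * ((y p * y p).trace).re := by
  rw [metric, h.coframe_frameVec hγ hp]
  have h1 : φ p * y p * (φ p)ᴴ * (φ p * y p * (φ p)ᴴ) = φ p * (y p * y p) * (φ p)ᴴ := by
    calc _ = φ p * y p * ((φ p)ᴴ * φ p) * y p * (φ p)ᴴ := by noncomm_ring
      _ = _ := by rw [h.unitary_right p hp]; noncomm_ring
  rw [h1, Matrix.trace_mul_comm, ← mul_assoc, h.unitary_right p hp, one_mul]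

/-- The solutions of the `-1` flow equations for a frame with `ω_t = 0`. -/
structure IsWaveFrame (v : ℝ × ℝ → Fin n → ℂ) (b : ℝ × ℝ → Fin n → ℂ) (s : ℝ × ℝ → ℂ)
    (S : ℝ × ℝ → Matrix (Fin n) (Fin n) ℂ) (U : Set (ℝ × ℝ)) : Prop where
  smooth : ∀ j, ContDiffOn ℝ ∞ (fun q => b q j) U
  recursion : ∀ p ∈ U, recValue (v p) (Complex.I • vdx b p) (s p) (S p) = 0
  deriv : ∀ p ∈ U, ∀ i j, dx (fun q => S q i j) p = hsym star (star (v p)) (Complex.I • b p) i j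
  time : ∀ p ∈ U, vdt v p = -((chi n : ℂ) * Complex.I) • b p

lemma contDiffOn_ofReal {α : ℝ × ℝ → ℝ} (hα : ContDiffOn ℝ ∞ α U) :
    ContDiffOn ℝ ∞ (fun q => (α q : ℂ)) U :=
  Complex.ofRealCLM.contDiff.comp_contDiffOn hα

section Reduced

variable {b : ℝ × ℝ → Fin n → ℂ} {s : ℝ × ℝ → ℂ} {S : ℝ × ℝ → Matrix (Fin n) (Fin n) ℂ}
  {h α β : ℝ × ℝ → ℝ} (hw : IsWaveFrame v b s S U)
  (hs : ∀ q ∈ U, (h q : ℂ) = -2 * s q)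
  (hS : ∀ q ∈ U, -(Complex.I • S q) = ((α q : ℂ) * Complex.I) • outer (star (b q)) (b q) +
    ((β q : ℂ) * Complex.I) • 1)
include hS

lemma entry_of_ansatz {q : ℝ × ℝ} (hq : q ∈ U) (i j : Fin n) :
    S q i j = -((α q : ℂ) * (star (b q i) * b q j) +
      (β q : ℂ) * (1 : Matrix (Fin n) (Fin n) ℂ) i j) := by
  have h1 := congrFun (congrFun (hS q hq) i) j
  simp only [Matrix.neg_apply, Matrix.smul_apply, Matrix.add_apply, outer, Matrix.of_apply,
    Pi.star_apply, smul_eq_mul] at h1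
  have h2 : Complex.I * S q i j = Complex.I * -((α q : ℂ) * (star (b q i) * b q j) +
      (β q : ℂ) * (1 : Matrix (Fin n) (Fin n) ℂ) i j) := by linear_combination -h1
  exact mul_left_cancel₀ Complex.I_ne_zero h2

include hw hs

lemma IsWaveFrame.vdx_eq (hp : p ∈ U) (j : Fin n) : vdx b p j =
    -Complex.I * (((h p + β p : ℝ) : ℂ) * v p j + α p * dot (v p) (star (b p)) * b p j) := by
  have h1 := congrFun (hw.recursion p hp) j
  simp only [recValue, Pi.smul_apply, Pi.add_apply, Pi.zero_apply, smul_eq_mul,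
    Matrix.vecMul, dotProduct] at h1
  have h2 : ∑ i, v p i * S p i j = -(α p * dot (v p) (star (b p)) * b p j + β p * v p j) := by
    have h3 : ∑ i, v p i * S p i j = -(α p * dot (v p) (star (b p)) * b p j +
        β p * ∑ i, v p i * (1 : Matrix (Fin n) (Fin n) ℂ) i j) := by
      simp only [dot, Finset.mul_sum, Finset.sum_mul, ← Finset.sum_neg_distrib,
        ← Finset.sum_add_distrib, Pi.star_apply]
      refine Finset.sum_congr rfl fun i _ => ?_
      rw [entry_of_ansatz hS hp]; ring
    rw [h3]; simp [Matrix.one_apply]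
  rw [h2] at h1
  have h4 := (mul_eq_zero.1 h1).resolve_left Complex.I_ne_zero
  have h5 := hs p hp
  push_cast
  linear_combination (-Complex.I) * h4 + Complex.I * v p j * h5 + vdx b p j * Complex.I_mul_I

/-- Differentiate the ansatz for S along x, eliminate ∂_x h⊥ by `vdx_eq` and compare with the
prescribed derivative of S. The coefficient of v̄ ⊗ h⊥ - h̄⊥ ⊗ v is i(1 + α(h + β)); it vanishes by
linear independence of v and h⊥. -/
lemma IsWaveFrame.alpha_mul (hU : IsOpen U) (hα : ContDiffOn ℝ ∞ α U) (hβ : ContDiffOn ℝ ∞ β U)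
    (hp : p ∈ U) (hli : LinearIndependent ℂ ![v p, b p]) : α p * (h p + β p) = -1 := by
  have dα := differentiableAt_of_smooth (contDiffOn_ofReal hα) hU hp
  have dβ := differentiableAt_of_smooth (contDiffOn_ofReal hβ) hU hp
  have db (j : Fin n) := differentiableAt_of_smooth (hw.smooth j) hU hp
  have dsb (j : Fin n) := differentiableAt_of_smooth (contDiffOn_star (hw.smooth j)) hU hp
  set α' : ℂ := fderiv ℝ (fun q => (α q : ℂ)) p (0, 1)
  set β' : ℂ := fderiv ℝ (fun q => (β q : ℂ)) p (0, 1)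
  set k : ℂ := ((h p + β p : ℝ) : ℂ) with hk
  set z : ℂ := dot (v p) (star (b p)) with hz
  have hder (i j : Fin n) : dx (fun q => S q i j) p =
      -(α p * (star (b p i) * vdx b p j + star (vdx b p i) * b p j) + α' * (star (b p i) * b p j) +
        β' * (1 : Matrix (Fin n) (Fin n) ℂ) i j) := by
    rw [dx_congr hU hp fun q hq => entry_of_ansatz hS hq i j]
    have d1 := (dsb i).fun_mul (db j)
    rw [dx_eq_fderiv ((dα.fun_mul d1).fun_add (dβ.mul_const _)).fun_neg, fderiv_fun_neg, neg_apply,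
      fderiv_fun_add (dα.fun_mul d1) (dβ.mul_const _), add_apply, fderiv_fun_mul dα d1, add_apply,
      smul_apply, smul_apply, fderiv_mul_const dβ, smul_apply, fderiv_fun_mul (dsb i) (db j),
      add_apply, smul_apply, smul_apply, fderiv_star_apply]
    simp only [vdx, dx_eq_fderiv (db i), dx_eq_fderiv (db j), smul_eq_mul]
    ring
  have key := coeff_eq_zero_of_linearIndependent hli (c := Complex.I * (1 + α p * k))
    (d := -(α' + Complex.I * α p ^ 2 * (star z - z))) (e := β') fun i j => by
      have h1 := hw.deriv p hp i j
      have hsx : star (vdx b p i) = Complex.I * (k * star (v p i) + α p * star z * star (b p i)) := by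
        rw [hw.vdx_eq hs hS hp, ← hk, ← hz]
        simp only [star_mul', star_add, star_neg, Complex.star_def, Complex.conj_I,
          Complex.conj_ofReal, hk]
        ring
      have hx := hw.vdx_eq hs hS hp j
      rw [← hk, ← hz] at hx
      rw [hder, hsx, hx] at h1
      simp only [hsym, outer, Matrix.add_apply, Matrix.of_apply, Pi.star_apply, Pi.smul_apply,
        Function.comp_apply, star_star, smul_eq_mul, star_mul'] at h1
      simp only [Complex.star_def, Complex.conj_I] at h1 ⊢
      linear_combination -h1
  have h2 := (mul_eq_zero.1 key).resolve_left Complex.I_ne_zero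
  rw [hk] at h2
  have h3 : 1 + α p * (h p + β p) = 0 := by exact_mod_cast h2
  linarith

end Reduced

lemma trace_ansatz (a : Fin n → ℂ) (x y : ℂ) :
    ((x * Complex.I) • outer (star a) a + (y * Complex.I) • (1 : Matrix (Fin n) (Fin n) ℂ)).trace =
      Complex.I * (x * dot a (star a) + n * y) := by
  rw [Matrix.trace_add, Matrix.trace_smul, Matrix.trace_smul, trace_outer, Matrix.trace_one,
    dot_comm, Fintype.card_fin, smul_eq_mul, smul_eq_mul]
  ring

lemma trace_ansatz_sq (a : Fin n → ℂ) (x y : ℂ) :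
    (((x * Complex.I) • outer (star a) a + (y * Complex.I) • (1 : Matrix (Fin n) (Fin n) ℂ)) *
      ((x * Complex.I) • outer (star a) a + (y * Complex.I) • 1)).trace =
      -(x ^ 2 * dot a (star a) ^ 2 + 2 * x * y * dot a (star a) + n * y ^ 2) := by
  simp only [mul_add, add_mul, smul_mul_assoc, mul_smul_comm, outer_mul_outer, one_mul, mul_one,
    Matrix.trace_add, Matrix.trace_smul, trace_outer, Matrix.trace_one, smul_eq_mul,
    Fintype.card_fin, dot_comm (a := star a)]
  linear_combination (x ^ 2 * dot a (star a) ^ 2 + 2 * x * y * dot a (star a) + n * y ^ 2) *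
    Complex.I_mul_I

/-- The algebra of the reduction, with `ρ = |h⊥|²`. -/
lemma reduction_algebra (hn : 1 ≤ n) {h a b ρ : ℝ} (htr : h = a * ρ + n * b)
    (hm : (2 / chi n) ^ 2 = 1 / 2 * chi n * (h ^ 2 + 2 * ρ + (a ^ 2 * ρ ^ 2 + 2 * a * b * ρ + n * b ^ 2)))
    (hk : a * (h + b) = -1) : b ^ 2 = (2 / ((n + 1) * chi n)) ^ 2 := by
  have hn0 : (n : ℝ) ≠ 0 := by positivity
  have hn1 : (n : ℝ) + 1 ≠ 0 := by positivity
  have hc : chi n * n = 2 * (n + 1) := by rw [chi]; field_simp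
  have hχ := (chi_pos hn).ne'
  -- The trace condition and α(h + β) = -1 eliminate ρ from the norm of γ_t, which leaves a multiple
  -- of β².
  have h1 : h ^ 2 + 2 * ρ + (a ^ 2 * ρ ^ 2 + 2 * a * b * ρ + n * b ^ 2) = n * (n + 1) * b ^ 2 := by
    subst htr
    linear_combination (2 * ρ) * hk
  rw [h1] at hm
  have h2 : 4 = (n + 1) ^ 2 * b ^ 2 * chi n ^ 2 := by
    have h3 : 1 / 2 * chi n * (n * (n + 1) * b ^ 2) = (n + 1) ^ 2 * b ^ 2 := by
      linear_combination (1 / 2 * (n + 1) * b ^ 2) * hc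
    rw [h3] at hm
    field_simp at hm
    linarith
  field_simp
  linarith

end Hyperbolic

/-! ### The complex vector hyperbolic equation -/

section Reduction

variable {n : ℕ} {T X : Set ℝ} {U : Set (ℝ × ℝ)} {p : ℝ × ℝ} {γ ψ φ : ℝ × ℝ → Mat n}
  {v : ℝ × ℝ → Fin n → ℂ} {b : ℝ × ℝ → Fin n → ℂ} {s : ℝ × ℝ → ℂ}
  {S : ℝ × ℝ → Matrix (Fin n) (Fin n) ℂ} {h α β : ℝ × ℝ → ℝ}

lemma IsWaveFrame.vdx_vdt (hw : IsWaveFrame v b s S U) (hU : IsOpen U) (hp : p ∈ U) :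
    vdx (vdt v) p = -((chi n : ℂ) * Complex.I) • vdx b p := by
  ext j
  have h1 : dx (fun q => vdt v q j) p = dx (fun q => -((chi n : ℂ) * Complex.I) * b q j) p :=
    dx_congr hU hp fun q hq => congrFun (hw.time q hq) j
  have db := differentiableAt_of_smooth (hw.smooth j) hU hp
  change dx (fun q => vdt v q j) p = _ * dx (fun q => b q j) p
  rw [h1, dx_eq_fderiv (db.const_mul _), dx_eq_fderiv db, fderiv_const_mul db, smul_apply,
    smul_eq_mul]

/-- The right hand side of the hyperbolic equation, in terms of `ρ = |h⊥|²` and `w = v · h̄⊥`. -/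
lemma hyperbolic_rhs {σ c k a r ρ : ℝ} (hσ : σ ^ 2 = 1) (hr : r = -(σ * c * k) - 1)
    (hak : a * k = -1) (hk2 : k ^ 2 = -ρ - 2 * σ / c * k) (hc : c ≠ 0) (v b : Fin n → ℂ)
    (hρ : dot b (star b) = ρ) :
    (-((c : ℂ) * Complex.I)) • (-Complex.I • ((k : ℂ) • v + ((a : ℂ) * dot v (star b)) • b)) =
      (σ : ℂ) • (((1 + r : ℝ) : ℂ) • v -
        ((1 - r : ℝ) / dot (-((c : ℂ) * Complex.I) • b) (star (-((c : ℂ) * Complex.I) • b)) *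
          dot v (star (-((c : ℂ) * Complex.I) • b))) • (-((c : ℂ) * Complex.I) • b)) := by
  have hstar : star (-((c : ℂ) * Complex.I)) = (c : ℂ) * Complex.I := by
    simp [Complex.star_def]
  rw [star_smul, hstar, dot_smul_left, dot_smul_right, dot_smul_right, hρ]
  have hc' : (c : ℂ) ≠ 0 := by exact_mod_cast hc
  have hσ' : (σ : ℂ) ^ 2 = 1 := by exact_mod_cast hσ
  have hI := Complex.I_sq
  -- For ρ = 0 the quotient has denominator 0, but its vector factor h⊥ vanishes too, so the last
  -- term is absent.
  by_cases h0 : ρ = 0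
  · have hb : b = 0 := by
      rw [← dot_star_self_eq_zero, hρ, h0, Complex.ofReal_zero]
    subst hb
    ext j
    simp only [smul_zero, add_zero, sub_zero, Pi.smul_apply, smul_eq_mul, hr]
    push_cast
    linear_combination (c * k * v j : ℂ) * hI + (c * k * v j : ℂ) * hσ'
  · have h0' : (ρ : ℂ) ≠ 0 := by exact_mod_cast h0
    -- This matches the coefficients of h⊥. Multiplied by k ≠ 0 it becomes the quadratic equation
    -- for k, because ak = -1.
    have h3 : σ * (1 - r) = c * a * ρ := by
      have hk0 : k ≠ 0 := fun h => by simp [h] at hak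
      have h4 : c * k ^ 2 = -(c * ρ) - 2 * σ * k := by rw [hk2]; field_simp
      refine mul_right_cancel₀ hk0 ?_
      rw [hr]
      linear_combination c * k ^ 2 * hσ + h4 - c * ρ * hak
    have h3' : (σ : ℂ) * ((1 - r : ℝ) : ℂ) = c * a * ρ := by exact_mod_cast h3
    ext j
    simp only [Pi.smul_apply, Pi.sub_apply, Pi.add_apply, smul_eq_mul]
    have h5 : ((1 - r : ℝ) : ℂ) / (-((c : ℂ) * Complex.I) * ((c : ℂ) * Complex.I * ρ)) =
        ((1 - r : ℝ) : ℂ) / (c ^ 2 * ρ) := by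
      congr 1
      linear_combination (-(c : ℂ) ^ 2 * ρ) * hI
    rw [h5]
    have h6 : (σ : ℂ) * (((1 - r : ℝ) : ℂ) / (c ^ 2 * ρ)) = a / c := by
      rw [mul_div_assoc', h3']; field_simp
    have h7 : (c : ℂ) ^ 2 * (a / c) = c * a := by field_simp
    have h8 : (σ : ℂ) * ((1 + r : ℝ) : ℂ) = -(c * k) := by
      rw [hr]; push_cast; linear_combination (-(c * k : ℂ)) * hσ'
    set w := dot v (star b)
    linear_combination (c * (k * v j + a * w * b j) : ℂ) * hI - v j * h8 -
      (w * c ^ 2 * Complex.I ^ 2 * b j) * h6 - (w * b j * Complex.I ^ 2) * h7 - (c * a * w * b j) * hI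

theorem IsWaveFrame.hyperbolic (hn : 1 ≤ n) (hU : IsOpen U) (hc : IsPreconnected U)
    (hw : IsWaveFrame v b s S U) (hs : ∀ q ∈ U, (h q : ℂ) = -2 * s q)
    (hS : ∀ q ∈ U, -(Complex.I • S q) = ((α q : ℂ) * Complex.I) • outer (star (b q)) (b q) +
      ((β q : ℂ) * Complex.I) • 1)
    (hh : ContDiffOn ℝ ∞ h U) (hβ : ContDiffOn ℝ ∞ β U)
    (htr : ∀ q ∈ U, h q = α q * ∑ j, ‖b q j‖ ^ 2 + n * β q)
    (hm : ∀ q ∈ U, (2 / chi n) ^ 2 = 1 / 2 * chi n * (h q ^ 2 + 2 * ∑ j, ‖b q j‖ ^ 2 +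
      (α q ^ 2 * (∑ j, ‖b q j‖ ^ 2) ^ 2 + 2 * α q * β q * ∑ j, ‖b q j‖ ^ 2 + n * β q ^ 2)))
    (hk : ∀ q ∈ U, α q * (h q + β q) = -1) :
    ∃ (σ : ℝ) (r : ℝ × ℝ → ℝ), (σ = 1 ∨ σ = -1) ∧ ContDiffOn ℝ ∞ r U ∧ ∀ p ∈ U,
      β p = -σ * (2 / ((n + 1) * chi n)) ∧ α p * (h p + β p) = -1 ∧
      ((r p ^ 2 : ℝ) : ℂ) = 1 - dot (vdt v p) (star (vdt v p)) ∧
      vdx (vdt v) p = (σ : ℂ) • (((1 + r p : ℝ) : ℂ) • v p -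
        ((1 - r p : ℝ) / dot (vdt v p) (star (vdt v p)) * dot (v p) (star (vdt v p))) • vdt v p) := by
  have hχ := (chi_pos hn).ne'
  have hn1 : (n : ℝ) + 1 ≠ 0 := by positivity
  have hg : 2 / (((n : ℝ) + 1) * chi n) ≠ 0 := by positivity
  obtain ⟨σ, hσ, hβσ⟩ : ∃ σ : ℝ, (σ = 1 ∨ σ = -1) ∧
      ∀ p ∈ U, β p = -σ * (2 / ((n + 1) * chi n)) := by
    -- β² is a nonzero constant and β is continuous on a connected set, so its sign is constant; σ
    -- is the opposite sign.
    rcases hc.eq_or_eq_neg_of_sq_eq hβ.continuousOn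
      (continuousOn_const (c := 2 / (((n : ℝ) + 1) * chi n)))
      (fun p hp => reduction_algebra hn (htr p hp) (hm p hp) (hk p hp)) fun _ => hg with h1 | h1
    · exact ⟨-1, Or.inr rfl, fun p hp => by rw [h1 hp]; ring⟩
    · exact ⟨1, Or.inl rfl, fun p hp => by rw [h1 hp, Pi.neg_apply]; ring⟩
  have hσ2 : σ ^ 2 = 1 := by rcases hσ with rfl | rfl <;> norm_num
  -- The coefficient of v in v_tx is -χ(h + β); equating it to σ(1 + r) dictates r, and makes r
  -- smooth without any square root.
  refine ⟨σ, fun p => -(σ * chi n * (h p + β p)) - 1, hσ,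
    ((contDiffOn_const.mul (hh.add hβ)).neg).sub contDiffOn_const, fun p hp => ?_⟩
  -- The trace condition reads h + β = α|h⊥|² + (n + 1)β; multiplying by h + β and using α(h + β) =
  -- -1 gives a quadratic equation, which in terms of r is r² = 1 - |v_t|².
  have hk2 : (h p + β p) ^ 2 = -(∑ j, ‖b p j‖ ^ 2) - 2 * σ / chi n * (h p + β p) := by
    have h1 : 2 * σ / chi n = -((n + 1) * β p) := by
      rw [hβσ p hp]; field_simp
    rw [h1]
    have h2 : h p + β p = α p * ∑ j, ‖b p j‖ ^ 2 + (n + 1) * β p := by rw [htr p hp]; ring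
    linear_combination (h p + β p) * h2 + (∑ j, ‖b p j‖ ^ 2) * hk p hp
  refine ⟨hβσ p hp, hk p hp, ?_, ?_⟩
  · have h1 : (-(σ * chi n * (h p + β p)) - 1) ^ 2 = 1 - chi n ^ 2 * ∑ j, ‖b p j‖ ^ 2 := by
      have h3 : chi n * (h p + β p) ^ 2 = -(chi n * ∑ j, ‖b p j‖ ^ 2) - 2 * σ * (h p + β p) := by
        rw [hk2]; field_simp
      linear_combination chi n ^ 2 * (h p + β p) ^ 2 * hσ2 + chi n * h3
    have hstar : star (-((chi n : ℂ) * Complex.I)) = (chi n : ℂ) * Complex.I := by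
      simp [Complex.star_def]
    rw [h1, hw.time p hp, star_smul, hstar, dot_smul_left, dot_smul_right, dot_star_self]
    push_cast
    linear_combination (-(chi n : ℂ) ^ 2 * ∑ j, (‖b p j‖ : ℂ) ^ 2) * Complex.I_sq
  · have h1 : vdx b p = -Complex.I • (((h p + β p : ℝ) : ℂ) • v p +
        ((α p : ℂ) * dot (v p) (star (b p))) • b p) := by
      ext j
      rw [hw.vdx_eq hs hS hp]
      rfl
    rw [hw.vdx_vdt hU hp, h1, hw.time p hp]
    exact hyperbolic_rhs hσ2 rfl (hk p hp) hk2 hχ _ _ (dot_star_self _)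

/-- In the frame with ω_t = 0 the scalar hypotheses of the reduction are the tracelessness of e_t
and the norm of γ_t, both expanded with the ansatz for 𝐡; h is real because e_t is skew-Hermitian.
-/
theorem IsParallelFrame.exists_hyperbolic_frame (hn : 1 ≤ n) (hT : IsOpen T) (hT' : T.OrdConnected)
    (hX : IsOpen X) (hX' : X.OrdConnected) (hf : IsParallelFrame γ ψ φ v (T ×ˢ X))
    (h : IsWaveMap γ (T ×ˢ X)) :
    ∃ ψ' φ' v', IsParallelFrame γ ψ' φ' v' (T ×ˢ X) ∧
      ∃ (hperp : ℝ × ℝ → Fin n → ℂ) (h : ℝ × ℝ → ℝ) (hmat : ℝ × ℝ → Matrix (Fin n) (Fin n) ℂ),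
        (∀ p ∈ T ×ˢ X, frameT ψ' φ' p = flowMatrix (hperp p) (h p) (hmat p) ∧
          conT ψ' φ' p = 0 ∧ vdt v' p = -((chi n : ℂ) * Complex.I) • hperp p) ∧
        ∀ α β : ℝ × ℝ → ℝ, ContDiffOn ℝ ∞ α (T ×ˢ X) → ContDiffOn ℝ ∞ β (T ×ˢ X) →
          (∀ p ∈ T ×ˢ X, metric (γ p) (mdt γ p) (mdt γ p) = (2 / chi n) ^ 2 ∧
            hmat p = ((α p : ℂ) * Complex.I) • outer (star (hperp p)) (hperp p) +
              ((β p : ℂ) * Complex.I) • 1 ∧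
            (LinearIndependent ℂ ![v' p, hperp p] ∨ α p * (h p + β p) = -1)) →
          ∃ (σ : ℝ) (r : ℝ × ℝ → ℝ), (σ = 1 ∨ σ = -1) ∧ ContDiffOn ℝ ∞ r (T ×ˢ X) ∧
            ∀ p ∈ T ×ˢ X, β p = -σ * (2 / ((n + 1) * chi n)) ∧ α p * (h p + β p) = -1 ∧
              ((r p ^ 2 : ℝ) : ℂ) = 1 - dot (vdt v' p) (star (vdt v' p)) ∧
              vdx (vdt v') p = (σ : ℂ) • (((1 + r p : ℝ) : ℂ) • v' p -
                ((1 - r p : ℝ) / dot (vdt v' p) (star (vdt v' p)) *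
                  dot (v' p) (star (vdt v' p))) • vdt v' p) := by
  have hU := hT.prod hX
  have hk := kappa_ne_zero hn
  obtain ⟨ψ', φ', v', hf', hv⟩ := hf.exists_wave_frame hn hT hT' hX hX' h
  obtain ⟨b, s, S, hb, hs, hS, he⟩ := hf'.exists_blockMat hU hn
  have hreal (q) (hq : q ∈ T ×ˢ X) : (((-2 * s q).re : ℝ) : ℂ) = -2 * s q := by
    have h1 := hf'.frameT_conjTranspose hU hq
    rw [he q hq, Matrix.conjTranspose_smul, Complex.star_def, Complex.conj_ofReal, ← smul_neg] at h1
    have h2 := (blockMat_skew (smul_right_injective _ hk h1)).1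
    rw [← Complex.conj_eq_iff_re, map_mul, map_neg, map_ofNat, ← Complex.star_def, h2]
  have he' (q) (hq : q ∈ T ×ˢ X) : frameT ψ' φ' q =
      flowMatrix (b q) ((-2 * s q).re : ℝ) (-(Complex.I • S q)) := by
    rw [he q hq, hreal q hq, flowMatrix_eq_blockMat]
  have htime (q) (hq : q ∈ T ×ˢ X) : vdt v' q = -((chi n : ℂ) * Complex.I) • b q := by
    rw [(hv q hq).2]
    ext j
    rw [unitFrame_lie, Matrix.smul_apply, (lie_projMat_apply _).2.1, he q hq, ← kappa_sq hn]
    simp only [Matrix.smul_apply, blockMat, Matrix.fromBlocks_apply₁₂, Matrix.replicateRow_apply,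
      smul_eq_mul, Pi.smul_apply]
    ring
  have hw : IsWaveFrame v' b s S (T ×ˢ X) := by
    have h0 : (0 : Mat n) = blockMat 0 0 0 := by
      rw [← offMat_eq_blockMat]; ext (i | i) (j | j) <;> simp [offMat]
    have hlie : ⁅unitFrame n, (0 : Mat n)⁆ = 0 := by rw [Ring.lie_def, mul_zero, zero_mul, sub_zero]
    have key (p) (hp : p ∈ T ×ˢ X) := by
      have h1 := hf'.covD_frameT hU hn hp hb hs hS he
      rw [hf'.matD_frameT hU hp, (hv p hp).1, hlie, neg_zero, eq_comm,
        smul_eq_zero_iff_right hk, h0] at h1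
      exact blockMat_inj h1
    exact ⟨hb, fun p hp => neg_eq_zero.1 (key p hp).1,
      fun p hp i j => congrFun (congrFun (sub_eq_zero.1 (key p hp).2.2) i) j, htime⟩
  have hsmooth : ContDiffOn ℝ ∞ (fun q => (-2 * s q).re) (T ×ˢ X) :=
    Complex.reCLM.contDiff.comp_contDiffOn (contDiffOn_const.mul hs)
  refine ⟨ψ', φ', v', hf', b, fun q => (-2 * s q).re, fun q => -(Complex.I • S q),
    fun q hq => ⟨he' q hq, (hv q hq).1, htime q hq⟩, fun α β hα hβ hyp => ?_⟩
  have hans (q) (hq : q ∈ T ×ˢ X) : -(Complex.I • S q) =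
      ((α q : ℂ) * Complex.I) • outer (star (b q)) (b q) + ((β q : ℂ) * Complex.I) • 1 :=
    (hyp q hq).2.1
  refine hw.hyperbolic hn hU (hT'.isPreconnected.prod hX'.isPreconnected) hreal
    hans hsmooth hβ ?_ ?_ fun q hq => (hyp q hq).2.2.elim
      (hw.alpha_mul hreal hans hU hα hβ hq) id
  · intro q hq
    have h1 := hf'.frameT_trace hU hq
    rw [he' q hq, flowMatrix_trace, hans q hq, trace_ansatz, dot_star_self, mul_eq_zero] at h1
    have h2 := h1.resolve_left hk
    have h3 : Complex.I * (((-2 * s q).re : ℝ) : ℂ) =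
        Complex.I * ((α q * ∑ j, ‖b q j‖ ^ 2 + n * β q : ℝ) : ℂ) := by
      push_cast at h2 ⊢
      linear_combination -h2
    exact_mod_cast mul_left_cancel₀ Complex.I_ne_zero h3
  · intro q hq
    rw [← (hyp q hq).1, hf'.mdt_curve hU hq, metric_eq (hf'.isSmoothLift hU) hf'.lift hq, he' q hq,
      flowMatrix_sq_trace hn, hans q hq, trace_ansatz_sq, dot_star_self]
    have h1 (x y z a c ρ m : ℝ) : ((c : ℂ) * (-(x : ℂ) ^ 2 - 2 * (ρ : ℂ) +
        -((a : ℂ) ^ 2 * (ρ : ℂ) ^ 2 + 2 * a * z * ρ + m * (z : ℂ) ^ 2))).re =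
        c * (-x ^ 2 - 2 * ρ + -(a ^ 2 * ρ ^ 2 + 2 * a * z * ρ + m * z ^ 2)) := by
      rw [← Complex.ofReal_re (c * _)]; push_cast; rfl
    have h2 := h1 (-2 * s q).re 0 (β q) (α q) (chi n) (∑ j, ‖b q j‖ ^ 2) n
    rw [Complex.ofReal_natCast] at h2
    rw [h2]
    ring

end Reduction

end SUCurveFlow

end

open SUCurveFlow in
theorem theorem3 (n : ℕ) (hn : 1 ≤ n) :
    IsHamiltonianPair (opH n) (opI n) ∧
    ∃ (𝓗 : Hierarchy n) (F : ℕ → DiffPoly n) (f : ℕ → FreeAlgebra ℂ ℕ),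
      -- the flows on `v` are bi-Hamiltonian
      (∀ k, jconj n (F k) = F k ∧ varDeriv (F k) = -𝓗.h k) ∧
      (∀ k,
        opH n (varDeriv (F (k + 1) - (chi n : ℂ) • (if k = 0 then 0 else F (k - 1))))
          (𝓗.flow k) ∧
        opI n (-varDeriv (F (k + 2) - (chi n : ℂ) • F k)) (𝓗.flow k)) ∧
      -- the odd and even flows on `γ` are analogs of order `k + 1` of the first two
      (∀ m, SameLeading (2 * m + 1) (f (2 * m))
        (((-1) ^ m * (kappa n : ℂ)⁻¹) • ⁅FreeAlgebra.ι ℂ 0, FreeAlgebra.ι ℂ (2 * m + 1)⁆)) ∧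
      (∀ m, SameLeading (2 * m + 2) (f (2 * m + 1))
        (((-1) ^ m : ℂ) • FreeAlgebra.ι ℂ (2 * m + 2))) ∧
      ∀ (T X : Set ℝ), IsOpen T → T.OrdConnected → IsOpen X → X.OrdConnected →
      ∀ (γ ψ φ : ℝ × ℝ → Mat n) (v : ℝ × ℝ → Fin n → ℂ),
        IsNonStretchingFlow γ (T ×ˢ X) → IsParallelFrame γ ψ φ v (T ×ˢ X) →
        -- `v` gives the components of the principal normal `∇_x γ_x` in the frame
        (∀ p ∈ T ×ˢ X, (φ p)ᴴ * coframe (γ p) (covX γ (mdx γ) p) * φ p =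
          flowMatrix (Complex.I • v p) 0 0) ∧
        -- `0` flow
        (IsZeroFlow ψ φ (T ×ˢ X) ↔ ∀ p ∈ T ×ˢ X, mdt γ p = mdx γ p) ∧
        ((∀ p ∈ T ×ˢ X, mdt γ p = mdx γ p) →
          ∃ ψ' φ' v', IsParallelFrame γ ψ' φ' v' (T ×ˢ X) ∧
            ∀ p ∈ T ×ˢ X, vdt v' p = vdx v' p) ∧
        -- `+(k+1)` flow
        (∀ k,
          (IsFlow 𝓗 k ψ φ v (T ×ˢ X) ↔ IsGeometricMap (f k) γ (T ×ˢ X)) ∧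
          (IsFlow 𝓗 k ψ φ v (T ×ˢ X) →
            ∃ ψ' φ' v', IsParallelFrame γ ψ' φ' v' (T ×ˢ X) ∧
              IsFlow 𝓗 k ψ' φ' v' (T ×ˢ X) ∧
              ∀ p ∈ T ×ˢ X, vdt v' p = fun j => evalJet v' p (𝓗.flow k j))) ∧
        -- `+1` flow
        (IsFlow 𝓗 0 ψ φ v (T ×ˢ X) ↔ IsSchrodingerMap γ (T ×ˢ X)) ∧
        (IsSchrodingerMap γ (T ×ˢ X) →
          ∃ ψ' φ' v', IsParallelFrame γ ψ' φ' v' (T ×ˢ X) ∧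
            ∀ p ∈ T ×ˢ X, Complex.I • vdt v' p =
              vdx (vdx v') p + (2 * dot (v' p) (star (v' p))) • v' p + (chi n : ℂ) • v' p) ∧
        -- `+2` flow
        (IsFlow 𝓗 1 ψ φ v (T ×ˢ X) ↔ IsMKdVMap γ (T ×ˢ X)) ∧
        (IsMKdVMap γ (T ×ˢ X) →
          ∃ ψ' φ' v', IsParallelFrame γ ψ' φ' v' (T ×ˢ X) ∧
            ∀ p ∈ T ×ˢ X, vdt v' p =
              vdx (vdx (vdx v')) p + (3 * dot (v' p) (star (v' p))) • vdx v' p +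
                (3 * dot (vdx v' p) (star (v' p))) • v' p + (chi n : ℂ) • vdx v' p) ∧
        -- `-1` flow
        (IsMinusOneFlow ψ φ v (T ×ˢ X) ↔ IsWaveMap γ (T ×ˢ X)) ∧
        (IsWaveMap γ (T ×ˢ X) →
          ∃ ψ' φ' v', IsParallelFrame γ ψ' φ' v' (T ×ˢ X) ∧
            ∃ (hperp : ℝ × ℝ → Fin n → ℂ) (h : ℝ × ℝ → ℝ)
              (hmat : ℝ × ℝ → Matrix (Fin n) (Fin n) ℂ),
              (∀ p ∈ T ×ˢ X,
                frameT ψ' φ' p = flowMatrix (hperp p) (h p) (hmat p) ∧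
                conT ψ' φ' p = 0 ∧
                vdt v' p = -((chi n : ℂ) * Complex.I) • hperp p) ∧
              -- reduction of the nonlocal terms, with `t` scaled so that `|γ_t| = 2/χ`
              ∀ α β : ℝ × ℝ → ℝ,
                ContDiffOn ℝ ∞ α (T ×ˢ X) → ContDiffOn ℝ ∞ β (T ×ˢ X) →
                (∀ p ∈ T ×ˢ X,
                  metric (γ p) (mdt γ p) (mdt γ p) = (2 / chi n) ^ 2 ∧
                  hmat p = ((α p : ℂ) * Complex.I) • outer (star (hperp p)) (hperp p) +
                    ((β p : ℂ) * Complex.I) • 1 ∧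
                  (LinearIndependent ℂ ![v' p, hperp p] ∨ α p * (h p + β p) = -1)) →
                ∃ (σ : ℝ) (r : ℝ × ℝ → ℝ), (σ = 1 ∨ σ = -1) ∧ ContDiffOn ℝ ∞ r (T ×ˢ X) ∧
                  ∀ p ∈ T ×ˢ X,
                    β p = -σ * (2 / ((n + 1) * chi n)) ∧
                    α p * (h p + β p) = -1 ∧
                    ((r p ^ 2 : ℝ) : ℂ) = 1 - dot (vdt v' p) (star (vdt v' p)) ∧
                    vdx (vdt v') p = (σ : ℂ) •
                      (((1 + r p : ℝ) : ℂ) • v' p -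
                        ((1 - r p : ℝ) / dot (vdt v' p) (star (vdt v' p)) *
                          dot (v' p) (star (vdt v' p))) • vdt v' p)) := by
  obtain ⟨f, hfe, hfo, hf⟩ := exists_geometric hn
  refine ⟨isHamiltonianPair_opH_opI n, jetHierarchy n, jetHam n, f,
    fun k => ⟨star_jetHam k, varDeriv_jetHam k⟩, jetHierarchy_biHamiltonian, hfe, hfo,
    fun T X hT hT' hX hX' γ ψ φ v _ h => ?_⟩
  have hU := hT.prod hX
  exact ⟨fun p hp => h.principalNormal hU hp, h.isZeroFlow_iff hU,
    h.exists_zeroFlow_frame hn hT hT' hX hX',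
    fun k => ⟨h.isFlow_iff_isGeometricMap hU (hf k), h.exists_flow_frame hn hT hT' hX hX'⟩,
    h.isFlow_iff_isSchrodingerMap hU hn, h.exists_schrodinger_frame hn hT hT' hX hX',
    h.isFlow_iff_isMKdVMap hU hn, h.exists_mKdV_frame hn hT hT' hX hX',
    h.isMinusOneFlow_iff hU hn, h.exists_hyperbolic_frame hn hT hT' hX hX'⟩
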